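/- Let $R$ be a complete discrete valuation ring with fraction field $K$ and algebraically closed residue field of characteristic $p>0$, let $\pi$ be a uniformizer of $R$ and $S=\operatorname{Spec}R$. For an $R$-scheme $\mathcal Y$, let $\mathcal Y^\dagger$ be the log scheme $\mathcal Y$ with the (Zariski) divisorial log structure $\mathcal M=\mathcal O_{\mathcal Y}\cap j_*\mathcal O_{\mathcal Y_K}^\times$ induced by its special fibre, where $j:\mathcal Y_K\to\mathcal Y$ is the inclusion of the generic fibre. Let $\mathcal X$ be a proper, flat $R$-scheme with smooth generic fibre, and suppose that $\mathcal X^\dagger$ is log regular in the sense of Kato (in particular fs). For $y\in\mathcal X$ let $I(y,\mathcal M)\subseteq\mathcal O_{\mathcal X,y}$ be the ideal generated by the image of $\mathcal M_y\setminus\mathcal M_y^\times$. The fan $F(\mathcal X)$ is the set of $x\in\mathcal X$ with $I(x,\mathcal M)=\mathfrak m_x$. For $x\in F(\mathcal X)$, let $U(x)$ be the set of $y\in\mathcal X$ such that the prime ideal $I(y,\mathcal M)$ of $\mathcal O_{\mathcal X,y}$ corresponds to the point $x$ of $\mathcal X$. Let $F(\mathcal X)^{(1)}$ be the set of $y\in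 F(\mathcal X)$ of height $1$, i.e. such that the monoid $\mathcal M_y^\sharp=\mathcal M_y/\mathcal M_y^\times$ has dimension $1$; then $\mathcal M_y^\sharp\cong\mathbf N$, and the saturation index $s(y)$ is the image of $\pi$ in $\mathbf N$. For $d\ge 1$ put $S(d)=\operatorname{Spec}R[T]/(T^d-\pi)$, and let $\mathcal X(d)^\dagger=\mathcal X^\dagger\times^{\mathrm{fs}}_{S^\dagger}S(d)^\dagger$ be the fibre product in the category of fs log schemes. Let $x\in F(\mathcal X)$ and let $d\ge 1$ be an integer prime to $p$. Then $U(x)$ is locally closed in $\mathcal X$, and, with reduced scheme structures on both sides, the inverse image of $U(x)$ in $\mathcal X(d)^\dagger$ is a finite étale cover of $U(x)$ of constant degree. This degree divides $d$, and it divides $s(y)$ for every $y\in F(\mathcal X)^{(1)}$ that is a generization of $x$; that is, it divides $\gcd_y s(y)$ (where the gcd of the empty family is $0$). -/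

import Mathlib

open CategoryTheory AlgebraicGeometry TopologicalSpace Opposite

universe u

noncomputable section

/-! ### Commutative monoids -/

/-- The largest commutative quotient of a monoid, used only to obtain colimits (and hence stalks)
in the category of commutative monoids. -/
def MonCat.commCon (A : MonCat.{u}) : Con A :=
  conGen fun a b => ∃ c d : A, a = c * d ∧ b = d * c

instance MonCat.commConCommMonoid (A : MonCat.{u}) : CommMonoid A.commCon.Quotient where
  mul_comm a b := by
    induction a using Con.induction_on with
    | H a =>
      induction b using Con.induction_on with
      | H b =>
        rw [← Con.coe_mul, ← Con.coe_mul]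
        exact (Con.eq _).2 (ConGen.Rel.of _ _ ⟨a, b, rfl, rfl⟩)

/-- Maps out of the commutative quotient. -/
def MonCat.commConHomEquiv (A : MonCat.{u}) (B : CommMonCat.{u}) :
    (CommMonCat.of A.commCon.Quotient ⟶ B) ≃ (A ⟶ (forget₂ CommMonCat MonCat).obj B) where
  toFun g := MonCat.ofHom (g.hom.comp A.commCon.mk')
  invFun g := CommMonCat.ofHom (Con.lift A.commCon (show A →* B from g.hom) (Con.conGen_le.2 (by
    rintro a b ⟨c, d, rfl, rfl⟩
    change g.hom (c * d) = g.hom (d * c)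
    rw [map_mul, map_mul]
    exact mul_comm (G := B) _ _)))
  left_inv g := by
    ext x
    rfl
  right_inv g := by
    ext x
    rfl

instance CommMonCat.forget₂Reflective : Reflective (forget₂ CommMonCat.{u} MonCat.{u}) where
  L := Adjunction.leftAdjointOfEquiv (F_obj := fun A => CommMonCat.of A.commCon.Quotient)
    (fun A B => MonCat.commConHomEquiv A B) (by intros; rfl)
  adj := Adjunction.adjunctionOfEquivLeft _ _

instance CommMonCat.hasColimits : Limits.HasColimits CommMonCat.{u} :=
  hasColimits_of_reflective (forget₂ CommMonCat.{u} MonCat.{u})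

/-- An *fs* monoid: a commutative monoid, written multiplicatively, that is finitely generated,
integral (cancellative) and saturated in its group envelope. For `a b : P` the element `a / b` of
the group envelope lies in `P` iff `b ∣ a`, and `(a / b) ^ n` lies in `P` iff `b ^ n ∣ a ^ n`. -/
structure IsFsMonoid (P : Type u) [CommMonoid P] : Prop where
  fg : Monoid.FG P
  integral : ∀ a b c : P, a * b = a * c → b = c
  saturated : ∀ (a b : P) (n : ℕ), 0 < n → b ^ n ∣ a ^ n → b ∣ a

/-- The faces of a commutative monoid, ordered by inclusion. They are the complements of the
prime ideals. -/
abbrev MonoidFace (P : Type u) [CommMonoid P] : Type u :=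
  {F : Submonoid P // ∀ a b : P, a * b ∈ F → a ∈ F ∧ b ∈ F}

/-- The dimension of a commutative monoid: the supremum of the lengths of chains of prime ideals
or, passing to complements, of chains of faces. -/
def monoidDim (P : Type u) [CommMonoid P] : WithBot ℕ∞ :=
  Order.krullDim (MonoidFace P)

/-- The rank of the group envelope of a commutative monoid. -/
def monoidRank (P : Type u) [CommMonoid P] : ℕ :=
  Module.finrank ℤ (Additive (Algebra.GrothendieckGroup P))

open Classical in
/-- If `P ≅ ℕ`, the natural number corresponding to `a` (the isomorphism is unique);
by convention `0` if `P` is not isomorphic to `ℕ`. -/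
def monoidOrder (P : Type u) [CommMonoid P] (a : P) : ℕ :=
  if h : Nonempty (P ≃* Multiplicative ℕ) then Multiplicative.toAdd (h.some a) else 0

/-! ### Log structures and log schemes (on the Zariski site) -/

/-- A log structure on a scheme `X`: a sheaf of commutative monoids `M` on `X` with a morphism `α`
to the multiplicative monoid of the structure sheaf that restricts to an isomorphism from the
inverse image of the sheaf of units to the sheaf of units. -/
structure LogStructure (X : Scheme.{u}) where
  M : TopCat.Presheaf CommMonCat.{u} X
  isSheaf : M.IsSheaf
  α : M ⟶ X.presheaf ⋙ forget₂ CommRingCat.{u} CommMonCat.{u}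
  existsUnique_unit : ∀ (U : X.Opens) (v : Γ(X, U)), IsUnit v →
    ∃! m : M.obj (op U), (α.app (op U)).hom m = v

namespace LogStructure

variable {X : Scheme.{u}} (L : LogStructure X)

/-- The map `α` on sections over `U`. -/
def toΓ (U : X.Opens) : L.M.obj (op U) →* Γ(X, U) := (L.α.app (op U)).hom

/-- The stalk of the sheaf of monoids at `x`. -/
abbrev stalk (x : X) : Type u := (L.M.stalk x : CommMonCat.{u})

/-- The map from sections over `U` to the stalk at `x ∈ U`. -/
def germ (U : X.Opens) (x : X) (hx : x ∈ U) : L.M.obj (op U) →* L.stalk x :=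
  (L.M.germ U x hx).hom

/-- The stalk at `x` of the characteristic sheaf `M / 𝒪ˣ`. Since `α` identifies `Mˣ` with `𝒪ˣ`,
this is the quotient of the stalk of `M` by its group of units. -/
abbrev charStalk (x : X) : Type u := Associates (L.stalk x)

/-- A homomorphism `β : P → Γ(U, M)` is a *chart* if the log structure on `U` associated with the
prelog structure `P → Γ(U, M) → Γ(U, 𝒪)` maps isomorphically to `M|_U`. This is expressed on
stalks: the stalk at `y` of the associated log structure is the amalgamated sum
of `P` and `𝒪_yˣ = M_yˣ` over the submonoid of elements of `P` that become units at `y`, and the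
two clauses say that its map to `M_y` is surjective and injective. -/
def IsChart (U : X.Opens) {P : Type u} [CommMonoid P] (β : P →* L.M.obj (op U)) : Prop :=
  ∀ (y : X) (hy : y ∈ U),
    (∀ m : L.stalk y, ∃ (p : P) (v : (L.stalk y)ˣ), L.germ U y hy (β p) * v = m) ∧
    (∀ (p q : P) (v : (L.stalk y)ˣ), L.germ U y hy (β p) * v = L.germ U y hy (β q) →
      ∃ a b : P, IsUnit (L.germ U y hy (β a)) ∧ IsUnit (L.germ U y hy (β b)) ∧
        p * a = q * b ∧ v * L.germ U y hy (β b) = L.germ U y hy (β a))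

/-- A log structure is *fs* if it admits charts by fs monoids locally. -/
def IsFs : Prop :=
  ∀ x : X, ∃ U : X.Opens, x ∈ U ∧ ∃ (P : Type u) (_ : CommMonoid P) (β : P →* L.M.obj (op U)),
    IsFsMonoid P ∧ L.IsChart U β

/-- The ideal `I(x, M)` of `𝒪_x` generated by (the image under `α` of) the non-units of `M_x`. -/
def logIdeal (x : X) : Ideal (X.presheaf.stalk x) :=
  Ideal.span {a | ¬ IsUnit a ∧
    ∃ (U : X.Opens) (hx : x ∈ U) (m : L.M.obj (op U)), X.presheaf.germ U x hx (L.toΓ U m) = a}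

/-- Log regularity in the sense of Kato (including the requirement that the log structure be
fs). -/
def IsLogRegular : Prop :=
  L.IsFs ∧ ∀ x : X, IsRegularLocalRing (X.presheaf.stalk x ⧸ L.logIdeal x) ∧
    ringKrullDim (X.presheaf.stalk x) =
      ringKrullDim (X.presheaf.stalk x ⧸ L.logIdeal x) + (monoidRank (L.charStalk x) : WithBot ℕ∞)

/-- The set of points of the fan: the points `x` with `I(x, M) = 𝔪_x`. -/
def fan : Set X := {x | L.logIdeal x = IsLocalRing.maximalIdeal (X.presheaf.stalk x)}

/-- The height of a point of the fan: the dimension of the stalk of the characteristic sheaf. -/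
def height (x : X) : WithBot ℕ∞ := monoidDim (L.charStalk x)

/-- The logarithmic stratum `U(x) = π⁻¹(x)`, where the characteristic morphism `π` maps `y` to the
point of `X` corresponding to the prime ideal `I(y, M)` of `𝒪_y`. -/
def stratum (x : X) : Set X :=
  {y | ∃ h : (L.logIdeal y).IsPrime, X.fromSpecStalk y ⟨L.logIdeal y, h⟩ = x}

end LogStructure

/-- A log scheme. -/
structure LogScheme where
  scheme : Scheme.{u}
  log : LogStructure scheme

namespace LogScheme

/-- A morphism of log schemes `X ⟶ Y`: a morphism `f` of schemes with a morphism of sheaves of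
monoids `M_Y ⟶ f_* M_X` compatible with `𝒪_Y ⟶ f_* 𝒪_X`. -/
structure Hom (X Y : LogScheme.{u}) where
  base : X.scheme ⟶ Y.scheme
  comap (U : Y.scheme.Opens) : Y.log.M.obj (op U) →* X.log.M.obj (op (base ⁻¹ᵁ U))
  comap_res : ∀ {U V : Y.scheme.Opens} (i : U ⟶ V) (m : Y.log.M.obj (op V)),
    comap U (Y.log.M.map i.op m) = X.log.M.map ((Opens.map base.base).map i).op (comap V m)
  toΓ_comap : ∀ (U : Y.scheme.Opens) (m : Y.log.M.obj (op U)),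
    X.log.toΓ (base ⁻¹ᵁ U) (comap U m) = base.app U (Y.log.toΓ U m)

/-- The identity morphism. -/
def Hom.id (X : LogScheme.{u}) : Hom X X where
  base := 𝟙 X.scheme
  comap U := MonoidHom.id (X.log.M.obj (op U))
  comap_res i m := rfl
  toΓ_comap U m := by
    have h : (𝟙 X.scheme : X.scheme ⟶ X.scheme).app U (X.log.toΓ U m) = X.log.toΓ U m := by
      rw [Scheme.Hom.id_app]; rfl
    exact h.symm

/-- Composition of morphisms. -/
def Hom.comp {X Y Z : LogScheme.{u}} (f : Hom X Y) (g : Hom Y Z) : Hom X Z where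
  base := f.base ≫ g.base
  comap U := (f.comap (g.base ⁻¹ᵁ U)).comp (g.comap U)
  comap_res {U V} i m :=
    (congrArg (f.comap (g.base ⁻¹ᵁ U)) (g.comap_res i m)).trans
      (f.comap_res ((Opens.map g.base.base).map i) (g.comap V m))
  toΓ_comap U m := by
    have h : (f.base ≫ g.base).app U (Z.log.toΓ U m) =
        f.base.app (g.base ⁻¹ᵁ U) (g.base.app U (Z.log.toΓ U m)) := by
      rw [Scheme.Hom.comp_app]; rfl
    exact (f.toΓ_comap (g.base ⁻¹ᵁ U) (g.comap U m)).trans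
      ((congrArg (f.base.app (g.base ⁻¹ᵁ U)) (g.toΓ_comap U m)).trans h.symm)

instance : Category LogScheme.{u} where
  Hom := Hom
  id := Hom.id
  comp := Hom.comp

/-- The fibre product `Y = X ×_S Z` in the category of fs log schemes, for a cospan `f`, `g` of
(fs) log schemes: `Y` is an fs log scheme with the universal property of the fibre product with
respect to all fs log schemes. -/
structure IsFsPullback {Y X Z S : LogScheme.{u}} (fst : Y ⟶ X) (snd : Y ⟶ Z) (f : X ⟶ S)
    (g : Z ⟶ S) : Prop where
  isFs : Y.log.IsFs
  w : fst ≫ f = snd ≫ g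
  existsUnique_lift : ∀ (T : LogScheme.{u}), T.log.IsFs → ∀ (a : T ⟶ X) (b : T ⟶ Z),
    a ≫ f = b ≫ g → ∃! l : T ⟶ Y, l ≫ fst = a ∧ l ≫ snd = b

end LogScheme

/-! ### Divisorial log structures -/

section Divisorial

variable (X : Scheme.{u}) (W : X.Opens)

/-- The sections over `U` of `𝒪_X ∩ j_* 𝒪_Wˣ`, where `j : W → X` is the inclusion: the functions on
`U` that are invertible on `U ∩ W`. -/
def divisorialSubmonoid (U : X.Opens) : Submonoid Γ(X, U) :=
  (IsUnit.submonoid Γ(X, U ⊓ W)).comap (X.presheaf.map (homOfLE inf_le_left).op).hom.toMonoidHom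

lemma mem_divisorialSubmonoid_iff {U : X.Opens} (a : Γ(X, U)) :
    a ∈ divisorialSubmonoid X W U ↔
      ∀ (x : X) (hx : x ∈ U), x ∈ W → IsUnit (X.presheaf.germ U x hx a) := by
  constructor
  · intro h x hx hW
    have h' : IsUnit (X.presheaf.map (homOfLE (inf_le_left : U ⊓ W ≤ U)).op a) := h
    have h2 := h'.map (X.presheaf.germ (U ⊓ W) x ⟨hx, hW⟩).hom
    have h3 := TopCat.Presheaf.germ_res_apply X.presheaf
      (homOfLE (inf_le_left : U ⊓ W ≤ U)) x ⟨hx, hW⟩ a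
    exact h3 ▸ h2
  · intro h
    refine RingedSpace.isUnit_of_isUnit_germ X.toRingedSpace (U ⊓ W) _ fun x hx => ?_
    have h3 := TopCat.Presheaf.germ_res_apply X.presheaf
      (homOfLE (inf_le_left : U ⊓ W ≤ U)) x hx a
    exact h3.symm ▸ h x hx.1 hx.2

lemma divisorialSubmonoid_res {U V : X.Opens} (i : U ⟶ V) (a : Γ(X, V))
    (ha : a ∈ divisorialSubmonoid X W V) : X.presheaf.map i.op a ∈ divisorialSubmonoid X W U := by
  rw [mem_divisorialSubmonoid_iff] at ha ⊢
  intro x hx hW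
  have h3 := TopCat.Presheaf.germ_res_apply X.presheaf i x hx a
  exact h3.symm ▸ ha x (i.le hx) hW

/-- The presheaf of monoids `𝒪_X ∩ j_* 𝒪_Wˣ`. -/
def divisorialPresheaf : TopCat.Presheaf CommMonCat.{u} X where
  obj U := CommMonCat.of (divisorialSubmonoid X W U.unop)
  map {V U} i := CommMonCat.ofHom
    { toFun a := ⟨X.presheaf.map i a.1, divisorialSubmonoid_res X W i.unop a.1 a.2⟩
      map_one' := Subtype.ext (map_one (X.presheaf.map i).hom)
      map_mul' a b := Subtype.ext (map_mul (X.presheaf.map i).hom a.1 b.1) }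
  map_id U := by
    ext a
    change X.presheaf.map (𝟙 U) a.1 = a.1
    rw [X.presheaf.map_id]
    rfl
  map_comp i j := by
    ext a
    change X.presheaf.map (i ≫ j) a.1 = X.presheaf.map j (X.presheaf.map i a.1)
    rw [X.presheaf.map_comp]
    rfl

lemma divisorialPresheaf_isSheaf : (divisorialPresheaf X W).IsSheaf := by
  rw [TopCat.Presheaf.isSheaf_iff_isSheafUniqueGluing]
  intro ι U s hs
  have hcomp : TopCat.Presheaf.IsCompatible X.sheaf.obj U (fun i => (s i).1) := fun i j =>
    congrArg Subtype.val (hs i j)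
  obtain ⟨t, ht, huniq⟩ := X.sheaf.existsUnique_gluing U (fun i => (s i).1) hcomp
  have htm : (show Γ(X, iSup U) from t) ∈ divisorialSubmonoid X W (iSup U) := by
    rw [mem_divisorialSubmonoid_iff]
    intro x hx hW
    obtain ⟨i, hi⟩ := Opens.mem_iSup.1 hx
    have h1 := (mem_divisorialSubmonoid_iff X W _).1 (s i).2 x hi hW
    have h2 : X.presheaf.map (Opens.leSupr U i).op t = (s i).1 := ht i
    rw [← h2] at h1
    have h3 := TopCat.Presheaf.germ_res_apply X.presheaf (Opens.leSupr U i) x hi t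
    exact h3 ▸ h1
  refine ⟨⟨t, htm⟩, fun i => Subtype.ext (ht i), fun t' ht' => Subtype.ext ?_⟩
  exact huniq t'.1 fun i => congrArg Subtype.val (ht' i)

/-- The log structure `𝒪_X ∩ j_* 𝒪_Wˣ ⊆ 𝒪_X`; when `W` is the complement of a divisor, this is the
divisorial log structure. -/
def divisorialLog : LogStructure X where
  M := divisorialPresheaf X W
  isSheaf := divisorialPresheaf_isSheaf X W
  α := { app := fun U => CommMonCat.ofHom (divisorialSubmonoid X W U.unop).subtype }
  existsUnique_unit U v hv := by
    have hm : v ∈ divisorialSubmonoid X W U :=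
      hv.map (X.presheaf.map (homOfLE (inf_le_left : U ⊓ W ≤ U)).op).hom
    exact ⟨⟨v, hm⟩, rfl, fun m h => Subtype.ext h⟩

end Divisorial

lemma divisorialSubmonoid_app {Y X : Scheme.{u}} (f : Y ⟶ X) (V : Y.Opens) (W : X.Opens)
    (h : V ≤ f ⁻¹ᵁ W) (U : X.Opens) (a : Γ(X, U)) (ha : a ∈ divisorialSubmonoid X W U) :
    f.app U a ∈ divisorialSubmonoid Y V (f ⁻¹ᵁ U) := by
  rw [mem_divisorialSubmonoid_iff] at ha ⊢
  intro y hy hV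
  have h2 := (ha (f y) hy (h hV)).map (f.stalkMap y).hom
  have h3 := Scheme.Hom.germ_stalkMap_apply f U y hy a
  exact h3 ▸ h2

/-- A morphism `f : Y ⟶ X` with `V ⊆ f⁻¹(W)` induces a morphism of the log schemes
defined by the open subsets `V` and `W`. -/
def divisorialHom {Y X : Scheme.{u}} (f : Y ⟶ X) (V : Y.Opens) (W : X.Opens) (h : V ≤ f ⁻¹ᵁ W) :
    LogScheme.mk Y (divisorialLog Y V) ⟶ LogScheme.mk X (divisorialLog X W) :=
  LogScheme.Hom.mk f
    (fun U =>
      { toFun a := ⟨f.app U a.1, divisorialSubmonoid_app f V W h U a.1 a.2⟩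
        map_one' := Subtype.ext (map_one (f.app U).hom)
        map_mul' a b := Subtype.ext (map_mul (f.app U).hom a.1 b.1) })
    (fun {U V'} i m => by
      apply Subtype.ext
      have := f.naturality i.op
      exact congrArg (fun g => g.hom m.1) this)
    (fun U m => rfl)

/-! ### Schemes over a discrete valuation ring -/

section Trait

variable (R : Type u) [CommRing R] [IsDomain R] [IsDiscreteValuationRing R]

/-- The complement of the closed point of `Spec R`. -/
def genericOpen : (Spec (CommRingCat.of R)).Opens where
  carrier := {IsLocalRing.closedPoint R}ᶜ
  is_open' := (PrimeSpectrum.isClosed_singleton_iff_isMaximal (IsLocalRing.closedPoint R)).2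
    (inferInstanceAs (IsLocalRing.maximalIdeal R).IsMaximal) |>.isOpen_compl

variable {R}

/-- For an `R`-scheme `X`, the log scheme `X†`: the scheme `X` with the divisorial log structure
`𝒪_X ∩ j_* 𝒪_{X_K}ˣ` induced by its special fibre, the complement of which is `X_K`. -/
abbrev dagger {X : Scheme.{u}} (f : X ⟶ Spec (CommRingCat.of R)) : LogScheme.{u} :=
  LogScheme.mk X (divisorialLog X (f ⁻¹ᵁ genericOpen R))

variable (R) in
/-- The log scheme `S† = (Spec R)†`, given by `R \ {0} → R`. -/
abbrev traitDagger : LogScheme.{u} :=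
  LogScheme.mk (Spec (CommRingCat.of R)) (divisorialLog (Spec (CommRingCat.of R)) (genericOpen R))

/-- The structure morphism `X† ⟶ S†`. -/
def daggerHom {X : Scheme.{u}} (f : X ⟶ Spec (CommRingCat.of R)) : dagger f ⟶ traitDagger R :=
  divisorialHom f (f ⁻¹ᵁ genericOpen R) (genericOpen R) le_rfl

/-- The structure morphism `S(d) ⟶ S`, where `S(d) = Spec R[T]/(T ^ d - ϖ)`. -/
def ramifiedCover (ϖ : R) (d : ℕ) :
    Spec (CommRingCat.of (AdjoinRoot (Polynomial.X ^ d - Polynomial.C ϖ))) ⟶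
      Spec (CommRingCat.of R) :=
  Spec.map (CommRingCat.ofHom (AdjoinRoot.of (Polynomial.X ^ d - Polynomial.C ϖ)))

lemma uniformizer_mem (ϖ : R) (hϖ : Irreducible ϖ) :
    (Scheme.ΓSpecIso (CommRingCat.of R)).inv ϖ ∈
      divisorialSubmonoid (Spec (CommRingCat.of R)) (genericOpen R) ⊤ := by
  rw [mem_divisorialSubmonoid_iff]
  intro x hx hW
  rw [← Scheme.mem_basicOpen _ _ x hx, basicOpen_eq_of_affine]
  intro hmem
  refine hW (PrimeSpectrum.ext ?_)
  change x.asIdeal = IsLocalRing.maximalIdeal R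
  have h2 : IsLocalRing.maximalIdeal R ≤ x.asIdeal := by
    rw [hϖ.maximalIdeal_eq]
    exact (Ideal.span_singleton_le_iff_mem (I := x.asIdeal)).2 hmem
  exact ((IsLocalRing.maximalIdeal.isMaximal R).eq_of_le x.2.ne_top h2).symm

/-- A uniformizer of `R`, as a global section of the sheaf of monoids of `S†`. -/
def uniformizerSection (ϖ : R) (hϖ : Irreducible ϖ) : (traitDagger R).log.M.obj (op ⊤) :=
  (⟨(Scheme.ΓSpecIso (CommRingCat.of R)).inv ϖ, uniformizer_mem ϖ hϖ⟩ :
    divisorialSubmonoid (Spec (CommRingCat.of R)) (genericOpen R) ⊤)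

/-- The saturation index `s(y)` of a height `1` point `y` of the fan of a log scheme `X` over `S†`:
if `P` is the stalk of the sheaf of monoids at `y` and `𝔭 ⊆ P` its maximal ideal, then
`P / (P \ 𝔭)` is the stalk of the characteristic sheaf, which is isomorphic to `ℕ`, and `s(y)` is
the image of `ϖ`. (A chart `Q → M` around `y` induces an isomorphism from `Q / (Q \ 𝔮)` to this
stalk, where `𝔮` is the prime ideal of `Q` that corresponds to `y`.) -/
def saturationIndex {X : LogScheme.{u}} (f : X ⟶ traitDagger R) (ϖ : R) (hϖ : Irreducible ϖ)
    (y : X.scheme) : ℕ :=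
  monoidOrder (X.log.charStalk y)
    (Associates.mk (X.log.germ ⊤ y trivial (f.comap ⊤ (uniformizerSection ϖ hϖ))))

end Trait

/-! ### Reduced subschemes -/

section Reduced

variable {X : Scheme.{u}} (S : Set X)

/-- The sheaf of ideals of functions vanishing on the closure of `S`. -/
def closureIdeal : X.IdealSheafData :=
  Scheme.IdealSheafData.vanishingIdeal ⟨closure S, isClosed_closure⟩

/-- The closure of `S` with its reduced scheme structure. -/
def closureScheme : Scheme.{u} := (closureIdeal S).subscheme

/-- The closed immersion of the closure of `S`. -/
def closureSchemeι : closureScheme S ⟶ X := (closureIdeal S).subschemeι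

/-- The largest open subset of `X` contained in the complement of `closure S \ S`. If `S` is
locally closed it is equal to that complement. -/
def coborderOpen : X.Opens := ⟨interior (coborder S), isOpen_interior⟩

/-- A locally closed subset `S` of a scheme `X`, with the reduced scheme structure: the open
subscheme of the reduced closure of `S` with underlying set `S`. -/
def reducedSubscheme : Scheme.{u} := (closureSchemeι S ⁻¹ᵁ coborderOpen S).toScheme

/-- The immersion of the reduced subscheme on a locally closed subset. -/
def reducedSubschemeι : reducedSubscheme S ⟶ X :=
  (closureSchemeι S ⁻¹ᵁ coborderOpen S).ι ≫ closureSchemeι S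

lemma range_reducedSubschemeι (hS : IsLocallyClosed S) :
    Set.range (reducedSubschemeι S) = S := by
  have h1 : Set.range (closureSchemeι S) = closure S :=
    (closureIdeal S).range_subschemeι.trans
      (Scheme.IdealSheafData.coe_support_vanishingIdeal _)
  have h2 : Set.range (closureSchemeι S ⁻¹ᵁ coborderOpen S).ι =
      closureSchemeι S ⁻¹' coborder S := by
    rw [Scheme.Opens.range_ι]
    change closureSchemeι S ⁻¹' interior (coborder S) = _
    rw [hS.isOpen_coborder.interior_eq]
  refine (Set.range_comp (closureSchemeι S) (closureSchemeι S ⁻¹ᵁ coborderOpen S).ι).trans ?_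
  rw [h2, Set.image_preimage_eq_inter_range, h1, coborder_inter_closure]

instance isReduced_closureScheme : IsReduced (closureScheme S) := by
  have h : ∀ i : X.affineOpens, IsReduced ((closureIdeal S).subschemeCover.openCover.X i) := by
    intro i
    have : _root_.IsReduced (Γ(X, i.1) ⧸ (closureIdeal S).ideal i) := by
      rw [← Ideal.isRadical_iff_quotient_reduced]
      exact PrimeSpectrum.isRadical_vanishingIdeal _
    exact inferInstanceAs (IsReduced (Spec (CommRingCat.of (Γ(X, i.1) ⧸ (closureIdeal S).ideal i))))
  exact @IsReduced.of_openCover (closureScheme S) (closureIdeal S).subschemeCover.openCover h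

instance isReduced_reducedSubscheme : IsReduced (reducedSubscheme S) :=
  inferInstanceAs (IsReduced (closureSchemeι S ⁻¹ᵁ coborderOpen S).toScheme)

end Reduced

end

noncomputable section

/-! ### Saturated monoids -/

/-! Write $P_y$ for the characteristic stalk at $y$ and $[\pi]$ for the class of the uniformizer in
it. The degree is the largest divisor $n$ of $d$ such that $[\pi]$ is an $n$-th power in $P_x$. Such
divisibility passes to generizations (`exists_pow_eq_charGerm_of_specializes`), so $n$ divides every
$s(y)$. It is also constant along $U(x)$ (`exists_pow_eq_charGerm_iff_of_mem_stratum`), which makes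
the degree constant.

Near a point of $U(x)$ there is a chart $\beta : P \to \mathcal M$ by a characteristic stalk, in
which $\pi = \beta(p_1)^n v$ with $v$ a unit (`exists_stratumChart`). Put $d = nk$. By maximality of
$n$, the element $p_1$ is not an $l$-th power for any prime $l \mid k$. On the fibre product the
root $t$ of $\pi$ satisfies $(t^k)^n = \beta(p_1)^n v$. Saturatedness then gives $t^k = \beta(p_1)
w$ with $w^n = v$ (`exists_root_unit`). The inverse image of $U(x)$ thus maps to the scheme of
$n$-th roots of $v$ over $U(x)$, which is finite étale of degree $n$ because $n$ and $v$ are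
invertible. It remains to see that this map is an isomorphism, locally on $U(x)$ and with reduced
structures (`exists_rootCover_iso`).

The fibre product is known only through its universal property, so it is probed by hollow log
schemes: a scheme $T$ with log structure $\mathcal O_T^\times \times Q$, where $Q$ is sharp fs and
its nontrivial elements map to $0$. Let $Q$ be the saturated monoid obtained from $P$ by adjoining a
$k$-th root of $p_1$. If $T$ is reduced and lies over $U(x)$, an $n$-th root $w$ of $v$ on $T$
defines a morphism from a hollow log scheme to the fibre product, by $\beta(p) \mapsto (w^{h(p)},
p)$ and $t \mapsto (w^l, p_1^{1/k})$. Here $h$ is an integral linear form with $h(p_1) + 1 = lk$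
(`exists_linearForm`); thanks to this twist no $k$-th root of $w$ is needed. For $T$ the scheme of
roots, this gives a section (`exists_hollow_hom`).

The section is an immersion, since it has a retraction. It is surjective because a field-valued
point of the fibre product over $U(x)$ is determined by its image in the scheme of roots
(`comp_base_eq`): such a point underlies a morphism from a hollow log scheme, which factors through
the section by the universal property of $Q$ (`rootMonoid.exists_lift`) and the uniqueness of
morphisms to the fibre product. A surjective immersion onto a reduced scheme is an isomorphism.

Finally, $U(x)$ is locally closed because near each of its points it is the closure of $x$
(`exists_nhd_mem_stratum`): one inclusion between $I(z,\mathcal M)$ and the prime of $x$ is checked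
on generators of a chart, the other on generators of that prime. -/

/-- An element whose power divides a power divides. -/
class IsSaturatedMonoid (M : Type*) [CommMonoid M] : Prop extends IsCancelMul M where
  dvd_of_pow_dvd_pow : ∀ (a b : M) (n : ℕ), 0 < n → b ^ n ∣ a ^ n → b ∣ a

lemma IsFsMonoid.isSaturatedMonoid {P : Type u} [CommMonoid P] (h : IsFsMonoid P) :
    IsSaturatedMonoid P where
  mul_left_cancel a b c hbc := h.integral a b c hbc
  mul_right_cancel a b c hbc := h.integral a b c (by simpa [mul_comm] using hbc)
  dvd_of_pow_dvd_pow := h.saturated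

section Saturated

variable {M : Type*} [CommMonoid M] [IsSaturatedMonoid M]

lemma dvd_of_pow_dvd_pow' {a b : M} {n : ℕ} (hn : 0 < n) (h : b ^ n ∣ a ^ n) : b ∣ a :=
  IsSaturatedMonoid.dvd_of_pow_dvd_pow a b n hn h

instance Associates.isSaturatedMonoid : IsSaturatedMonoid (Associates M) :=
  have key : ∀ a b c : Associates M, a * b = a * c → b = c := by
    intro a b c
    obtain ⟨a, rfl⟩ := Associates.mk_surjective a
    obtain ⟨b, rfl⟩ := Associates.mk_surjective b
    obtain ⟨c, rfl⟩ := Associates.mk_surjective c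
    intro h
    rw [Associates.mk_mul_mk, Associates.mk_mul_mk, Associates.mk_eq_mk_iff_associated] at h
    obtain ⟨v, hv⟩ := h
    rw [Associates.mk_eq_mk_iff_associated]
    exact ⟨v, mul_left_cancel (a := a) (by rw [← mul_assoc, hv])⟩
  { mul_left_cancel := fun a b c h => key a b c h
    mul_right_cancel := fun a b c h => key a b c (by simpa [mul_comm] using h)
    dvd_of_pow_dvd_pow := by
      intro a b n hn
      obtain ⟨a, rfl⟩ := Associates.mk_surjective a
      obtain ⟨b, rfl⟩ := Associates.mk_surjective b
      rw [← Associates.mk_pow, ← Associates.mk_pow, Associates.mk_dvd_mk, Associates.mk_dvd_mk]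
      exact dvd_of_pow_dvd_pow' hn }

lemma eq_of_dvd_dvd_of_sharp [Subsingleton Mˣ] {a b : M} (h1 : a ∣ b) (h2 : b ∣ a) : a = b := by
  obtain ⟨c, rfl⟩ := h1
  obtain ⟨e, he⟩ := h2
  have h3 : c * e = 1 := mul_left_cancel (a := a) (by rw [← mul_assoc, ← he, mul_one])
  have h4 : Units.mkOfMulEqOne c e h3 = 1 := Subsingleton.elim _ _
  have h5 : c = 1 := congrArg Units.val h4
  rw [h5, mul_one]

/-- Equal powers divide each other, so by saturation their bases do too, and in a sharp monoid
divisibility is antisymmetric. -/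
lemma isMulTorsionFree_of_sharp [Subsingleton Mˣ] : IsMulTorsionFree M where
  pow_left_injective n hn a b h := by
    have hn' : 0 < n := Nat.pos_of_ne_zero hn
    have h' : a ^ n = b ^ n := h
    exact eq_of_dvd_dvd_of_sharp (dvd_of_pow_dvd_pow' hn' (dvd_of_eq h'))
      (dvd_of_pow_dvd_pow' hn' (dvd_of_eq h'.symm))

lemma Algebra.GrothendieckGroup.exists_of_div_of {M : Type*} [CommMonoid M]
    (z : Algebra.GrothendieckGroup M) :
    ∃ a b : M, z = Algebra.GrothendieckGroup.of a / Algebra.GrothendieckGroup.of b := by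
  induction z using Localization.ind with | _ y
  obtain ⟨a, b⟩ := y
  refine ⟨a, b, ?_⟩
  rw [eq_div_iff_mul_eq', Localization.mk_eq_monoidOf_mk']
  exact (mul_comm _ _).trans ((Localization.monoidOf (⊤ : Submonoid M)).mk'_spec' a b)

open Algebra in
/-- The projection of a saturated monoid onto its sharp quotient splits if the latter is finitely
generated. -/
theorem Associates.exists_section [Monoid.FG (Associates M)] :
    ∃ s : Associates M →* M, ∀ a, Associates.mk (s a) = a := by
  have : IsMulTorsionFree (Associates M) := isMulTorsionFree_of_sharp
  let oM : M →* GrothendieckGroup M := GrothendieckGroup.of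
  let oP : Associates M →* GrothendieckGroup (Associates M) := GrothendieckGroup.of
  have hoM : Function.Injective oM := GrothendieckGroup.of_injective
  have hoP : Function.Injective oP := GrothendieckGroup.of_injective
  let mkH : M →* Associates M := Associates.mkMonoidHom
  let g : GrothendieckGroup M →* GrothendieckGroup (Associates M) :=
    GrothendieckGroup.lift (oP.comp mkH)
  have hg : ∀ m, g (oM m) = oP (Associates.mk m) := fun m =>
    DFunLike.congr_fun (GrothendieckGroup.lift.symm_apply_apply (oP.comp mkH)) m
  have hfrac := fun z => GrothendieckGroup.exists_of_div_of (M := Associates M) z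
  have hfrac' := fun z => GrothendieckGroup.exists_of_div_of (M := M) z
  have hsurj : Function.Surjective g := by
    intro z
    obtain ⟨a, b, rfl⟩ := hfrac z
    obtain ⟨a, rfl⟩ := Associates.mk_surjective a
    obtain ⟨b, rfl⟩ := Associates.mk_surjective b
    exact ⟨oM a / oM b, by rw [map_div, hg, hg]⟩
  have hker : ∀ z, g z = 1 → ∃ v : Mˣ, z = oM v := by
    intro z hz
    obtain ⟨a, b, rfl⟩ := hfrac' z
    rw [map_div, hg, hg, div_eq_one] at hz
    obtain ⟨v, hv⟩ := Associates.mk_eq_mk_iff_associated.1 (hoP hz.symm)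
    exact ⟨v, by rw [div_eq_iff_eq_mul, ← map_mul, mul_comm, hv]⟩
  let gL : Additive (GrothendieckGroup M) →ₗ[ℤ] Additive (GrothendieckGroup (Associates M)) :=
    (MonoidHom.toAdditive g).toIntLinearMap
  -- The group envelope of the sharp quotient is finitely generated and torsion-free over `ℤ`, hence
  -- projective, so `g` splits.
  obtain ⟨σ, hσ⟩ := Module.projective_lifting_property gL LinearMap.id hsurj
  have hσ' : ∀ z, g (σ (Additive.ofMul z)).toMul = z := fun z =>
    LinearMap.congr_fun hσ (Additive.ofMul z)
  -- The splitting maps the sharp quotient into `M` and not only into its envelope: the chosen lift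
  -- differs from any representative in `M` by an element of the kernel of `g`, that is, by a unit
  -- of `M`.
  have hex : ∀ a : Associates M, ∃ m : M, oM m = (σ (Additive.ofMul (oP a))).toMul := by
    intro a
    obtain ⟨a, rfl⟩ := Associates.mk_surjective a
    obtain ⟨v, hv⟩ := hker ((σ (Additive.ofMul (oP (Associates.mk a)))).toMul / oM a) (by
      rw [map_div, hσ', hg, div_self'])
    exact ⟨v * a, by rw [map_mul, ← hv, div_mul_cancel]⟩
  choose s hs using hex
  refine ⟨⟨⟨s, hoM ?_⟩, fun a b => hoM ?_⟩, fun a => hoP ?_⟩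
  · rw [hs, map_one oM, map_one oP]
    exact map_zero σ
  · rw [hs, map_mul oM, map_mul oP, hs, hs]
    exact map_add σ _ _
  · change oP (Associates.mk (s a)) = _
    rw [← hg, hs, hσ']

variable [IsMulTorsionFree M]

/-- An element that is not a proper power with exponent dividing `k` has no power that is a `k`-th
power, except for the obvious ones. -/
lemma dvd_of_pow_eq_pow {p₁ : M} {k : ℕ} (hk : 0 < k)
    (hp : ∀ l : ℕ, l.Prime → l ∣ k → ∀ c : M, c ^ l ≠ p₁) {c : M} {j : ℕ} (h : c ^ k = p₁ ^ j) :
    ∃ i, j = k * i ∧ c = p₁ ^ i := by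
  suffices hkj : k ∣ j by
    obtain ⟨i, rfl⟩ := hkj
    refine ⟨i, rfl, pow_left_injective hk.ne' ?_⟩
    change c ^ k = (p₁ ^ i) ^ k
    rw [h, ← pow_mul, mul_comm]
  -- Torsion-freeness allows both exponents to be divided by their gcd; what has to be shown is then
  -- `k' = 1`.
  set g := Nat.gcd k j with hg
  have hg0 : 0 < g := Nat.gcd_pos_of_pos_left j hk
  obtain ⟨k', hk'⟩ : g ∣ k := Nat.gcd_dvd_left k j
  obtain ⟨j', hj'⟩ : g ∣ j := Nat.gcd_dvd_right k j
  have hcop : Nat.Coprime k' j' := by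
    have := Nat.coprime_div_gcd_div_gcd (m := k) (n := j) hg0
    rwa [← hg, Nat.div_eq_of_eq_mul_right hg0 hk', Nat.div_eq_of_eq_mul_right hg0 hj'] at this
  have h' : c ^ k' = p₁ ^ j' := by
    apply pow_left_injective hg0.ne'
    change (c ^ k') ^ g = (p₁ ^ j') ^ g
    rw [← pow_mul, ← pow_mul, mul_comm k', mul_comm j', ← hk', ← hj', h]
  by_cases hk1 : k' = 1
  · rw [hk1, mul_one] at hk'
    exact ⟨j', by rw [hk', ← hj']⟩
  exfalso
  have hk'0 : 0 < k' := Nat.pos_of_ne_zero fun h0 => by simp [h0] at hk'; omega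
  -- a Bezout relation `u * j' = v * k' + 1`
  obtain ⟨u, v, huv⟩ : ∃ u v : ℕ, u * j' = v * k' + 1 := by
    obtain ⟨u, hu⟩ := Nat.exists_mul_mod_eq_one_of_coprime hcop.symm (by omega)
    exact ⟨u, j' * u / k', by rw [mul_comm u, ← hu.2, mul_comm _ k', Nat.div_add_mod]⟩
  -- By saturation `p₁ ^ v` divides `c ^ u`, and the quotient is a `k'`-th root of `p₁`. A prime
  -- factor of `k'` then contradicts `hp`.
  have h1 : (c ^ u) ^ k' = p₁ * (p₁ ^ v) ^ k' := by
    rw [← pow_mul, mul_comm u, pow_mul, h', ← pow_mul, mul_comm j', huv, pow_succ, pow_mul,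
      mul_comm]
  obtain ⟨e, he⟩ := dvd_of_pow_dvd_pow' hk'0 (Dvd.intro_left _ h1.symm)
  have h2 : e ^ k' = p₁ := by
    apply mul_left_cancel (a := (p₁ ^ v) ^ k')
    rw [← mul_pow, ← he, h1, mul_comm]
  obtain ⟨l, hl, k'', rfl⟩ := Nat.exists_prime_and_dvd hk1
  exact hp l hl ⟨g * k'', by rw [hk']; ring⟩ (e ^ k'') (by rw [← pow_mul, mul_comm, h2])

/-- If `p₁` is not a proper power with exponent dividing `k`, then some integral linear form on the
monoid takes at `p₁` a value congruent to `-1` modulo `k`. -/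
theorem exists_linearForm [Monoid.FG M] {p₁ : M} {k : ℕ}
    (hp : ∀ l : ℕ, l.Prime → l ∣ k → ∀ c : M, c ^ l ≠ p₁) :
    ∃ (h : M →* Multiplicative ℤ) (l : ℤ), (h p₁).toAdd + 1 = l * k := by
  let G := Additive (Algebra.GrothendieckGroup M)
  let o : M →* Algebra.GrothendieckGroup M := Algebra.GrothendieckGroup.of
  have ho : Function.Injective o := Algebra.GrothendieckGroup.of_injective
  let v : G := Additive.ofMul (o p₁)
  let b := Module.finBasis ℤ G
  -- The coordinates of `v` generate the ideal of values at `v` of linear forms, so a form with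
  -- value `-1` modulo `k` exists as soon as `I` is the unit ideal. Otherwise some prime `l` divides
  -- `k` and all coordinates of `v`.
  let I : Ideal ℤ := Ideal.span {(k : ℤ)} ⊔ Ideal.span (Set.range (b.repr v))
  have hI : I = ⊤ := by
    by_contra hI
    obtain ⟨g, hg⟩ := (IsPrincipalIdealRing.principal I).principal
    have hgu : ¬ IsUnit g := fun hu => hI (by rw [hg]; exact Ideal.span_singleton_eq_top.2 hu)
    obtain ⟨l, hl, hlg⟩ := Nat.exists_prime_and_dvd (n := g.natAbs) fun h1 =>
      hgu (Int.isUnit_iff_natAbs_eq.2 h1)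
    have hdvd : ∀ z ∈ I, (l : ℤ) ∣ z := by
      intro z hz
      rw [hg] at hz
      exact (Int.natCast_dvd.2 hlg).trans (Ideal.mem_span_singleton.1 hz)
    have hlk : l ∣ k := Int.natCast_dvd_natCast.1
      (hdvd _ (Ideal.mem_sup_left (Ideal.mem_span_singleton_self _)))
    choose a ha using fun i => hdvd _ (Ideal.mem_sup_right
      (Ideal.subset_span ⟨i, rfl⟩ : b.repr v i ∈ Ideal.span (Set.range (b.repr v))))
    have hv : v = l • ∑ i, a i • b i := by
      rw [← b.sum_repr v, Finset.smul_sum]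
      refine Finset.sum_congr rfl fun i _ => ?_
      rw [ha, mul_smul, Nat.cast_smul_eq_nsmul]
    -- The `l`-th root of `p₁` exists so far only in the group envelope, as a fraction; saturation
    -- brings it back into `M`.
    obtain ⟨y, z, hyz⟩ := Algebra.GrothendieckGroup.exists_of_div_of
      (Additive.toMul (∑ i, a i • b i))
    have h1 : o p₁ = (o y / o z) ^ l := by
      rw [← hyz]
      exact congrArg Additive.toMul hv
    rw [div_pow, eq_div_iff_mul_eq', ← map_pow, ← map_pow, ← map_mul] at h1
    have h2 := ho h1
    obtain ⟨c, rfl⟩ := dvd_of_pow_dvd_pow' hl.pos ⟨p₁, h2.symm.trans (mul_comm _ _)⟩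
    exact hp l hl hlk c (mul_left_cancel (a := z ^ l) (by rw [← mul_pow, ← h2, mul_comm]))
  obtain ⟨x, hx, y, hy, hxy⟩ := Submodule.mem_sup.1 ((Ideal.eq_top_iff_one I).1 hI)
  obtain ⟨m, rfl⟩ := Ideal.mem_span_singleton'.1 hx
  obtain ⟨c, rfl⟩ := (Submodule.mem_span_range_iff_exists_fun ℤ).1 hy
  -- The sign turns the Bezout relation `m * k + ∑ i, c i * b.repr v i = 1` into `φ v + 1 = m * k`.
  let φ : G →ₗ[ℤ] ℤ := -∑ i, c i • b.coord i
  refine ⟨(AddMonoidHom.toMultiplicativeRight φ.toAddMonoidHom).comp o, m, ?_⟩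
  change φ v + 1 = _
  simp only [φ, LinearMap.neg_apply, LinearMap.sum_apply, LinearMap.smul_apply,
    Module.Basis.coord_apply]
  linarith

end Saturated

/-- If `e ^ n = a` with `n` the largest divisor of `d` such that `a` is an `n`-th power, then `e` is
not a proper power with exponent dividing `d / n`. -/
lemma pow_ne_of_maximal {M : Type*} [CommMonoid M] {a e : M} {d n k : ℕ} (hd : 0 < d)
    (hk : d = n * k) (hmax : ∀ m, m ∣ d → (∃ c : M, c ^ m = a) → m ≤ n) (he : e ^ n = a)
    (l : ℕ) (hl : l.Prime) (hlk : l ∣ k) (c : M) : c ^ l ≠ e := by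
  rintro rfl
  have hn : 0 < n := Nat.pos_of_ne_zero (by rintro rfl; simp at hk; omega)
  have := hmax (n * l) (hk ▸ Nat.mul_dvd_mul_left n hlk) ⟨c, by rw [← he, ← pow_mul, mul_comm]⟩
  have h2 := hl.two_le
  nlinarith

/-! ### Adjoining a root to a sharp saturated monoid -/

section Root

variable {P : Type u} [CommMonoid P] (p₁ : P) (k : ℕ)

/-- The monoid obtained from a sharp fs monoid `P` by adjoining a `k`-th root of `p₁` and
saturating, realized inside `P` in such a way that `P` is embedded by `p ↦ p ^ k` and that the root
is `p₁`. -/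
def rootMonoid : Submonoid P where
  carrier := {q | ∃ (a b : P) (j : ℕ), q * b ^ k = a ^ k * p₁ ^ j}
  one_mem' := ⟨1, 1, 0, by simp⟩
  mul_mem' := by
    rintro q q' ⟨a, b, j, h⟩ ⟨a', b', j', h'⟩
    refine ⟨a * a', b * b', j + j', ?_⟩
    rw [mul_pow, mul_pow, pow_add, mul_mul_mul_comm, h, h', mul_mul_mul_comm]

/-- The embedding `p ↦ p ^ k`. -/
def rootMonoid.of : P →* rootMonoid p₁ k where
  toFun p := ⟨p ^ k, p, 1, 0, by simp⟩
  map_one' := Subtype.ext (one_pow k)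
  map_mul' a b := Subtype.ext (mul_pow a b k)

/-- The `k`-th root of `p₁`. -/
def rootMonoid.root : rootMonoid p₁ k := ⟨p₁, 1, 1, 1, by simp⟩

lemma rootMonoid.root_pow : rootMonoid.root p₁ k ^ k = rootMonoid.of p₁ k p₁ := rfl

variable [IsSaturatedMonoid P] (hk : 0 < k)

-- Inside the group envelope of `P`, this submonoid is the intersection of `P` with the subgroup
-- generated by `k`-th powers and `p₁`, which is why it inherits saturation. It is finitely
-- generated because modulo `k`-th powers only finitely many exponent vectors of the generators of
-- `P` matter.
include hk in
theorem rootMonoid.isFsMonoid [Monoid.FG P] : IsFsMonoid (rootMonoid p₁ k) where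
  integral a b c h := mul_left_cancel h
  saturated := by
    rintro ⟨a, a₁, b₁, i, ha⟩ ⟨b, a₂, b₂, j, hb⟩ n hn ⟨c, hc⟩
    obtain ⟨e, rfl⟩ := dvd_of_pow_dvd_pow' hn ⟨c.1, congrArg Subtype.val hc⟩
    -- The quotient involves `p₁ ^ (i - j)`. As exponents must be natural numbers, `p₁ ^ (-j)` is
    -- replaced by `p₁ ^ (j * (k - 1))` divided by the `k`-th power of `p₁ ^ j`.
    refine ⟨⟨e, a₁ * b₂ , a₂ * b₁ * p₁ ^ j, i + j * (k - 1), ?_⟩, rfl⟩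
    have h1 : b * (e * (a₂ * b₁ * p₁ ^ j) ^ k) = b * ((a₁ * b₂) ^ k * p₁ ^ (i + j * (k - 1))) := by
      have h2 : j * k = j + j * (k - 1) := by
        obtain ⟨k, rfl⟩ : ∃ k', k = k' + 1 := ⟨k - 1, by omega⟩
        simp; ring
      calc _ = (b * e * b₁ ^ k) * (a₂ ^ k * p₁ ^ (j * k)) := by
            rw [mul_pow, mul_pow, ← pow_mul]; ac_rfl
        _ = a₁ ^ k * p₁ ^ i * (a₂ ^ k * p₁ ^ j * p₁ ^ (j * (k - 1))) := by
            rw [ha, h2, pow_add]; ac_rfl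
        _ = _ := by
            rw [← hb, mul_pow, pow_add]; ac_rfl
    exact mul_left_cancel h1
  fg := by
    obtain ⟨S, hS⟩ := Monoid.FG.fg_top (M := P)
    rw [Monoid.fg_iff_submonoid_fg, Submonoid.fg_iff]
    -- generators: the `k`-th powers of generators, and the products with exponents less than `k`
    let T₁ : Set P := (fun s => s ^ k) '' S
    let T₂ : Set P := Set.range fun r : S → Fin k => ∏ s, s.1 ^ (r s : ℕ)
    refine ⟨T₁ ∪ (T₂ ∩ rootMonoid p₁ k), le_antisymm ?_ ?_, ?_⟩
    · rw [Submonoid.closure_le]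
      rintro _ (⟨s, -, rfl⟩ | ⟨-, h⟩)
      · exact (rootMonoid.of p₁ k s).2
      · exact h
    · rintro q hq
      have hq' : q ∈ Submonoid.closure (S : Set P) := hS ▸ Submonoid.mem_top q
      obtain ⟨a, ha⟩ := Submonoid.mem_closure_finset'.1 hq'
      let x : P := ∏ s : S, s.1 ^ (a s / k)
      let r : P := ∏ s : S, s.1 ^ (a s % k)
      have hxr : q = x ^ k * r := by
        rw [ha, ← Finset.prod_pow, ← Finset.prod_mul_distrib]
        refine Finset.prod_congr rfl fun s _ => ?_
        rw [← pow_mul, ← pow_add, Nat.div_add_mod']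
      rw [hxr]
      refine mul_mem ?_ (Submonoid.subset_closure (Or.inr ⟨⟨fun s => ⟨a s % k, Nat.mod_lt _ hk⟩,
        rfl⟩, ?_⟩))
      · rw [← Finset.prod_pow]
        refine prod_mem fun s _ => ?_
        rw [pow_right_comm]
        have hs : s.1 ^ k ∈ Submonoid.closure (T₁ ∪ (T₂ ∩ rootMonoid p₁ k)) :=
          Submonoid.subset_closure (Or.inl ⟨s, s.2, rfl⟩)
        exact pow_mem hs _
      · obtain ⟨b, c, j, h⟩ := hq
        exact ⟨b, x * c, j, by rw [← h, hxr, mul_pow]; ac_rfl⟩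
    · exact (S.finite_toSet.image _).union ((Set.finite_range _).inter_of_left _)

variable {p₁ k} [IsMulTorsionFree P] {M : Type*} [CommMonoid M] [IsSaturatedMonoid M]

-- This is the well-definedness of the lift. The quotient of `x` and `y` has a `k`-th power that is
-- a power of `p₁`; as `p₁` has no `l`-th root for primes `l ∣ k`, the quotient is itself a power of
-- `p₁`, and there `φ` is controlled by `t`. Without that hypothesis the quotient could be
-- independent of `t`.
omit [IsSaturatedMonoid M] in
include hk in
lemma rootMonoid.lift_aux (hp : ∀ l : ℕ, l.Prime → l ∣ k → ∀ c : P, c ^ l ≠ p₁) (φ : P →* M) (t : M)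
    (ht : t ^ k = φ p₁) {x y : P} {i j : ℕ} (h : x ^ k * p₁ ^ i = y ^ k * p₁ ^ j) :
    φ x * t ^ i = φ y * t ^ j := by
  wlog hij : i ≤ j generalizing x y i j
  · exact (this h.symm (by omega)).symm
  obtain ⟨m, rfl⟩ := Nat.exists_eq_add_of_le hij
  have h1 : x ^ k = y ^ k * p₁ ^ m := by
    apply mul_right_cancel (b := p₁ ^ i)
    rw [h, pow_add]; ac_rfl
  obtain ⟨c, rfl⟩ := dvd_of_pow_dvd_pow' hk ⟨_, h1⟩
  obtain ⟨n, rfl, rfl⟩ := dvd_of_pow_eq_pow hk hp (c := c) (j := m)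
    (mul_left_cancel (a := y ^ k) (by rw [← h1, mul_pow]))
  rw [map_mul, map_pow, ← ht, pow_add, ← pow_mul]; ac_rfl

include hk in
/-- The universal property of `rootMonoid`. -/
theorem rootMonoid.exists_lift (hp : ∀ l : ℕ, l.Prime → l ∣ k → ∀ c : P, c ^ l ≠ p₁)
    (φ : P →* M) (t : M) (ht : t ^ k = φ p₁) :
    ∃ ψ : rootMonoid p₁ k →* M, (∀ p, ψ (rootMonoid.of p₁ k p) = φ p) ∧
      ψ (rootMonoid.root p₁ k) = t ∧ ∀ q, ψ q ^ k = φ q.1 := by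
  -- The relation satisfied by `q` prescribes the value `m` as a fraction. The `k`-th power of this
  -- fraction is `φ q`, so the fraction lies in `M` by saturation.
  have hex : ∀ q : rootMonoid p₁ k, ∃ m : M, ∀ (a b : P) (j : ℕ), q.1 * b ^ k = a ^ k * p₁ ^ j →
      m * φ b = φ a * t ^ j := by
    rintro ⟨q, a, b, j, h⟩
    have h1 : φ b ^ k ∣ (φ a * t ^ j) ^ k := by
      rw [mul_pow, ← pow_mul, mul_comm j, pow_mul, ht, ← map_pow, ← map_pow, ← map_pow, ← map_mul,
        ← h]
      exact map_dvd φ (Dvd.intro_left _ rfl)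
    obtain ⟨m, hm⟩ := dvd_of_pow_dvd_pow' hk h1
    refine ⟨m, fun a' b' j' h' => ?_⟩
    apply mul_left_cancel (a := φ b)
    rw [← mul_assoc, ← hm, mul_right_comm, ← map_mul, ← mul_assoc, ← map_mul]
    refine rootMonoid.lift_aux hk hp φ t ht ?_
    change q * b' ^ k = _ at h'
    rw [mul_pow, mul_pow, mul_right_comm, ← h, mul_right_comm, h']; ac_rfl
  choose ψ hψ using hex
  refine ⟨⟨⟨ψ, ?_⟩, fun q q' => ?_⟩, fun p => ?_, ?_, fun q => ?_⟩
  · simpa using hψ 1 1 1 0 (by simp)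
  · obtain ⟨a, b, j, h⟩ := q.2
    obtain ⟨a', b', j', h'⟩ := q'.2
    have h1 := hψ (q * q') (a * a') (b * b') (j + j') (by
      rw [mul_pow, mul_pow, pow_add, mul_mul_mul_comm, ← h, ← h', Submonoid.coe_mul]; ac_rfl)
    apply mul_right_cancel (b := φ (b * b'))
    refine h1.trans ?_
    rw [map_mul, map_mul, mul_mul_mul_comm, hψ q a b j h, hψ q' a' b' j' h', pow_add]; ac_rfl
  · simpa using hψ (rootMonoid.of p₁ k p) p 1 0 (by simp [rootMonoid.of])
  · simpa using hψ (rootMonoid.root p₁ k) 1 1 1 (by simp [rootMonoid.root])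
  · obtain ⟨a, b, j, h⟩ := q.2
    have h1 := hψ q a b j h
    apply mul_right_cancel (b := φ b ^ k)
    change ψ q ^ k * _ = _
    rw [← mul_pow, h1, mul_pow, ← pow_mul, mul_comm j, pow_mul, ht, ← map_pow, ← map_pow, ← map_pow,
      ← map_mul, ← map_mul, h]

instance rootMonoid.subsingleton_units [Subsingleton Pˣ] : Subsingleton (rootMonoid p₁ k)ˣ :=
  (Units.map_injective (f := (rootMonoid p₁ k).subtype) Subtype.val_injective).subsingleton

end Root

/-! ### Stalks of log structures -/

lemma AlgebraicGeometry.Scheme.section_ext {X : Scheme.{u}} {U : X.Opens} {s t : Γ(X, U)}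
    (h : ∀ (x : X) (hx : x ∈ U), X.presheaf.germ U x hx s = X.presheaf.germ U x hx t) : s = t :=
  TopCat.Presheaf.section_ext X.sheaf U s t h

/-- A family of germs that is locally induced by sections is induced by a section. -/
lemma AlgebraicGeometry.Scheme.exists_section_of_germs {X : Scheme.{u}} {V : X.Opens}
    (g : ∀ x ∈ V, X.presheaf.stalk x)
    (h : ∀ x ∈ V, ∃ (W : X.Opens) (_ : x ∈ W) (hWV : W ≤ V) (s : Γ(X, W)),
      ∀ (y : X) (hy : y ∈ W), X.presheaf.germ W y hy s = g y (hWV hy)) :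
    ∃ s : Γ(X, V), ∀ (x : X) (hx : x ∈ V), X.presheaf.germ V x hx s = g x hx := by
  choose W hxW hWV s hs using fun x : V => h x.1 x.2
  obtain ⟨t, ht, -⟩ := X.sheaf.existsUnique_gluing' W V (fun x => homOfLE (hWV x))
    (fun x hx => Opens.mem_iSup.2 ⟨⟨x, hx⟩, hxW ⟨x, hx⟩⟩) s (by
      intro x y
      refine AlgebraicGeometry.Scheme.section_ext fun z hz => ?_
      refine (TopCat.Presheaf.germ_res_apply X.presheaf (Opens.infLELeft (W x) (W y)) z hz
        (s x)).trans (Eq.trans ?_ (TopCat.Presheaf.germ_res_apply X.presheaf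
          (Opens.infLERight (W x) (W y)) z hz (s y)).symm)
      exact (hs x z hz.1).trans (hs y z hz.2).symm)
  refine ⟨t, fun x hx => ?_⟩
  have h1 := TopCat.Presheaf.germ_res_apply X.presheaf (homOfLE (hWV ⟨x, hx⟩)) x (hxW ⟨x, hx⟩) t
  have h2 : X.presheaf.map (homOfLE (hWV ⟨x, hx⟩)).op t = s ⟨x, hx⟩ := ht ⟨x, hx⟩
  rw [h2] at h1
  exact h1.symm.trans (hs ⟨x, hx⟩ x (hxW ⟨x, hx⟩))

namespace LogStructure

variable {X : Scheme.{u}} (L : LogStructure X)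

/-- Restriction of sections of the sheaf of monoids. -/
def res {U V : X.Opens} (h : U ≤ V) : L.M.obj (op V) →* L.M.obj (op U) := (L.M.map (homOfLE h).op).hom

lemma germ_res {U V : X.Opens} (h : U ≤ V) (x : X) (hx : x ∈ U) (m : L.M.obj (op V)) :
    L.germ U x hx (L.res h m) = L.germ V x (h hx) m :=
  TopCat.Presheaf.germ_res_apply L.M (homOfLE h) x hx m

lemma toΓ_res {U V : X.Opens} (h : U ≤ V) (m : L.M.obj (op V)) :
    L.toΓ U (L.res h m) = X.presheaf.map (homOfLE h).op (L.toΓ V m) :=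
  ConcreteCategory.congr_hom (L.α.naturality (homOfLE h).op) m

lemma res_res {U V W : X.Opens} (h : U ≤ V) (h' : V ≤ W) (m : L.M.obj (op W)) :
    L.res h (L.res h' m) = L.res (h.trans h') m :=
  (ConcreteCategory.congr_hom (L.M.map_comp (homOfLE h').op (homOfLE h).op) m).symm

lemma exists_germ {x : X} (m : L.stalk x) {V : X.Opens} (hV : x ∈ V) :
    ∃ (U : X.Opens) (_ : U ≤ V) (hx : x ∈ U) (s : L.M.obj (op U)), L.germ U x hx s = m := by
  obtain ⟨U, h, hx, s, hs⟩ := TopCat.Presheaf.exists_le_germ_eq L.M m hV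
  exact ⟨U, h, hx, s, hs⟩

lemma exists_res_eq {x : X} {U V : X.Opens} (hU : x ∈ U) (hV : x ∈ V) {s : L.M.obj (op U)}
    {t : L.M.obj (op V)} (h : L.germ U x hU s = L.germ V x hV t) :
    ∃ (W : X.Opens) (_ : x ∈ W) (hWU : W ≤ U) (hWV : W ≤ V), L.res hWU s = L.res hWV t := by
  obtain ⟨W, hx, i, j, e⟩ := TopCat.Presheaf.germ_eq L.M x hU hV s t h
  exact ⟨W, hx, i.le, j.le, e⟩

lemma section_ext {U : X.Opens} {s t : L.M.obj (op U)}
    (h : ∀ (x : X) (hx : x ∈ U), L.germ U x hx s = L.germ U x hx t) : s = t :=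
  TopCat.Presheaf.section_ext (⟨L.M, L.isSheaf⟩ : TopCat.Sheaf CommMonCat X) U s t h

/-- The map `α` on stalks. -/
def alphaStalk (x : X) : L.stalk x →* X.presheaf.stalk x :=
  CommMonCat.Hom.hom (X := L.M.stalk x)
    (Y := (forget₂ CommRingCat CommMonCat).obj (X.presheaf.stalk x))
  (Limits.colimit.desc ((OpenNhds.inclusion x).op ⋙ L.M)
    { pt := (forget₂ CommRingCat CommMonCat).obj (X.presheaf.stalk x)
      ι :=
        { app := fun U => L.α.app (op U.unop.1) ≫
            (forget₂ CommRingCat CommMonCat).map (X.presheaf.germ U.unop.1 x U.unop.2)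
          naturality := by
            intro U V i
            let j : V.unop.1 ⟶ U.unop.1 := homOfLE i.unop.le
            have h1 := L.α.naturality j.op
            have h2 : X.presheaf.map j.op ≫ X.presheaf.germ V.unop.1 x V.unop.2 =
                X.presheaf.germ U.unop.1 x U.unop.2 :=
              TopCat.Presheaf.germ_res X.presheaf j x V.unop.2
            ext m
            exact (congrArg (X.presheaf.germ V.unop.1 x V.unop.2)
              (ConcreteCategory.congr_hom h1 m)).trans
                (ConcreteCategory.congr_hom h2 (L.toΓ U.unop.1 m)) } })

lemma alphaStalk_germ {x : X} (U : X.Opens) (hx : x ∈ U) (m : L.M.obj (op U)) :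
    L.alphaStalk x (L.germ U x hx m) = X.presheaf.germ U x hx (L.toΓ U m) :=
  ConcreteCategory.congr_hom (Limits.colimit.ι_desc (F := (OpenNhds.inclusion x).op ⋙ L.M) _
    (op (⟨U, hx⟩ : OpenNhds x))) m

lemma toΓ_injective_of_isUnit {U : X.Opens} {a b : L.M.obj (op U)} (ha : IsUnit (L.toΓ U a))
    (h : L.toΓ U a = L.toΓ U b) : a = b :=
  (L.existsUnique_unit U _ ha).unique rfl h.symm

lemma isUnit_of_isUnit_toΓ {U : X.Opens} {a : L.M.obj (op U)} (ha : IsUnit (L.toΓ U a)) :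
    IsUnit a := by
  obtain ⟨v, hv⟩ := ha
  obtain ⟨b, hb, -⟩ := L.existsUnique_unit U (v⁻¹ : Γ(X, U)ˣ) (Units.isUnit _)
  have hb : L.toΓ U b = (v⁻¹ : Γ(X, U)ˣ) := hb
  refine IsUnit.of_mul_eq_one b (L.toΓ_injective_of_isUnit ?_ ?_)
  · rw [map_mul, hb, ← hv, Units.mul_inv]
    exact isUnit_one
  · rw [map_mul, hb, ← hv, Units.mul_inv, map_one]

/-- The unit section of the sheaf of monoids corresponding to a unit. -/
def unitSection {U : X.Opens} (v : Γ(X, U)ˣ) : (L.M.obj (op U))ˣ :=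
  (L.isUnit_of_isUnit_toΓ (a := (L.existsUnique_unit U v v.isUnit).choose) (by
    have h : L.toΓ U _ = _ := (L.existsUnique_unit U v v.isUnit).choose_spec.1
    rw [h]
    exact v.isUnit)).unit

lemma toΓ_unitSection {U : X.Opens} (v : Γ(X, U)ˣ) : L.toΓ U (L.unitSection v) = v :=
  (L.existsUnique_unit U v v.isUnit).choose_spec.1

lemma isUnit_germ_iff {x : X} {U : X.Opens} {hx : x ∈ U} {m : L.M.obj (op U)} :
    IsUnit (L.germ U x hx m) ↔ IsUnit (X.presheaf.germ U x hx (L.toΓ U m)) := by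
  constructor
  · intro h
    rw [← alphaStalk_germ]
    exact h.map _
  · intro h
    have hle := X.basicOpen_le (L.toΓ U m)
    have hxm : x ∈ X.basicOpen (L.toΓ U m) := (Scheme.mem_basicOpen X _ x hx).2 h
    rw [← L.germ_res hle x hxm]
    refine IsUnit.map _ (L.isUnit_of_isUnit_toΓ ?_)
    rw [toΓ_res]
    exact RingedSpace.isUnit_res_basicOpen X.toRingedSpace _

lemma isUnit_iff {x : X} {m : L.stalk x} : IsUnit m ↔ IsUnit (L.alphaStalk x m) := by
  obtain ⟨U, -, hx, m, rfl⟩ := L.exists_germ m (V := ⊤) trivial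
  rw [isUnit_germ_iff, alphaStalk_germ]

/-- A unit of the stalk is the germ of a unit section. -/
lemma exists_unitSection {x : X} (v : (L.stalk x)ˣ) {V : X.Opens} (hV : x ∈ V) :
    ∃ (U : X.Opens) (_ : U ≤ V) (hx : x ∈ U) (w : Γ(X, U)ˣ), L.germ U x hx (L.unitSection w) = v := by
  obtain ⟨U, hUV, hx, m, hm⟩ := L.exists_germ (v : L.stalk x) hV
  have h : IsUnit (X.presheaf.germ U x hx (L.toΓ U m)) := by
    rw [← isUnit_germ_iff, hm]
    exact v.isUnit
  have hle := X.basicOpen_le (L.toΓ U m)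
  have hxm : x ∈ X.basicOpen (L.toΓ U m) := (Scheme.mem_basicOpen X _ x hx).2 h
  have hu : IsUnit (L.toΓ _ (L.res hle m)) := by
    rw [toΓ_res]
    exact RingedSpace.isUnit_res_basicOpen X.toRingedSpace _
  refine ⟨_, hle.trans hUV, hxm, hu.unit, ?_⟩
  rw [← hm, ← L.germ_res hle x hxm]
  congr 1
  exact L.toΓ_injective_of_isUnit (by rw [toΓ_unitSection]; exact hu.unit.isUnit)
    (by rw [toΓ_unitSection, IsUnit.unit_spec])

lemma alphaStalk_injective_of_isUnit {x : X} {a b : L.stalk x} (ha : IsUnit a)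
    (h : L.alphaStalk x a = L.alphaStalk x b) : a = b := by
  have hb : IsUnit b := by rw [isUnit_iff, ← h, ← isUnit_iff]; exact ha
  obtain ⟨a, rfl⟩ := ha
  obtain ⟨b, rfl⟩ := hb
  obtain ⟨U, -, hxU, v, hv⟩ := L.exists_unitSection a (V := ⊤) trivial
  obtain ⟨V, -, hxV, w, hw⟩ := L.exists_unitSection b (V := ⊤) trivial
  rw [← hv, ← hw, alphaStalk_germ, alphaStalk_germ, toΓ_unitSection, toΓ_unitSection] at h
  obtain ⟨W, hxW, i, j, e⟩ := TopCat.Presheaf.germ_eq X.presheaf x hxU hxV _ _ h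
  rw [← hv, ← hw, ← L.germ_res i.le x hxW, ← L.germ_res j.le x hxW]
  congr 1
  refine L.toΓ_injective_of_isUnit ?_ ?_
  · rw [toΓ_res, toΓ_unitSection]
    exact v.isUnit.map (X.presheaf.map _).hom
  · rw [toΓ_res, toΓ_unitSection, toΓ_res, toΓ_unitSection]
    exact e

-- The stalk is the amalgamated sum of an fs monoid `P` with units. The injectivity clause of the
-- chart turns an identity of germs into one in `P`, up to factors that become units at `x`;
-- cancellation and saturation in `P` then transfer.
variable {L} in
lemma IsFs.isSaturatedMonoid_stalk (hL : L.IsFs) (x : X) : IsSaturatedMonoid (L.stalk x) := by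
  obtain ⟨U, hx, P, _, β, hP, hβ⟩ := hL x
  obtain ⟨h1, h2⟩ := hβ x hx
  have := hP.isSaturatedMonoid
  set b : P →* L.stalk x := (L.germ U x hx).comp β with hb
  change ∀ m, ∃ p v, b p * _ = m at h1
  change ∀ p q v, b p * _ = b q → ∃ s t, IsUnit (b s) ∧ IsUnit (b t) ∧ _ ∧ _ * b t = b s at h2
  have key : ∀ a c e : L.stalk x, a * c = a * e → c = e := by
    intro a c e h
    obtain ⟨p, v, rfl⟩ := h1 a
    obtain ⟨q, v', rfl⟩ := h1 c
    obtain ⟨r, v'', rfl⟩ := h1 e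
    have h3 : b (p * q) * ((v' * v''⁻¹ : (L.stalk x)ˣ) : L.stalk x) = b (p * r) := by
      rw [map_mul, map_mul, Units.val_mul, ← mul_assoc, Units.mul_inv_eq_iff_eq_mul]
      apply (v.isUnit).mul_left_cancel
      calc _ = b p * v * (b q * v') := by ac_rfl
        _ = _ := by rw [h]; ac_rfl
    obtain ⟨s, t, -, ht, h4, h5⟩ := h2 _ _ _ h3
    rw [mul_assoc, mul_assoc] at h4
    have h6 := congrArg b (mul_left_cancel h4)
    rw [map_mul, map_mul, ← h5, ← mul_assoc] at h6
    have h7 := ht.mul_right_cancel h6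
    rw [Units.val_mul, ← mul_assoc, Units.mul_inv_eq_iff_eq_mul] at h7
    exact h7
  refine { mul_left_cancel := fun a c e h => key a c e h
           mul_right_cancel := fun a c e h => key a c e (by simpa [mul_comm] using h)
           dvd_of_pow_dvd_pow := ?_ }
  rintro a c n hn ⟨e, h⟩
  obtain ⟨p, v, rfl⟩ := h1 a
  obtain ⟨q, v', rfl⟩ := h1 c
  obtain ⟨r, v'', rfl⟩ := h1 e
  have h3 : b (q ^ n * r) * ((v' ^ n * v'' * (v ^ n)⁻¹ : (L.stalk x)ˣ) : L.stalk x) = b (p ^ n) := by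
    rw [map_mul, map_pow, map_pow, Units.val_mul, ← mul_assoc, Units.mul_inv_eq_iff_eq_mul,
      Units.val_pow_eq_pow_val, ← mul_pow, h, mul_pow, Units.val_mul, Units.val_pow_eq_pow_val]
    ac_rfl
  obtain ⟨s, t, -, ht, h4, -⟩ := h2 _ _ _ h3
  have h5 : q ^ n ∣ (p * t) ^ n := by
    obtain ⟨n, rfl⟩ : ∃ n', n = n' + 1 := ⟨n - 1, by omega⟩
    refine ⟨r * s * t ^ n, ?_⟩
    rw [mul_pow, pow_succ t, mul_comm _ t, ← mul_assoc, ← h4]; ac_rfl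
  have h6 := map_dvd b (dvd_of_pow_dvd_pow' hn h5)
  rw [map_mul] at h6
  exact (Units.mul_right_dvd).2 ((Units.dvd_mul_right).2 ((ht.dvd_mul_right).1 h6))

variable {L} in
lemma IsFs.fg_charStalk (hL : L.IsFs) (x : X) : Monoid.FG (L.charStalk x) := by
  obtain ⟨U, hx, P, _, β, hP, hβ⟩ := hL x
  have := hP.fg
  let b : P →* L.charStalk x := (Associates.mkMonoidHom).comp ((L.germ U x hx).comp β)
  refine Monoid.fg_of_surjective b fun m => ?_
  obtain ⟨m, rfl⟩ := Associates.mk_surjective m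
  obtain ⟨p, v, rfl⟩ := (hβ x hx).1 m
  exact ⟨p, Associates.mk_eq_mk_iff_associated.2 ⟨v, rfl⟩⟩

end LogStructure

/-! ### Constant hollow log structures -/

section Hollow

variable (T : Scheme.{u}) (Q : Type u) [CommMonoid Q]

/-- Restriction of locally constant functions. -/
def LocallyConstant.restrictHom {U V : T.Opens} (h : U ≤ V) :
    LocallyConstant V Q →* LocallyConstant U Q where
  toFun q := ⟨fun x => q ⟨x.1, h x.2⟩,
    q.isLocallyConstant.comp_continuous (continuous_inclusion h)⟩
  map_one' := rfl
  map_mul' _ _ := rfl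

/-- The presheaf `𝒪ˣ × Q`. -/
def hollowPresheaf : TopCat.Presheaf CommMonCat.{u} T where
  obj U := CommMonCat.of ((Γ(T, U.unop))ˣ × LocallyConstant U.unop Q)
  map i := CommMonCat.ofHom (MonoidHom.prodMap (Units.map (T.presheaf.map i).hom.toMonoidHom)
    (LocallyConstant.restrictHom T Q i.unop.le))
  map_id U := by
    refine CommMonCat.hom_ext (MonoidHom.ext fun a => Prod.ext (Units.ext ?_) rfl)
    change T.presheaf.map (𝟙 U) a.1.1 = a.1.1
    rw [T.presheaf.map_id]
    rfl
  map_comp i j := by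
    refine CommMonCat.hom_ext (MonoidHom.ext fun a => Prod.ext (Units.ext ?_) rfl)
    change T.presheaf.map (i ≫ j) a.1.1 = T.presheaf.map j (T.presheaf.map i a.1.1)
    rw [T.presheaf.map_comp]
    rfl

variable {T Q}

lemma hollow_ext {U : T.Opens} {s t : (hollowPresheaf T Q).obj (op U)}
    (h1 : ∀ (x : T) (hx : x ∈ U), T.presheaf.germ U x hx s.1.1 = T.presheaf.germ U x hx t.1.1)
    (h2 : ∀ (x : T) (hx : x ∈ U), s.2 ⟨x, hx⟩ = t.2 ⟨x, hx⟩) : s = t :=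
  Prod.ext (Units.ext (Scheme.section_ext h1)) (LocallyConstant.ext fun x => h2 x.1 x.2)

/-- Sections of the hollow log structure with prescribed coordinates at all points. -/
lemma exists_hollow {U : T.Opens} (g : ∀ x ∈ U, T.presheaf.stalk x) (q : ∀ x ∈ U, Q)
    (h : ∀ x ∈ U, ∃ (W : T.Opens) (_ : x ∈ W) (hWU : W ≤ U) (v : Γ(T, W)ˣ) (c : Q),
      ∀ (y : T) (hy : y ∈ W), T.presheaf.germ W y hy v = g y (hWU hy) ∧ q y (hWU hy) = c) :
    ∃ s : (hollowPresheaf T Q).obj (op U), ∀ (x : T) (hx : x ∈ U),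
      T.presheaf.germ U x hx s.1.1 = g x hx ∧ s.2 ⟨x, hx⟩ = q x hx := by
  obtain ⟨t, ht⟩ := Scheme.exists_section_of_germs g fun x hx => by
    obtain ⟨W, hxW, hWU, v, c, hv⟩ := h x hx
    exact ⟨W, hxW, hWU, v, fun y hy => (hv y hy).1⟩
  have htu : IsUnit t := by
    refine RingedSpace.isUnit_of_isUnit_germ T.toRingedSpace U _ fun x hx => ?_
    obtain ⟨W, hxW, hWU, v, c, hv⟩ := h x hx
    have h1 : T.presheaf.germ U x hx t = T.presheaf.germ W x hxW v :=
      (ht x hx).trans (hv x hxW).1.symm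
    exact h1.symm ▸ v.isUnit.map (T.presheaf.germ W x hxW).hom
  refine ⟨(htu.unit, ⟨fun x => q x.1 x.2, ?_⟩), fun x hx => ⟨ht x hx, rfl⟩⟩
  rw [IsLocallyConstant.iff_exists_open]
  rintro ⟨x, hx⟩
  obtain ⟨W, hxW, hWU, v, c, hv⟩ := h x hx
  refine ⟨Subtype.val ⁻¹' (W : Set T), W.2.preimage continuous_subtype_val, hxW, fun y hy => ?_⟩
  exact (hv y.1 hy).2.trans (hv x hxW).2.symm

/-- Locally a section of `𝒪ˣ × Q` has constant second component. -/
lemma hollow_exists_const {U : T.Opens} (s : (hollowPresheaf T Q).obj (op U)) (x : T)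
    (hx : x ∈ U) : ∃ (W : T.Opens) (_ : x ∈ W) (hWU : W ≤ U),
      ∀ (y : T) (hy : y ∈ W), s.2 ⟨y, hWU hy⟩ = s.2 ⟨x, hx⟩ := by
  have h1 := s.2.isLocallyConstant.isOpen_fiber (s.2 ⟨x, hx⟩)
  refine ⟨⟨Subtype.val '' _, U.2.isOpenMap_subtype_val _ h1⟩, ⟨⟨x, hx⟩, rfl, rfl⟩, ?_, ?_⟩
  · rintro _ ⟨y, -, rfl⟩
    exact y.2
  · rintro _ ⟨y, hy, rfl⟩
    exact hy

lemma hollowPresheaf_isSheaf : (hollowPresheaf T Q).IsSheaf := by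
  rw [TopCat.Presheaf.isSheaf_iff_isSheafUniqueGluing]
  intro ι U s hs
  have hs1 : ∀ i j (x : T) (hi : x ∈ U i) (hj : x ∈ U j),
      T.presheaf.germ (U i) x hi (s i).1.1 = T.presheaf.germ (U j) x hj (s j).1.1 ∧
      (s i).2 ⟨x, hi⟩ = (s j).2 ⟨x, hj⟩ := by
    intro i j x hi hj
    have h := hs i j
    constructor
    · have h1 : T.presheaf.map (Opens.infLELeft (U i) (U j)).op (s i).1.1 =
        T.presheaf.map (Opens.infLERight (U i) (U j)).op (s j).1.1 := congrArg (fun z => z.1.1) h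
      have h2 := congrArg (T.presheaf.germ _ x (⟨hi, hj⟩ : x ∈ U i ⊓ U j)) h1
      exact (TopCat.Presheaf.germ_res_apply T.presheaf (Opens.infLELeft (U i) (U j)) x ⟨hi, hj⟩
        _).symm.trans (h2.trans (TopCat.Presheaf.germ_res_apply T.presheaf
          (Opens.infLERight (U i) (U j)) x ⟨hi, hj⟩ _))
    · exact congrArg (fun z => z.2 ⟨x, hi, hj⟩) h
  have hmem : ∀ x ∈ iSup U, ∃ i, x ∈ U i := fun x hx => Opens.mem_iSup.1 hx
  choose i hi using hmem
  obtain ⟨t, ht⟩ := exists_hollow (U := iSup U)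
    (fun x hx => T.presheaf.germ _ x (hi x hx) (s (i x hx)).1.1)
    (fun x hx => (s (i x hx)).2 ⟨x, hi x hx⟩) (by
      intro x hx
      obtain ⟨W, hxW, hWU, hc⟩ := hollow_exists_const (s (i x hx)) x (hi x hx)
      refine ⟨W, hxW, hWU.trans (le_iSup U _), Units.map (T.presheaf.map (homOfLE hWU).op).hom.toMonoidHom
        (s (i x hx)).1, (s (i x hx)).2 ⟨x, hi x hx⟩, fun y hy => ⟨?_, ?_⟩⟩
      · exact (TopCat.Presheaf.germ_res_apply T.presheaf (homOfLE hWU) y hy _).trans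
          (hs1 _ _ _ _ _).1
      · exact (hs1 _ _ _ (hi _ _) (hWU hy)).2.trans (hc y hy))
  have htr : ∀ (j : ι) (x : T) (hx : x ∈ U j),
      T.presheaf.germ (U j) x hx ((hollowPresheaf T Q).map (Opens.leSupr U j).op t).1.1 =
        T.presheaf.germ _ x (Opens.mem_iSup.2 ⟨j, hx⟩ : x ∈ iSup U) t.1.1 := fun j x hx =>
    TopCat.Presheaf.germ_res_apply T.presheaf (Opens.leSupr U j) x hx t.1.1
  refine ⟨t, fun j => hollow_ext (fun x hx => ?_) fun x hx => ?_, fun t' ht' =>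
    hollow_ext (fun x hx => ?_) fun x hx => ?_⟩
  · exact (htr j x hx).trans ((ht x _).1.trans (hs1 _ _ _ _ _).1)
  · exact (ht x _).2.trans (hs1 _ _ _ _ _).2
  · rw [(ht x hx).1, ← ht' (i x hx)]
    exact (TopCat.Presheaf.germ_res_apply T.presheaf (Opens.leSupr U _) x (hi x hx) t'.1.1).symm
  · rw [(ht x hx).2, ← ht' (i x hx)]
    rfl

open Classical in
lemma exists_hollowAlpha {U : T.Opens} (s : (hollowPresheaf T Q).obj (op U)) :
    ∃ a : Γ(T, U), ∀ (x : T) (hx : x ∈ U), T.presheaf.germ U x hx a =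
      if s.2 ⟨x, hx⟩ = 1 then T.presheaf.germ U x hx s.1.1 else 0 := by
  refine Scheme.exists_section_of_germs _ fun x hx => ?_
  obtain ⟨W, hxW, hWU, hc⟩ := hollow_exists_const s x hx
  refine ⟨W, hxW, hWU, if s.2 ⟨x, hx⟩ = 1 then T.presheaf.map (homOfLE hWU).op s.1.1 else 0,
    fun y hy => ?_⟩
  rw [hc y hy]
  split_ifs
  · exact TopCat.Presheaf.germ_res_apply T.presheaf (homOfLE hWU) y hy s.1.1
  · exact map_zero _

/-- The map `𝒪ˣ × Q → 𝒪` that is the inclusion on `𝒪ˣ × {1}` and zero elsewhere. -/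
def hollowAlpha {U : T.Opens} (s : (hollowPresheaf T Q).obj (op U)) : Γ(T, U) :=
  (exists_hollowAlpha s).choose

open Classical in
lemma germ_hollowAlpha {U : T.Opens} (s : (hollowPresheaf T Q).obj (op U)) (x : T) (hx : x ∈ U) :
    T.presheaf.germ U x hx (hollowAlpha s) =
      if s.2 ⟨x, hx⟩ = 1 then T.presheaf.germ U x hx s.1.1 else 0 :=
  (exists_hollowAlpha s).choose_spec x hx

variable (T Q) [Subsingleton Qˣ]

lemma mul_eq_one_iff_of_sharp {a b : Q} : a * b = 1 ↔ a = 1 ∧ b = 1 := by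
  constructor
  · intro h
    have h1 : Units.mkOfMulEqOne a b h = 1 := Subsingleton.elim _ _
    have h2 : a = 1 := congrArg Units.val h1
    exact ⟨h2, by rwa [h2, one_mul] at h⟩
  · rintro ⟨rfl, rfl⟩
    exact one_mul 1

open Classical in
/-- The constant hollow log structure with sharp monoid `Q`. -/
def hollowLog : LogStructure T where
  M := hollowPresheaf T Q
  isSheaf := hollowPresheaf_isSheaf
  α :=
    { app := fun U => CommMonCat.ofHom
        { toFun := fun s => hollowAlpha (U := U.unop) s
          map_one' := by
            refine Scheme.section_ext fun x hx => ?_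
            exact (germ_hollowAlpha (U := U.unop) _ x hx).trans (if_pos rfl)
          map_mul' := fun s t => by
            refine Scheme.section_ext fun x hx => ?_
            refine (germ_hollowAlpha _ x hx).trans (Eq.trans ?_ (map_mul
              (T.presheaf.germ U.unop x hx).hom (hollowAlpha (U := U.unop) s)
              (hollowAlpha (U := U.unop) t)).symm)
            refine Eq.trans ?_ (congrArg₂ (· * ·) (germ_hollowAlpha (U := U.unop) s x hx)
              (germ_hollowAlpha (U := U.unop) t x hx)).symm
            change (if s.2 ⟨x, hx⟩ * t.2 ⟨x, hx⟩ = 1 then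
              T.presheaf.germ U.unop x hx (s.1.1 * t.1.1) else 0) = _
            rw [mul_eq_one_iff_of_sharp, map_mul]
            by_cases h1 : s.2 ⟨x, hx⟩ = 1 <;> by_cases h2 : t.2 ⟨x, hx⟩ = 1 <;> simp [h1, h2] }
      naturality := fun U V i => by
        ext s
        refine Scheme.section_ext (U := V.unop) fun x hx => ?_
        refine (germ_hollowAlpha (U := V.unop) _ x hx).trans (Eq.trans ?_
          (TopCat.Presheaf.germ_res_apply' T.presheaf i x hx (hollowAlpha (U := U.unop) s)).symm)
        refine Eq.trans ?_ (germ_hollowAlpha (U := U.unop) s x (i.unop.le hx)).symm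
        refine if_congr Iff.rfl ?_ rfl
        exact TopCat.Presheaf.germ_res_apply' T.presheaf i x hx s.1.1 }
  existsUnique_unit U v hv := by
    refine ⟨((hv.unit, 1) : Γ(T, U)ˣ × LocallyConstant U Q), ?_, fun s hs => ?_⟩
    · refine Scheme.section_ext fun x hx => ?_
      exact (germ_hollowAlpha (U := U) _ x hx).trans (if_pos rfl)
    · have hs' : hollowAlpha (U := U) s = v := hs
      -- Where the second component is not `1` the germ of the value is `0`, which is not a unit in
      -- a local ring.
      have h1 : ∀ (x : T) (hx : x ∈ U), s.2 ⟨x, hx⟩ = 1 := by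
        intro x hx
        by_contra h
        have h2 := (germ_hollowAlpha (U := U) s x hx).trans (if_neg h)
        rw [hs'] at h2
        have h3 := hv.map (T.presheaf.germ U x hx).hom
        exact h3.ne_zero h2
      refine hollow_ext (fun x hx => ?_) h1
      have h2 := (germ_hollowAlpha (U := U) s x hx).trans (if_pos (h1 x hx))
      rw [hs'] at h2
      exact h2.symm

variable {T Q}

lemma germ_toΓ_hollowLog_of_eq_one {U : T.Opens} (s : (hollowLog T Q).M.obj (op U)) {x : T}
    (hx : x ∈ U) (h : s.2 ⟨x, hx⟩ = 1) :
    T.presheaf.germ U x hx ((hollowLog T Q).toΓ U s) = T.presheaf.germ U x hx s.1.1 :=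
  (germ_hollowAlpha s x hx).trans (if_pos h)

lemma hollowLog_unitSection {U : T.Opens} (v : Γ(T, U)ˣ) :
    ((hollowLog T Q).unitSection v : (hollowLog T Q).M.obj (op U)) =
      ((v, 1) : Γ(T, U)ˣ × LocallyConstant U Q) := by
  refine (hollowLog T Q).toΓ_injective_of_isUnit ?_ ?_
  · rw [LogStructure.toΓ_unitSection]
    exact v.isUnit
  · rw [LogStructure.toΓ_unitSection]
    refine Scheme.section_ext fun x hx => Eq.symm ?_
    exact germ_toΓ_hollowLog_of_eq_one (Q := Q)
      ((v, 1) : Γ(T, U)ˣ × LocallyConstant U Q) hx rfl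

lemma hollowLog_res_fst {U V : T.Opens} (h : U ≤ V) (s : (hollowLog T Q).M.obj (op V)) {x : T}
    (hx : x ∈ U) : T.presheaf.germ U x hx ((hollowLog T Q).res h s).1.1 =
      T.presheaf.germ V x (h hx) s.1.1 :=
  TopCat.Presheaf.germ_res_apply T.presheaf (homOfLE h) x hx s.1.1

lemma hollowLog_germ_eq_iff {U V : T.Opens} {x : T} {hU : x ∈ U} {hV : x ∈ V}
    {s : (hollowLog T Q).M.obj (op U)} {t : (hollowLog T Q).M.obj (op V)} :
    (hollowLog T Q).germ U x hU s = (hollowLog T Q).germ V x hV t ↔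
      T.presheaf.germ U x hU s.1.1 = T.presheaf.germ V x hV t.1.1 ∧ s.2 ⟨x, hU⟩ = t.2 ⟨x, hV⟩ := by
  constructor
  · intro h
    obtain ⟨W, hxW, hWU, hWV, e⟩ := (hollowLog T Q).exists_res_eq hU hV h
    refine ⟨?_, congrArg (fun z => z.2 ⟨x, hxW⟩) e⟩
    rw [← hollowLog_res_fst hWU s hxW, e, hollowLog_res_fst]
  · rintro ⟨h1, h2⟩
    obtain ⟨W, hxW, i, j, e⟩ := TopCat.Presheaf.germ_eq T.presheaf x hU hV _ _ h1
    obtain ⟨W₁, hxW₁, hWU, hc₁⟩ := hollow_exists_const s x hU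
    obtain ⟨W₂, hxW₂, hWV, hc₂⟩ := hollow_exists_const t x hV
    have hx' : x ∈ W ⊓ (W₁ ⊓ W₂) := ⟨hxW, hxW₁, hxW₂⟩
    have hU' : W ⊓ (W₁ ⊓ W₂) ≤ U := inf_le_left.trans i.le
    have hV' : W ⊓ (W₁ ⊓ W₂) ≤ V := inf_le_left.trans j.le
    rw [← (hollowLog T Q).germ_res hU' x hx', ← (hollowLog T Q).germ_res hV' x hx']
    congr 1
    refine hollow_ext (fun y hy => ?_) fun y hy => ?_
    · refine (hollowLog_res_fst hU' s hy).trans (Eq.trans ?_ (hollowLog_res_fst hV' t hy).symm)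
      have h3 := congrArg (T.presheaf.germ W y hy.1) e
      rwa [TopCat.Presheaf.germ_res_apply, TopCat.Presheaf.germ_res_apply] at h3
    · exact (hc₁ y hy.2.1).trans (h2.trans (hc₂ y hy.2.2).symm)

/-- The tautological global chart of the hollow log structure. -/
def hollowChart : Q →* (hollowLog T Q).M.obj (op ⊤) where
  toFun q := ((1, LocallyConstant.const _ q) : Γ(T, ⊤)ˣ × LocallyConstant (⊤ : T.Opens) Q)
  map_one' := rfl
  map_mul' _ _ := Prod.ext (mul_one (1 : Γ(T, ⊤)ˣ)).symm rfl

lemma hollowChart_isChart : (hollowLog T Q).IsChart ⊤ (hollowChart (T := T) (Q := Q)) := by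
  refine fun y hy => ⟨fun m => ?_, fun p q v h => ?_⟩
  · obtain ⟨U, -, hU, s, rfl⟩ := (hollowLog T Q).exists_germ m (V := ⊤) trivial
    refine ⟨s.2 ⟨y, hU⟩, Units.map ((hollowLog T Q).germ U y hU)
      ((hollowLog T Q).unitSection s.1), ?_⟩
    rw [Units.coe_map, hollowLog_unitSection, ← (hollowLog T Q).germ_res le_top y hU]
    refine (map_mul ((hollowLog T Q).germ U y hU) _ _).symm.trans (hollowLog_germ_eq_iff.2 ⟨?_, ?_⟩)
    · refine (map_mul (T.presheaf.germ U y hU).hom _ _).trans ?_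
      refine (congrArg (· * _) ((hollowLog_res_fst le_top _ hU).trans
        (map_one (T.presheaf.germ ⊤ y trivial).hom))).trans (one_mul _)
    · exact mul_one _
  · obtain ⟨U, -, hU, w, hw⟩ := (hollowLog T Q).exists_unitSection v (V := ⊤) trivial
    rw [← hw, hollowLog_unitSection, ← (hollowLog T Q).germ_res le_top y hU] at h
    obtain ⟨h1, h2⟩ := hollowLog_germ_eq_iff.1
      ((map_mul ((hollowLog T Q).germ U y hU) _ _).trans h)
    have h3 : T.presheaf.germ U y hU w = 1 := by
      refine Eq.trans ?_ (h1.trans (map_one (T.presheaf.germ ⊤ y hy).hom))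
      refine Eq.symm ((map_mul (T.presheaf.germ U y hU).hom _ _).trans ?_)
      exact (congrArg (· * _) ((hollowLog_res_fst le_top _ hU).trans
        (map_one (T.presheaf.germ ⊤ y trivial).hom))).trans (one_mul _)
    have h4 : (v : (hollowLog T Q).stalk y) = 1 := by
      rw [← hw, hollowLog_unitSection, ← map_one ((hollowLog T Q).germ U y hU)]
      exact hollowLog_germ_eq_iff.2 ⟨h3.trans (map_one (T.presheaf.germ U y hU).hom).symm, rfl⟩
    have h5 : p = q := (mul_one p).symm.trans h2
    refine ⟨1, 1, ?_, ?_, by rw [h5], ?_⟩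
    · rw [map_one, map_one]; exact isUnit_one
    · rw [map_one, map_one]; exact isUnit_one
    · rw [h4, one_mul]

lemma hollowLog_isFs (hQ : IsFsMonoid Q) : (hollowLog T Q).IsFs := fun _ =>
  ⟨⊤, trivial, Q, _, hollowChart, hQ, hollowChart_isChart⟩

/-- The coordinates of a section of the hollow log structure at a point. -/
def hollowCoord (U : T.Opens) (x : T) (hx : x ∈ U) :
    (hollowLog T Q).M.obj (op U) →* T.presheaf.stalk x × Q where
  toFun s := (T.presheaf.germ U x hx s.1.1, s.2 ⟨x, hx⟩)
  map_one' := Prod.ext (map_one (T.presheaf.germ U x hx).hom) rfl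
  map_mul' _ _ := Prod.ext (map_mul (T.presheaf.germ U x hx).hom _ _) rfl

lemma hollowCoord_ext {U : T.Opens} {s t : (hollowLog T Q).M.obj (op U)}
    (h : ∀ (x : T) (hx : x ∈ U), hollowCoord U x hx s = hollowCoord U x hx t) : s = t :=
  hollow_ext (fun x hx => congrArg Prod.fst (h x hx)) fun x hx => congrArg Prod.snd (h x hx)

lemma hollowCoord_map {U V : T.Opens} (i : U ⟶ V) (x : T) (hx : x ∈ U)
    (s : (hollowLog T Q).M.obj (op V)) :
    hollowCoord U x hx ((hollowLog T Q).M.map i.op s) = hollowCoord V x (i.le hx) s :=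
  Prod.ext (TopCat.Presheaf.germ_res_apply T.presheaf i x hx s.1.1) rfl

lemma hollowCoord_unitSection {U : T.Opens} (v : Γ(T, U)ˣ) (x : T) (hx : x ∈ U) :
    hollowCoord U x hx ((hollowLog T Q).unitSection v : (hollowLog T Q).M.obj (op U)) =
      (T.presheaf.germ U x hx v, 1) := by
  rw [hollowLog_unitSection]
  rfl

open Classical in
/-- The value of `α` in terms of coordinates. -/
def hollowVal {A : Type*} [Zero A] (z : A × Q) : A := if z.2 = 1 then z.1 else 0

lemma germ_toΓ_hollowLog {U : T.Opens} (s : (hollowLog T Q).M.obj (op U)) {x : T}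
    (hx : x ∈ U) :
    T.presheaf.germ U x hx ((hollowLog T Q).toΓ U s) = hollowVal (hollowCoord U x hx s) :=
  germ_hollowAlpha s x hx

end Hollow

/-! ### Morphisms from hollow log schemes -/

section HollowHom

variable {T : Scheme.{u}} {Q : Type u} [CommMonoid Q] [Subsingleton Qˣ]

variable (T Q) in
/-- The constant hollow log scheme. -/
abbrev hollow : LogScheme.{u} := LogScheme.mk T (hollowLog T Q)

lemma LogScheme.hom_ext_of_hollowCoord {S : LogScheme.{u}} {φ ψ : hollow T Q ⟶ S}
    (hb : φ.base = ψ.base)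
    (h : ∀ (U : S.scheme.Opens) (m : S.log.M.obj (op U)) (t : T) (ht : φ.base t ∈ U)
      (ht' : ψ.base t ∈ U), hollowCoord (φ.base ⁻¹ᵁ U) t ht (φ.comap U m) =
        hollowCoord (ψ.base ⁻¹ᵁ U) t ht' (ψ.comap U m)) : φ = ψ := by
  obtain ⟨b, c, h1, h2⟩ := φ
  obtain ⟨b', c', h1', h2'⟩ := ψ
  obtain rfl : b = b' := hb
  congr
  funext U
  exact MonoidHom.ext fun m => hollowCoord_ext fun t ht => h U m t ht ht

/-- A section of the hollow log structure amounts to a family of pointwise coordinates that is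
locally given by one unit section and one constant in `Q`. Compatible maps on stalks therefore
assemble to a morphism as soon as their values have this local form, which is `hloc`. -/
lemma LogScheme.exists_hollow_hom_of_stalks {S : LogScheme.{u}} (b : T ⟶ S.scheme)
    (h : ∀ t : T, S.log.stalk (b t) →* (T.presheaf.stalk t)ˣ × Q)
    (hα : ∀ (t : T) (m : S.log.stalk (b t)), b.stalkMap t (S.log.alphaStalk (b t) m) =
      hollowVal (((h t m).1 : T.presheaf.stalk t), (h t m).2))
    (hloc : ∀ (U : S.scheme.Opens) (m : S.log.M.obj (op U)) (t : T), b t ∈ U →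
      ∃ (W : T.Opens) (_ : t ∈ W) (hW : W ≤ b ⁻¹ᵁ U) (v : Γ(T, W)ˣ) (c : Q), ∀ (s : T) (hs : s ∈ W),
        T.presheaf.germ W s hs v = (h s (S.log.germ U (b s) (hW hs) m)).1 ∧
          (h s (S.log.germ U (b s) (hW hs) m)).2 = c) :
    ∃ φ : hollow T Q ⟶ S, φ.base = b ∧ ∀ (U : S.scheme.Opens) (m : S.log.M.obj (op U)) (t : T)
      (ht : φ.base t ∈ U) (ht' : b t ∈ U), hollowCoord (φ.base ⁻¹ᵁ U) t ht (φ.comap U m) =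
        (((h t (S.log.germ U (b t) ht' m)).1 : T.presheaf.stalk t),
          (h t (S.log.germ U (b t) ht' m)).2) := by
  have hex := fun (U : S.scheme.Opens) (m : S.log.M.obj (op U)) =>
    exists_hollow (T := T) (Q := Q) (U := b ⁻¹ᵁ U)
      (fun t ht => (h t (S.log.germ U (b t) ht m)).1) (fun t ht => (h t (S.log.germ U (b t) ht m)).2)
      (hloc U m)
  choose c hc using hex
  have hc' : ∀ (U : S.scheme.Opens) (m : S.log.M.obj (op U)) (t : T) (ht : t ∈ b ⁻¹ᵁ U),
      hollowCoord (b ⁻¹ᵁ U) t ht (c U m) =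
        (((h t (S.log.germ U (b t) ht m)).1 : T.presheaf.stalk t),
          (h t (S.log.germ U (b t) ht m)).2) := fun U m t ht =>
    Prod.ext (hc U m t ht).1 (hc U m t ht).2
  refine ⟨LogScheme.Hom.mk b (fun U => ⟨⟨c U, ?_⟩, fun m m' => ?_⟩) (fun {U V} i m => ?_)
    (fun U m => ?_), rfl, fun U m t ht ht' => hc' U m t ht'⟩
  · refine hollowCoord_ext fun t ht => ?_
    rw [hc', map_one, map_one, map_one]
    rfl
  · refine hollowCoord_ext fun t ht => ?_
    rw [map_mul]
    change hollowCoord (b ⁻¹ᵁ U) t ht (c U (m * m')) = hollowCoord (b ⁻¹ᵁ U) t ht (c U m) *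
      hollowCoord (b ⁻¹ᵁ U) t ht (c U m')
    rw [hc', hc', hc', map_mul, map_mul]
    rfl
  · refine hollowCoord_ext fun t ht => ?_
    refine (hc' _ _ t ht).trans (Eq.trans ?_ (hollowCoord_map _ t ht _).symm)
    refine Eq.trans ?_ (hc' _ _ t (i.le ht)).symm
    rw [show S.log.germ U (b t) ht (S.log.M.map i.op m) = S.log.germ V (b t) (i.le ht) m from
      S.log.germ_res i.le _ ht m]
  · refine Scheme.section_ext fun t ht => ?_
    refine (germ_toΓ_hollowLog _ ht).trans ?_
    refine (congrArg hollowVal (hc' U m t ht)).trans ?_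
    exact (hα _ _).symm.trans ((congrArg _ (S.log.alphaStalk_germ U ht m)).trans
      (Scheme.Hom.germ_stalkMap_apply b U t ht _))

variable {S : LogScheme.{u}}

/-- The two conditions on a chart at one point. -/
def LogStructure.IsChartAt {X : Scheme.{u}} (L : LogStructure X) (U : X.Opens) {P : Type u}
    [CommMonoid P] (β : P →* L.M.obj (op U)) (y : X) (hy : y ∈ U) : Prop :=
  (∀ m : L.stalk y, ∃ (p : P) (v : (L.stalk y)ˣ), L.germ U y hy (β p) * v = m) ∧
    (∀ (p q : P) (v : (L.stalk y)ˣ), L.germ U y hy (β p) * v = L.germ U y hy (β q) →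
      ∃ a b : P, IsUnit (L.germ U y hy (β a)) ∧ IsUnit (L.germ U y hy (β b)) ∧
        p * a = q * b ∧ v * L.germ U y hy (β b) = L.germ U y hy (β a))

/-- In a neighbourhood of a point, a section is the product of an element of the chart and a
unit. -/
lemma LogStructure.exists_res_eq_mul_unitSection {X : Scheme.{u}} (L : LogStructure X)
    {U V : X.Opens} {y : X} (hU : y ∈ U) (hV : y ∈ V) (m : L.M.obj (op U)) (n : L.M.obj (op V))
    (v : (L.stalk y)ˣ) (h : L.germ V y hV n * v = L.germ U y hU m) :
    ∃ (W : X.Opens) (hW : y ∈ W) (hWU : W ≤ U) (hWV : W ≤ V) (w : Γ(X, W)ˣ),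
      L.res hWU m = L.res hWV n * L.unitSection w ∧ L.germ W y hW (L.unitSection w) = v := by
  obtain ⟨W, hWV, hW, w, hw⟩ := L.exists_unitSection v hV
  rw [← hw, ← L.germ_res hWV y hW, ← map_mul] at h
  obtain ⟨W', hW', i, j, e⟩ := L.exists_res_eq hW hU h
  have h1 : L.res i (L.unitSection w) = L.unitSection (Units.map (X.presheaf.map (homOfLE i).op).hom.toMonoidHom w) := by
    refine L.toΓ_injective_of_isUnit ?_ ?_
    · rw [toΓ_res, toΓ_unitSection]
      exact w.isUnit.map (X.presheaf.map _).hom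
    · rw [toΓ_res, toΓ_unitSection, toΓ_unitSection]
      rfl
  refine ⟨W', hW', j, i.trans hWV,
    Units.map (X.presheaf.map (homOfLE i).op).hom.toMonoidHom w, ?_, ?_⟩
  · rw [← e, map_mul, L.res_res, h1]
  · rw [← h1, L.germ_res, hw]

/-- A unit section of the monoid sheaf is determined by its image under `α`, so compatibility with
`α` leaves no freedom for its pullback. -/
lemma LogScheme.Hom.hollowCoord_comap_unitSection (φ : hollow T Q ⟶ S) {U : S.scheme.Opens}
    (v : Γ(S.scheme, U)ˣ) (t : T) (ht : t ∈ φ.base ⁻¹ᵁ U) :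
    hollowCoord (φ.base ⁻¹ᵁ U) t ht (φ.comap U (S.log.unitSection v)) =
      (T.presheaf.germ (φ.base ⁻¹ᵁ U) t ht (φ.base.app U v), 1) := by
  have h1 : (hollowLog T Q).toΓ _ (φ.comap U (S.log.unitSection v)) = φ.base.app U v :=
    (φ.toΓ_comap U _).trans (by rw [S.log.toΓ_unitSection])
  have h2 : φ.comap U (S.log.unitSection v) =
      (hollowLog T Q).unitSection (Units.map (φ.base.app U).hom.toMonoidHom v) := by
    refine (hollowLog T Q).toΓ_injective_of_isUnit ?_ ?_
    · rw [h1]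
      exact v.isUnit.map (φ.base.app U).hom
    · rw [h1, LogStructure.toΓ_unitSection]
      rfl
  rw [h2, hollowCoord_unitSection]
  rfl

lemma LogScheme.Hom.hollowCoord_comap_res (φ : hollow T Q ⟶ S) {U V : S.scheme.Opens} (h : U ≤ V)
    (m : S.log.M.obj (op V)) (t : T) (ht : t ∈ φ.base ⁻¹ᵁ U) :
    hollowCoord (φ.base ⁻¹ᵁ U) t ht (φ.comap U (S.log.res h m)) =
      hollowCoord (φ.base ⁻¹ᵁ V) t (h ht) (φ.comap V m) :=
  (congrArg _ (φ.comap_res (homOfLE h) m)).trans (hollowCoord_map _ _ _ _)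

/-- A morphism from a hollow log scheme is determined by its effect on local charts. -/
lemma LogScheme.hom_ext_of_chart {φ ψ : hollow T Q ⟶ S} (hb : φ.base = ψ.base)
    (h : ∀ t : T, ∃ (V : S.scheme.Opens) (hV : φ.base t ∈ V) (hV' : ψ.base t ∈ V) (P : Type u)
      (_ : CommMonoid P) (β : P →* S.log.M.obj (op V)),
      S.log.IsChartAt V β (φ.base t) hV ∧ ∀ p, hollowCoord (φ.base ⁻¹ᵁ V) t hV (φ.comap V (β p)) =
        hollowCoord (ψ.base ⁻¹ᵁ V) t hV' (ψ.comap V (β p))) : φ = ψ := by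
  refine LogScheme.hom_ext_of_hollowCoord hb fun U m t ht ht' => ?_
  obtain ⟨V, hV, hV', P, _, β, ⟨hβ, -⟩, hc⟩ := h t
  obtain ⟨p, v, hpv⟩ := hβ (S.log.germ U _ ht m)
  obtain ⟨W, hW, hWU, hWV, w, e, -⟩ := S.log.exists_res_eq_mul_unitSection ht hV m (β p) v hpv
  have hW' : ψ.base t ∈ W := by rw [← hb]; exact hW
  rw [← φ.hollowCoord_comap_res hWU m t hW, ← ψ.hollowCoord_comap_res hWU m t hW', e,
    map_mul, map_mul, map_mul, map_mul]
  refine congrArg₂ (· * ·) ?_ ?_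
  · exact (φ.hollowCoord_comap_res hWV _ t hW).trans
      ((hc p).trans (ψ.hollowCoord_comap_res hWV _ t hW').symm)
  · refine (φ.hollowCoord_comap_unitSection w t hW).trans
      (Eq.trans ?_ (ψ.hollowCoord_comap_unitSection w t hW').symm)
    clear hc
    obtain ⟨b, c, h1, h2⟩ := φ
    obtain ⟨b', c', h1', h2'⟩ := ψ
    obtain rfl : b = b' := hb
    rfl

variable [IsCancelMul Q]

/-- Construction of a morphism from a hollow log scheme by means of a chart. -/
theorem LogScheme.exists_hollow_hom_of_chart (b : T ⟶ S.scheme) (V : S.scheme.Opens)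
    (hV : ∀ t, b t ∈ V) {P : Type u} [CommMonoid P] (β : P →* S.log.M.obj (op V))
    (hβ : ∀ t, S.log.IsChartAt V β (b t) (hV t)) (η : P →* Γ(T, ⊤)ˣ × Q)
    (hη : ∀ p t, T.presheaf.germ (b ⁻¹ᵁ V) t (hV t) (b.app V (S.log.toΓ V (β p))) =
      hollowVal (T.presheaf.germ ⊤ t trivial (η p).1, (η p).2)) :
    ∃ φ : hollow T Q ⟶ S, φ.base = b ∧ ∀ (p : P) (t : T) (ht : φ.base t ∈ V),
      hollowCoord (φ.base ⁻¹ᵁ V) t ht (φ.comap V (β p)) =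
        (T.presheaf.germ ⊤ t trivial (η p).1, (η p).2) := by
  let u := fun t : T => Units.map ((b.stalkMap t).hom.toMonoidHom.comp (S.log.alphaStalk (b t)))
  let ηt := fun t : T => (MonoidHom.prodMap (Units.map (T.presheaf.germ ⊤ t trivial).hom.toMonoidHom)
    (MonoidHom.id Q)).comp η
  let e := fun (t : T) (v : (S.log.stalk (b t))ˣ) => ((u t v, 1) : (T.presheaf.stalk t)ˣ × Q)
  have he : ∀ t v v', e t (v * v') = e t v * e t v' := fun t v v' =>
    Prod.ext (map_mul (u t) v v') (one_mul 1).symm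
  have hη' : ∀ p t, b.stalkMap t (S.log.alphaStalk (b t) (S.log.germ V (b t) (hV t) (β p))) =
      hollowVal (((ηt t p).1 : T.presheaf.stalk t), (ηt t p).2) := by
    intro p t
    rw [S.log.alphaStalk_germ]
    exact (Scheme.Hom.germ_stalkMap_apply b V t (hV t) _).trans (hη p t)
  -- A unit pulls back to a unit, so the hollow value of `η p` is nonzero; this forces its
  -- `Q`-component to be `1` and its first component to be the pulled back unit.
  have hunit : ∀ p t (hp : IsUnit (S.log.germ V (b t) (hV t) (β p))), ηt t p = e t hp.unit := by
    intro p t hp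
    have h1 : IsUnit (hollowVal (((ηt t p).1 : T.presheaf.stalk t), (ηt t p).2)) := by
      rw [← hη']
      exact (hp.map (S.log.alphaStalk (b t))).map (b.stalkMap t).hom
    have h2 : (ηt t p).2 = 1 := by
      by_contra h
      rw [hollowVal, if_neg h] at h1
      exact h1.ne_zero rfl
    refine Prod.ext (Units.ext ?_) h2
    exact ((hη' p t).trans (if_pos h2)).symm
  -- The stalk is the amalgamated sum of `P` and the units. By `hunit`, `η` and the pullback of
  -- units agree on the elements of `P` that become units, so together they define a map on the
  -- stalk.
  have hex : ∀ (t : T) (m : S.log.stalk (b t)), ∃ z : (T.presheaf.stalk t)ˣ × Q,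
      ∀ (p : P) (v : (S.log.stalk (b t))ˣ),
      S.log.germ V (b t) (hV t) (β p) * v = m → z = ηt t p * e t v := by
    intro t m
    obtain ⟨p, v, hpv⟩ : ∃ (p : P) (v : (S.log.stalk (b t))ˣ), _ := (hβ t).1 m
    refine ⟨ηt t p * e t v, fun q v' hqv => ?_⟩
    have h1 : S.log.germ V (b t) (hV t) (β p) * ((v * v'⁻¹ : (S.log.stalk (b t))ˣ) : S.log.stalk (b t)) =
        S.log.germ V (b t) (hV t) (β q) := by
      rw [Units.val_mul, ← mul_assoc, Units.mul_inv_eq_iff_eq_mul, hpv, hqv]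
    obtain ⟨x, y, hx, hy, hxy, hv⟩ := (hβ t).2 p q _ h1
    have h2 : v * hy.unit = v' * hx.unit := by
      have : v * v'⁻¹ * hy.unit = hx.unit := Units.ext hv
      rw [← this, mul_comm v', mul_right_comm, inv_mul_cancel_right]
    have h3 := congrArg (ηt t) hxy
    rw [map_mul, map_mul, hunit x t hx, hunit y t hy] at h3
    apply mul_right_cancel (b := e t hx.unit)
    rw [mul_right_comm, h3, mul_assoc, ← he, mul_comm hy.unit, h2, he, mul_assoc]
  choose h hh using hex
  have hmul : ∀ t m m', h t (m * m') = h t m * h t m' := by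
    intro t m m'
    obtain ⟨p, v, hpv⟩ := (hβ t).1 m
    obtain ⟨p', v', hpv'⟩ := (hβ t).1 m'
    rw [hh t m p v hpv, hh t m' p' v' hpv', hh t (m * m') (p * p') (v * v') (by
      rw [← hpv, ← hpv', map_mul, map_mul, Units.val_mul]; ac_rfl), map_mul, he]
    ac_rfl
  have hone : ∀ t, h t 1 = 1 := fun t => by
    refine (hh t 1 1 1 (by rw [map_one, map_one, Units.val_one, one_mul])).trans ?_
    rw [map_one, one_mul]
    exact Prod.ext (map_one (u t)) rfl
  refine (LogScheme.exists_hollow_hom_of_stalks b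
    (fun t => ⟨⟨h t, hone t⟩, hmul t⟩) ?_ ?_).imp fun φ ⟨hb, hφ⟩ =>
      ⟨hb, fun p t ht => (hφ V (β p) t ht (hV t)).trans ?_⟩
  · intro t m
    obtain ⟨p, v, rfl⟩ := (hβ t).1 m
    change _ = hollowVal ((((h t _).1 : (T.presheaf.stalk t)ˣ) : T.presheaf.stalk t), (h t _).2)
    rw [hh t _ p v rfl, map_mul, map_mul, hη']
    have h1 : (ηt t p * e t v).2 = (ηt t p).2 := mul_one _
    unfold hollowVal
    rw [h1]
    split_ifs
    · rfl
    · exact zero_mul _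
  · intro U m t ht
    obtain ⟨p, v, hpv⟩ := (hβ t).1 (S.log.germ U _ ht m)
    obtain ⟨W, hW, hWU, hWV, w, e1, -⟩ :=
      S.log.exists_res_eq_mul_unitSection ht (hV t) m (β p) v hpv
    refine ⟨b ⁻¹ᵁ W, hW, fun s hs => hWU hs,
      Units.map (T.presheaf.map (homOfLE le_top).op).hom.toMonoidHom (η p).1 *
        Units.map (b.app W).hom.toMonoidHom w, (η p).2, fun s hs => ?_⟩
    have hs' : b s ∈ W := hs
    have h1 := hh s (S.log.germ U (b s) (hWU hs') m) p
      (Units.map (S.log.germ W (b s) hs') (S.log.unitSection w)) (by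
        rw [Units.coe_map, ← S.log.germ_res hWU _ hs', e1, map_mul, S.log.germ_res])
    change _ = (((h s _).1 : (T.presheaf.stalk s)ˣ) : T.presheaf.stalk s) ∧ (h s _).2 = _
    rw [h1]
    refine ⟨(map_mul (T.presheaf.germ (b ⁻¹ᵁ W) s hs).hom _ _).trans ?_, mul_one _⟩
    refine congrArg₂ (· * ·) (TopCat.Presheaf.germ_res_apply T.presheaf (homOfLE le_top) s hs _) ?_
    refine (Scheme.Hom.germ_stalkMap_apply b W s hs' _).symm.trans ?_
    change _ = b.stalkMap s (S.log.alphaStalk (b s) (S.log.germ W (b s) hs' (S.log.unitSection w)))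
    rw [S.log.alphaStalk_germ, S.log.toΓ_unitSection]
  · have h1 := hh t (S.log.germ V (b t) (hV t) (β p)) p 1 (by rw [Units.val_one, mul_one])
    have h2 : h t (S.log.germ V (b t) (hV t) (β p)) = ηt t p := by
      rw [h1]
      exact Prod.ext ((congrArg _ (map_one (u t))).trans (mul_one _)) (mul_one _)
    change ((((h t _).1 : (T.presheaf.stalk t)ˣ) : T.presheaf.stalk t), (h t _).2) = _
    rw [h2]
    rfl

omit [IsCancelMul Q] in
/-- Construction of a morphism from a hollow log scheme with only one point. -/
theorem LogScheme.exists_hollow_hom_of_subsingleton [Subsingleton T] (b : T ⟶ S.scheme) (t₀ : T)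
    (h : S.log.stalk (b t₀) →* (T.presheaf.stalk t₀)ˣ × Q)
    (hα : ∀ m, b.stalkMap t₀ (S.log.alphaStalk (b t₀) m) =
      hollowVal (((h m).1 : T.presheaf.stalk t₀), (h m).2)) :
    ∃ φ : hollow T Q ⟶ S, φ.base = b ∧ ∀ (U : S.scheme.Opens) (m : S.log.M.obj (op U))
      (ht : φ.base t₀ ∈ U) (ht' : b t₀ ∈ U), hollowCoord (φ.base ⁻¹ᵁ U) t₀ ht (φ.comap U m) =
        (((h (S.log.germ U (b t₀) ht' m)).1 : T.presheaf.stalk t₀),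
          (h (S.log.germ U (b t₀) ht' m)).2) := by
  have hex : ∀ t : T, ∃ h' : S.log.stalk (b t) →* (T.presheaf.stalk t)ˣ × Q,
      ∀ e : t = t₀, h' = by subst e; exact h := by
    intro t
    obtain rfl := Subsingleton.elim t t₀
    exact ⟨h, fun _ => rfl⟩
  choose h' hh' using hex
  have hh₀ : h' t₀ = h := hh' t₀ rfl
  refine (LogScheme.exists_hollow_hom_of_stalks b h' ?_ ?_).imp fun φ ⟨hb, hφ⟩ =>
    ⟨hb, fun U m ht ht' => (hφ U m t₀ ht ht').trans (by rw [hh₀])⟩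
  · intro t m
    obtain rfl := Subsingleton.elim t t₀
    rw [hh₀, hα]
  · intro U m t ht
    obtain rfl := Subsingleton.elim t t₀
    obtain ⟨W, hWU, hW, s, hs⟩ := TopCat.Presheaf.exists_le_germ_eq T.presheaf
      ((h (S.log.germ U (b t) ht m)).1 : T.presheaf.stalk t) (V := b ⁻¹ᵁ U) ht
    have hsu : IsUnit s := by
      refine RingedSpace.isUnit_of_isUnit_germ T.toRingedSpace W _ fun x hx => ?_
      obtain rfl := Subsingleton.elim x t
      exact hs ▸ Units.isUnit _
    refine ⟨W, hW, hWU, hsu.unit, (h (S.log.germ U (b t) ht m)).2, fun x hx => ?_⟩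
    obtain rfl := Subsingleton.elim x t
    rw [hh₀]
    exact ⟨hs, rfl⟩

end HollowHom

/-! ### Logarithmic strata -/

/-- This serves to impose a condition simultaneously on finitely many generators, of a monoid in a
chart or of an ideal. -/
lemma AlgebraicGeometry.Scheme.exists_common_nhd {X : Scheme.{u}} {ι : Type*} (S : Finset ι) (y : X)
    (C : ι → X.Opens → Prop) (hC : ∀ i U V, V ≤ U → C i U → C i V)
    (h : ∀ i ∈ S, ∃ U : X.Opens, y ∈ U ∧ C i U) {V : X.Opens} (hV : y ∈ V) :
    ∃ U : X.Opens, y ∈ U ∧ U ≤ V ∧ ∀ i ∈ S, C i U := by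
  classical
  induction S using Finset.induction_on with
  | empty => exact ⟨V, hV, le_rfl, by simp⟩
  | insert i S hi ih =>
    obtain ⟨U, hU, hUV, hUS⟩ := ih fun j hj => h j (Finset.mem_insert_of_mem hj)
    obtain ⟨U', hU', hUi⟩ := h i (Finset.mem_insert_self i S)
    refine ⟨U ⊓ U', ⟨hU, hU'⟩, inf_le_left.trans hUV, fun j hj => ?_⟩
    obtain rfl | hj := Finset.mem_insert.1 hj
    · exact hC _ _ _ inf_le_right hUi
    · exact hC _ _ _ inf_le_left (hUS j hj)

/-- The stalk is a localization of the ring of sections, and every ideal of a localization is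
extended from its contraction. -/
lemma AlgebraicGeometry.IsAffineOpen.map_comap_germ {X : Scheme.{u}} {V : X.Opens}
    (hV : IsAffineOpen V) (z : X) (hz : z ∈ V) (J : Ideal (X.presheaf.stalk z)) :
    (J.comap (X.presheaf.germ V z hz).hom).map (X.presheaf.germ V z hz).hom = J := by
  let := X.presheaf.algebra_section_stalk ⟨z, hz⟩
  have := hV.isLocalization_stalk ⟨z, hz⟩
  exact IsLocalization.map_under (hV.primeIdealOf ⟨z, hz⟩).asIdeal.primeCompl _ J

namespace LogStructure

variable {X : Scheme.{u}} (L : LogStructure X) {x y : X}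

/-- The map from the spectrum of the stalk at `y` is injective, and the prime contracted from the
stalk at `x` is the point over `x`. So `y` lies in the stratum iff its log ideal is that prime. -/
lemma mem_stratum_iff : y ∈ L.stratum x ↔ ∃ h : x ⤳ y, L.logIdeal y =
    (IsLocalRing.maximalIdeal (X.presheaf.stalk x)).comap (X.presheaf.stalkSpecializes h).hom := by
  have key : ∀ h : x ⤳ y, X.fromSpecStalk y
      (Spec.map (X.presheaf.stalkSpecializes h) (IsLocalRing.closedPoint _)) = x := by
    intro h
    refine (Scheme.Hom.comp_apply _ _ _).symm.trans ?_
    rw [Scheme.SpecMap_stalkSpecializes_fromSpecStalk]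
    exact Scheme.fromSpecStalk_closedPoint
  constructor
  · rintro ⟨hI, hx⟩
    have h : x ⤳ y := by
      have : x ∈ Set.range (X.fromSpecStalk y) := ⟨_, hx⟩
      rwa [Scheme.range_fromSpecStalk] at this
    refine ⟨h, ?_⟩
    have h1 := (X.fromSpecStalk y).injective ((key h).trans hx.symm)
    exact (congrArg PrimeSpectrum.asIdeal h1).symm
  · rintro ⟨h, hI⟩
    have hp : (L.logIdeal y).IsPrime := by
      rw [hI]
      exact Ideal.comap_isPrime _ _
    refine ⟨hp, Eq.trans ?_ (key h)⟩
    congr 1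
    exact PrimeSpectrum.ext hI

variable {L}

lemma specializes_of_mem_stratum (h : y ∈ L.stratum x) : x ⤳ y := (L.mem_stratum_iff.1 h).1

lemma isUnit_germ_of_specializes (h : x ⤳ y) {U : X.Opens} (hy : y ∈ U) {m : L.M.obj (op U)}
    (hm : IsUnit (L.germ U y hy m)) : IsUnit (L.germ U x (h.mem_open U.2 hy) m) := by
  rw [isUnit_germ_iff] at hm ⊢
  rw [← TopCat.Presheaf.germ_stalkSpecializes_apply X.presheaf hy h]
  exact hm.map (X.presheaf.stalkSpecializes h).hom

lemma mem_logIdeal {U : X.Opens} (hy : y ∈ U) {m : L.M.obj (op U)}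
    (hm : ¬ IsUnit (L.germ U y hy m)) : X.presheaf.germ U y hy (L.toΓ U m) ∈ L.logIdeal y :=
  Ideal.subset_span ⟨by rwa [← isUnit_germ_iff], U, hy, m, rfl⟩

/-- A non-unit at `y` has its image in the log ideal, which on the stratum is the prime of `x`;
hence it is still a non-unit at `x`. This rigidity is what makes charts behave uniformly along a
stratum. -/
lemma isUnit_germ_iff_of_mem_stratum (h : y ∈ L.stratum x) {U : X.Opens} (hy : y ∈ U)
    (hx : x ∈ U) {m : L.M.obj (op U)} :
    IsUnit (L.germ U y hy m) ↔ IsUnit (L.germ U x hx m) := by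
  obtain ⟨hs, hI⟩ := L.mem_stratum_iff.1 h
  refine ⟨fun hm => isUnit_germ_of_specializes hs hy hm, fun hm => ?_⟩
  by_contra hm'
  have h1 := mem_logIdeal hy hm'
  rw [hI, Ideal.mem_comap, IsLocalRing.mem_maximalIdeal, mem_nonunits_iff] at h1
  apply h1
  rw [isUnit_germ_iff] at hm
  rw [← TopCat.Presheaf.germ_stalkSpecializes_apply X.presheaf hy hs] at hm
  exact hm

lemma mem_comap_maximalIdeal_of_germ (h : x ⤳ y) {U : X.Opens} (hy : y ∈ U) {m : L.M.obj (op U)}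
    (hm : ¬ IsUnit (L.germ U x (h.mem_open U.2 hy) m)) : X.presheaf.germ U y hy (L.toΓ U m) ∈
      (IsLocalRing.maximalIdeal (X.presheaf.stalk x)).comap (X.presheaf.stalkSpecializes h).hom := by
  rw [Ideal.mem_comap, IsLocalRing.mem_maximalIdeal, mem_nonunits_iff]
  rw [isUnit_germ_iff] at hm
  rw [← TopCat.Presheaf.germ_stalkSpecializes_apply X.presheaf hy h] at hm
  exact hm

/-- Near a point of the stratum of `x`, the log ideal is contained in the prime ideal of `x`. -/
lemma exists_nhd_logIdeal_le (hL : L.IsFs) (hy : y ∈ L.stratum x) :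
    ∃ V : X.Opens, y ∈ V ∧ ∀ z ∈ V, ∀ h : x ⤳ z, L.logIdeal z ≤
      (IsLocalRing.maximalIdeal (X.presheaf.stalk x)).comap (X.presheaf.stalkSpecializes h).hom := by
  obtain ⟨U, hyU, P, _, β, hP, hβ⟩ := hL y
  obtain ⟨S, hS⟩ := hP.fg.fg_top
  have hxU : x ∈ U := (specializes_of_mem_stratum hy).mem_open U.2 hyU
  obtain ⟨V, hyV, hVU, hV⟩ := Scheme.exists_common_nhd S y
    (fun p V => V ≤ U ∧ (IsUnit (L.germ U y hyU (β p)) →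
      ∀ (z : X) (hzU : z ∈ U), z ∈ V → IsUnit (L.germ U z hzU (β p))))
    (fun p V V' hle h => ⟨hle.trans h.1, fun hp z hzU hz => h.2 hp z hzU (hle hz)⟩)
    (fun p _ => by
      by_cases hp : IsUnit (L.germ U y hyU (β p))
      · refine ⟨X.basicOpen (L.toΓ U (β p)), ?_, X.basicOpen_le _, fun _ z hzU hz => ?_⟩
        · rwa [Scheme.mem_basicOpen X _ y hyU, ← isUnit_germ_iff]
        · rwa [isUnit_germ_iff, ← Scheme.mem_basicOpen X _ z hzU]
      · exact ⟨U, hyU, le_rfl, fun h => absurd h hp⟩) hyU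
  refine ⟨V, hyV, fun z hz h => ?_⟩
  have hzU : z ∈ U := hVU hz
  -- On `V` the generators of `P` that are units at `y` remain units. A generator that is not a unit
  -- at `z` is thus not a unit at `y`, hence not at `x`.
  have key : ∀ p, ¬ IsUnit (L.germ U z hzU (β p)) → ¬ IsUnit (L.germ U x hxU (β p)) := by
    intro p
    have hp : p ∈ Submonoid.closure (S : Set P) := hS ▸ Submonoid.mem_top p
    induction hp using Submonoid.closure_induction with
    | mem p hp =>
      intro h1 h2
      exact h1 ((hV p hp).2 ((isUnit_germ_iff_of_mem_stratum hy hyU hxU).2 h2) z hzU hz)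
    | one =>
      intro h1
      rw [map_one, map_one] at h1
      exact absurd isUnit_one h1
    | mul p q _ _ hp hq =>
      simp only [map_mul, IsUnit.mul_iff]
      tauto
  refine Ideal.span_le.2 ?_
  rintro _ ⟨ha, W, hzW, m, rfl⟩
  obtain ⟨p, v, hpv⟩ := (hβ z hzU).1 (L.germ W z hzW m)
  have h1 : X.presheaf.germ W z hzW (L.toΓ W m) =
      L.alphaStalk z v * X.presheaf.germ U z hzU (L.toΓ U (β p)) := by
    rw [← L.alphaStalk_germ W hzW, ← hpv, map_mul, L.alphaStalk_germ, mul_comm]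
  rw [h1]
  refine Ideal.mul_mem_left _ _ (mem_comap_maximalIdeal_of_germ h hzU (key p fun hp => ha ?_))
  rw [h1]
  exact (v.isUnit.map (L.alphaStalk z)).mul ((L.isUnit_germ_iff).1 hp)

/-- A section of the monoid sheaf that is not a unit at `y` is not a unit at `x`, as `y` lies in the
stratum, and hence not at any specialization `z` of `x`. So the generators of the log ideal at `y`
extend to sections lying in the log ideals at these `z`. -/
lemma exists_nhd_germ_mem_logIdeal (hy : y ∈ L.stratum x) (a : X.presheaf.stalk y)
    (ha : a ∈ L.logIdeal y) : ∃ (V : X.Opens) (hyV : y ∈ V) (s : Γ(X, V)),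
      X.presheaf.germ V y hyV s = a ∧ ∀ (z : X) (hz : z ∈ V), x ⤳ z →
        X.presheaf.germ V z hz s ∈ L.logIdeal z := by
  induction ha using Submodule.span_induction with
  | mem a ha =>
    obtain ⟨ha, U, hyU, m, rfl⟩ := ha
    refine ⟨U, hyU, L.toΓ U m, rfl, fun z hz h => mem_logIdeal hz fun hm => ha ?_⟩
    rw [← isUnit_germ_iff, isUnit_germ_iff_of_mem_stratum hy hyU (h.mem_open U.2 hz)]
    exact isUnit_germ_of_specializes h hz hm
  | zero =>
    exact ⟨⊤, trivial, 0, map_zero _, fun z hz _ => by rw [map_zero]; exact Ideal.zero_mem _⟩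
  | add a b _ _ iha ihb =>
    obtain ⟨V, hV, s, rfl, hs⟩ := iha
    obtain ⟨W, hW, t, rfl, ht⟩ := ihb
    have hVW : y ∈ V ⊓ W := ⟨hV, hW⟩
    refine ⟨V ⊓ W, hVW, X.presheaf.map (homOfLE inf_le_left).op s +
      X.presheaf.map (homOfLE inf_le_right).op t, ?_, fun z hz h => ?_⟩
    · rw [map_add, TopCat.Presheaf.germ_res_apply, TopCat.Presheaf.germ_res_apply]
    · rw [map_add, TopCat.Presheaf.germ_res_apply, TopCat.Presheaf.germ_res_apply]
      exact Ideal.add_mem _ (hs z hz.1 h) (ht z hz.2 h)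
  | smul c a _ iha =>
    obtain ⟨V, hV, s, rfl, hs⟩ := iha
    obtain ⟨W, hW, t, rfl⟩ := TopCat.Presheaf.exists_germ_eq X.presheaf c
    have hVW : y ∈ V ⊓ W := ⟨hV, hW⟩
    refine ⟨V ⊓ W, hVW, X.presheaf.map (homOfLE inf_le_right).op t *
      X.presheaf.map (homOfLE inf_le_left).op s, ?_, fun z hz h => ?_⟩
    · rw [map_mul, TopCat.Presheaf.germ_res_apply, TopCat.Presheaf.germ_res_apply]
      rfl
    · rw [map_mul, TopCat.Presheaf.germ_res_apply, TopCat.Presheaf.germ_res_apply]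
      exact Ideal.mul_mem_left _ _ (hs z hz.1 h)

/-- Near each of its points, the stratum of `x` is the closure of `x`. -/
theorem exists_nhd_mem_stratum [IsLocallyNoetherian X] (hL : L.IsFs) (hy : y ∈ L.stratum x) :
    ∃ V : X.Opens, y ∈ V ∧ ∀ z ∈ V, x ⤳ z → z ∈ L.stratum x := by
  obtain ⟨V₁, hyV₁, hV₁⟩ := exists_nhd_logIdeal_le hL hy
  obtain ⟨hs, hI⟩ := L.mem_stratum_iff.1 hy
  obtain ⟨_, ⟨V, hVaff, rfl⟩, hyV, hVV₁⟩ :=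
    X.isBasis_affineOpens.exists_subset_of_mem_open hyV₁ V₁.2
  have hxV : x ∈ V := hs.mem_open V.2 hyV
  have : IsNoetherianRing Γ(X, V) := IsLocallyNoetherian.component_noetherian ⟨V, hVaff⟩
  let p : Ideal Γ(X, V) :=
    (IsLocalRing.maximalIdeal (X.presheaf.stalk x)).comap (X.presheaf.germ V x hxV).hom
  obtain ⟨S, hS⟩ : p.FG := IsNoetherian.noetherian p
  have hp : ∀ (z : X) (hz : z ∈ V) (h : x ⤳ z),
      ((IsLocalRing.maximalIdeal (X.presheaf.stalk x)).comap
        (X.presheaf.stalkSpecializes h).hom).comap (X.presheaf.germ V z hz).hom = p := by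
    intro z hz h
    ext a
    rw [Ideal.mem_comap, Ideal.mem_comap, Ideal.mem_comap]
    exact iff_of_eq (congrArg (· ∈ _) (TopCat.Presheaf.germ_stalkSpecializes_apply X.presheaf hz h a))
  -- The prime of `x` is finitely generated by noetherianity. Its generators lie in the log ideal at
  -- `y`, hence in the log ideals at nearby specializations of `x`.
  obtain ⟨W, hyW, hWV, hW⟩ := Scheme.exists_common_nhd S y
    (fun a U => ∀ (z : X) (hz : z ∈ V), z ∈ U → x ⤳ z → X.presheaf.germ V z hz a ∈ L.logIdeal z)
    (fun a U U' hle h z hz hzU => h z hz (hle hzU)) (fun a ha => by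
      have ha' : X.presheaf.germ V y hyV a ∈ L.logIdeal y := by
        rw [hI]
        have : a ∈ p := hS ▸ Ideal.subset_span ha
        rwa [← hp y hyV hs] at this
      obtain ⟨U, hyU, s, hsa, hsU⟩ := exists_nhd_germ_mem_logIdeal hy _ ha'
      obtain ⟨U', hyU', i, j, e⟩ := TopCat.Presheaf.germ_eq X.presheaf y hyU hyV _ _ hsa
      refine ⟨U', hyU', fun z hz hzU' h => ?_⟩
      have h1 := congrArg (X.presheaf.germ U' z hzU') e
      rw [TopCat.Presheaf.germ_res_apply, TopCat.Presheaf.germ_res_apply] at h1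
      rw [← h1]
      exact hsU z _ h) hyV
  refine ⟨W, hyW, fun z hz h => L.mem_stratum_iff.2 ⟨h, le_antisymm (hV₁ z (hVV₁ (hWV hz)) h) ?_⟩⟩
  have hzV : z ∈ V := hWV hz
  rw [← hVaff.map_comap_germ z hzV (Ideal.comap _ _)]
  refine (Ideal.map_mono (hp z hzV h).le).trans ?_
  rw [← hS]
  refine (Ideal.map_span _ _).trans_le (Ideal.span_le.2 ?_)
  rintro _ ⟨a, ha, rfl⟩
  exact hW a ha z hzV hz h

theorem isLocallyClosed_stratum [IsLocallyNoetherian X] (hL : L.IsFs) (x : X) :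
    IsLocallyClosed (L.stratum x) := by
  choose V hyV hV using fun y : L.stratum x => exists_nhd_mem_stratum hL y.2
  refine ⟨((⨆ y, V y : X.Opens) : Set X), closure {x}, (⨆ y, V y : X.Opens).2, isClosed_closure, ?_⟩
  ext y
  constructor
  · intro hy
    exact ⟨Opens.mem_iSup.2 ⟨⟨y, hy⟩, hyV ⟨y, hy⟩⟩,
      specializes_iff_mem_closure.1 (specializes_of_mem_stratum hy)⟩
  · rintro ⟨hy, hxy⟩
    obtain ⟨z, hz⟩ := Opens.mem_iSup.1 hy
    exact hV z y hz (specializes_iff_mem_closure.2 hxy)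

end LogStructure

/-! ### Characteristic stalks under specialization and along strata -/

namespace LogStructure

variable {X : Scheme.{u}} {L : LogStructure X} {x y : X}

/-- The class of a section in the characteristic stalk. -/
abbrev charGerm (L : LogStructure X) (U : X.Opens) (y : X) (hy : y ∈ U) (m : L.M.obj (op U)) :
    L.charStalk y := Associates.mk (L.germ U y hy m)

lemma charGerm_mul {U : X.Opens} (hy : y ∈ U) (m n : L.M.obj (op U)) :
    L.charGerm U y hy (m * n) = L.charGerm U y hy m * L.charGerm U y hy n := by
  rw [charGerm, map_mul, Associates.mk_mul_mk]

lemma charGerm_eq_iff {U V : X.Opens} (hU : y ∈ U) (hV : y ∈ V) {m : L.M.obj (op U)}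
    {n : L.M.obj (op V)} : L.charGerm U y hU m = L.charGerm V y hV n ↔
      ∃ v : (L.stalk y)ˣ, L.germ U y hU m * v = L.germ V y hV n :=
  Associates.mk_eq_mk_iff_associated

lemma charGerm_eq_one_iff {U : X.Opens} (hU : y ∈ U) {m : L.M.obj (op U)} :
    L.charGerm U y hU m = 1 ↔ IsUnit (L.germ U y hU m) :=
  Associates.mk_eq_one

/-- Equality of classes in characteristic stalks spreads out. -/
lemma exists_nhd_charGerm_eq {U V : X.Opens} (hU : y ∈ U) (hV : y ∈ V) {m : L.M.obj (op U)}
    {n : L.M.obj (op V)} (h : L.charGerm U y hU m = L.charGerm V y hV n) :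
    ∃ (W : X.Opens) (_ : y ∈ W) (_ : W ≤ U) (_ : W ≤ V), ∀ (z : X) (_ : z ∈ W) (hzU : z ∈ U)
      (hzV : z ∈ V), L.charGerm U z hzU m = L.charGerm V z hzV n := by
  obtain ⟨v, hv⟩ := (charGerm_eq_iff hV hU).1 h.symm
  obtain ⟨W, hW, hWU, hWV, w, e, -⟩ := L.exists_res_eq_mul_unitSection hU hV m n v hv
  refine ⟨W, hW, hWU, hWV, fun z hz hzU hzV => Eq.symm ((charGerm_eq_iff hzV hzU).2
    ⟨Units.map (L.germ W z hz) (L.unitSection w), ?_⟩)⟩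
  rw [Units.coe_map, ← L.germ_res hWU z hz, ← L.germ_res hWV z hz, e, map_mul]

lemma charGerm_eq_of_specializes (hs : x ⤳ y) {U V : X.Opens} (hU : y ∈ U) (hV : y ∈ V)
    {m : L.M.obj (op U)} {n : L.M.obj (op V)} (h : L.charGerm U y hU m = L.charGerm V y hV n) :
    L.charGerm U x (hs.mem_open U.2 hU) m = L.charGerm V x (hs.mem_open V.2 hV) n := by
  obtain ⟨W, hW, -, -, H⟩ := exists_nhd_charGerm_eq hU hV h
  exact H x (hs.mem_open W.2 hW) _ _

lemma exists_charGerm (c : L.charStalk y) {V : X.Opens} (hV : y ∈ V) :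
    ∃ (U : X.Opens) (_ : U ≤ V) (hU : y ∈ U) (m : L.M.obj (op U)), L.charGerm U y hU m = c := by
  obtain ⟨m, rfl⟩ := Associates.mk_surjective c
  obtain ⟨U, hUV, hU, m, rfl⟩ := L.exists_germ m hV
  exact ⟨U, hUV, hU, m, rfl⟩

lemma charGerm_pow {U : X.Opens} (hy : y ∈ U) (m : L.M.obj (op U)) (n : ℕ) :
    L.charGerm U y hy (m ^ n) = L.charGerm U y hy m ^ n := by
  rw [charGerm, map_pow, Associates.mk_pow]

/-- Divisibility in the characteristic stalks is preserved by generization. -/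
lemma exists_pow_eq_charGerm_of_specializes (hs : x ⤳ y) {U : X.Opens} (hU : y ∈ U)
    {m : L.M.obj (op U)} {n : ℕ} (h : ∃ c : L.charStalk y, c ^ n = L.charGerm U y hU m) :
    ∃ c : L.charStalk x, c ^ n = L.charGerm U x (hs.mem_open U.2 hU) m := by
  obtain ⟨c, hc⟩ := h
  obtain ⟨V, -, hV, s, rfl⟩ := exists_charGerm c hU
  rw [← charGerm_pow] at hc
  exact ⟨_, (charGerm_pow _ _ _).symm.trans (charGerm_eq_of_specializes hs hV hU hc)⟩

variable (hL : L.IsFs)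
include hL

/-- On a stratum, the characteristic stalks embed into that at the generic point. -/
lemma charGerm_eq_of_mem_stratum (hy : y ∈ L.stratum x) {U V : X.Opens} (hyU : y ∈ U) (hyV : y ∈ V)
    (hxU : x ∈ U) (hxV : x ∈ V) {m : L.M.obj (op U)} {n : L.M.obj (op V)}
    (h : L.charGerm U x hxU m = L.charGerm V x hxV n) :
    L.charGerm U y hyU m = L.charGerm V y hyV n := by
  obtain ⟨W, hyW, P, _, β, hP, hβ⟩ := hL y
  have hs := specializes_of_mem_stratum hy
  have hxW : x ∈ W := hs.mem_open W.2 hyW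
  have hchart : ∀ {U : X.Opens} (hyU : y ∈ U) (m : L.M.obj (op U)),
      ∃ p, L.charGerm W y hyW (β p) = L.charGerm U y hyU m := by
    intro U hyU m
    obtain ⟨p, v, hpv⟩ := (hβ y hyW).1 (L.germ U y hyU m)
    exact ⟨p, (charGerm_eq_iff _ _).2 ⟨v, hpv⟩⟩
  obtain ⟨p, hp⟩ := hchart hyU m
  obtain ⟨q, hq⟩ := hchart hyV n
  have h1 : L.charGerm W x hxW (β p) = L.charGerm W x hxW (β q) :=
    (charGerm_eq_of_specializes hs hyW hyU hp).trans (h.trans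
      (charGerm_eq_of_specializes hs hyW hyV hq).symm)
  obtain ⟨v, hv⟩ := (charGerm_eq_iff _ _).1 h1
  -- The correcting factors `a` and `b` are units at `x`, hence also at `y` because `y` lies in the
  -- stratum. They therefore disappear in the characteristic stalk at `y`.
  obtain ⟨a, b, ha, hb, hab, -⟩ := (hβ x hxW).2 p q v hv
  have h2 := congrArg (fun z => L.charGerm W y hyW (β z)) hab
  simp only [map_mul, charGerm_mul] at h2
  rw [← isUnit_germ_iff_of_mem_stratum hy hyW hxW, ← charGerm_eq_one_iff] at ha hb
  rw [ha, hb, mul_one, mul_one] at h2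
  rw [← hp, ← hq, h2]

/-- On a stratum, the characteristic stalks surject onto that at the generic point. -/
lemma exists_pow_eq_charGerm_iff_of_mem_stratum (hy : y ∈ L.stratum x) {U : X.Opens} (hyU : y ∈ U)
    (hxU : x ∈ U) {m : L.M.obj (op U)} {n : ℕ} :
    (∃ c : L.charStalk y, c ^ n = L.charGerm U y hyU m) ↔
      ∃ c : L.charStalk x, c ^ n = L.charGerm U x hxU m := by
  have hs := specializes_of_mem_stratum hy
  refine ⟨exists_pow_eq_charGerm_of_specializes hs hyU, ?_⟩
  rintro ⟨c, hc⟩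
  obtain ⟨c, rfl⟩ := Associates.mk_surjective c
  obtain ⟨W, hyW, P, _, β, hP, hβ⟩ := hL y
  have hxW : x ∈ W := hs.mem_open W.2 hyW
  obtain ⟨p, v, rfl⟩ := (hβ x hxW).1 c
  refine ⟨L.charGerm W y hyW (β p), ?_⟩
  rw [← charGerm_pow]
  refine charGerm_eq_of_mem_stratum hL hy _ _ hxW hxU ?_
  rw [← hc, charGerm_pow]
  congr 1
  exact Associates.mk_eq_mk_iff_associated.2 ⟨v, rfl⟩

/-- Near a point `y` of a stratum, if sections are determined by their germs at `y`, there is a chart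
given by the characteristic stalk at `y`. -/
theorem exists_charStalk_chart [X.IsGermInjectiveAt y] (hinj : ∀ U, Function.Injective (L.toΓ U))
    (hy : y ∈ L.stratum x) :
    ∃ (V : X.Opens) (hyV : y ∈ V) (β : L.charStalk y →* L.M.obj (op V)),
      (∀ p, L.charGerm V y hyV (β p) = p) ∧
      ∀ z (hz : z ∈ V), z ∈ L.stratum x → L.IsChartAt V β z hz ∧
        ∀ p, IsUnit (L.germ V z hz (β p)) → p = 1 := by
  have := hL.isSaturatedMonoid_stalk y
  have := hL.fg_charStalk y
  obtain ⟨s, hs⟩ := Associates.exists_section (M := L.stalk y)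
  obtain ⟨G, hG⟩ := Monoid.FG.fg_top (M := L.charStalk y)
  obtain ⟨U, hyU, N, _, βN, hN, hβN⟩ := hL y
  obtain ⟨S, hS⟩ := hN.fg.fg_top
  obtain ⟨V₁, hyV₁, hV₁U, hV₁⟩ := Scheme.exists_common_nhd G y
    (fun p V => ∃ (W : X.Opens) (hW : y ∈ W) (m : L.M.obj (op W)), V ≤ W ∧ L.germ W y hW m = s p)
    (fun p V V' hle ⟨W, hW, m, hVW, hm⟩ => ⟨W, hW, m, hle.trans hVW, hm⟩)
    (fun p _ => by
      obtain ⟨W, -, hW, m, hm⟩ := L.exists_germ (s p) (V := ⊤) trivial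
      exact ⟨W, hW, W, hW, m, le_rfl, hm⟩) hyU
  -- On `V₂` a section is determined by its germ at `y`. Lifts of the values of the splitting `s`
  -- are therefore unique, and so automatically multiplicative.
  obtain ⟨V₂, hyV₂, -, hV₂V₁, hV₂⟩ := X.exists_le_and_germ_injective y V₁ hyV₁
  have hgerm : Function.Injective (L.germ V₂ y hyV₂) := by
    intro m m' h
    apply hinj
    apply hV₂
    have := congrArg (L.alphaStalk y) h
    rwa [L.alphaStalk_germ, L.alphaStalk_germ] at this
  have hex : ∀ p, ∃ m, L.germ V₂ y hyV₂ m = s p := by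
    intro p
    have hp : p ∈ Submonoid.closure (G : Set (L.charStalk y)) := hG ▸ Submonoid.mem_top p
    induction hp using Submonoid.closure_induction with
    | mem p hp =>
      obtain ⟨W, hW, m, hVW, hm⟩ := hV₁ p hp
      exact ⟨L.res (hV₂V₁.trans hVW) m, by rw [L.germ_res, hm]⟩
    | one => exact ⟨1, by rw [map_one, map_one]⟩
    | mul p q _ _ hp hq =>
      obtain ⟨m, hm⟩ := hp
      obtain ⟨n, hn⟩ := hq
      exact ⟨m * n, by rw [map_mul, map_mul, hm, hn]⟩
  choose β₂ hβ₂ using hex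
  let β₂' : L.charStalk y →* L.M.obj (op V₂) := ⟨⟨β₂, hgerm (by rw [hβ₂, map_one, map_one])⟩,
    fun p q => hgerm (by rw [hβ₂, map_mul, map_mul, hβ₂, hβ₂])⟩
  have hβ₂c : ∀ p, L.charGerm V₂ y hyV₂ (β₂' p) = p := fun p => by
    rw [charGerm, show L.germ V₂ y hyV₂ (β₂' p) = s p from hβ₂ p, hs]
  let q : N → L.charStalk y := fun n => L.charGerm U y hyU (βN n)
  -- After shrinking, the given chart `βN` and `β₂' ∘ q` agree up to units: it suffices to compare
  -- them on generators of `N`, where they agree at `y`. The chart property of `βN` then gives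
  -- surjectivity for `β₂'`.
  obtain ⟨V, hyV, hVV₂, hV⟩ := Scheme.exists_common_nhd S y
    (fun n V => ∀ (z : X) (_ : z ∈ V) (hzU : z ∈ U) (hz₂ : z ∈ V₂),
      L.charGerm U z hzU (βN n) = L.charGerm V₂ z hz₂ (β₂' (q n)))
    (fun n V V' hle h z hz hzU hz₂ => h z (hle hz) hzU hz₂)
    (fun n _ => by
      obtain ⟨W, hyW, -, -, hW⟩ := exists_nhd_charGerm_eq hyU hyV₂ (m := βN n) (n := β₂' (q n))
        (hβ₂c _).symm
      exact ⟨W, hyW, hW⟩) hyV₂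
  have hVU : V ≤ U := hVV₂.trans (hV₂V₁.trans hV₁U)
  have key : ∀ n (z : X) (hz : z ∈ V),
      L.charGerm U z (hVU hz) (βN n) = L.charGerm V₂ z (hVV₂ hz) (β₂' (q n)) := by
    intro n z hz
    have hn : n ∈ Submonoid.closure (S : Set N) := hS ▸ Submonoid.mem_top n
    induction hn using Submonoid.closure_induction with
    | mem n hn => exact hV n hn z hz _ _
    | one =>
      have : q 1 = 1 := by simp only [q, charGerm, map_one]; rfl
      rw [this, charGerm, charGerm, map_one, map_one, map_one, map_one]
    | mul m n _ _ hm hn =>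
      have : q (m * n) = q m * q n := by simp only [q, map_mul, charGerm_mul]
      rw [this, map_mul, map_mul, charGerm_mul, charGerm_mul, hm, hn]
  have hqsurj : Function.Surjective q := by
    intro p
    obtain ⟨m, rfl⟩ := Associates.mk_surjective p
    obtain ⟨n, v, rfl⟩ := (hβN y hyU).1 m
    exact ⟨n, Associates.mk_eq_mk_iff_associated.2 ⟨v, rfl⟩⟩
  have hres : ∀ z (hz : z ∈ V) p, L.germ V z hz ((L.res hVV₂).comp β₂' p) =
      L.germ V₂ z (hVV₂ hz) (β₂' p) := fun z hz p => L.germ_res hVV₂ z hz _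
  refine ⟨V, hyV, (L.res hVV₂).comp β₂', fun p => ?_, fun z hz hzs => ⟨⟨fun m => ?_,
    fun p p' v h => ?_⟩, fun p hp => ?_⟩⟩
  · rw [charGerm, hres, ← charGerm, hβ₂c]
  · obtain ⟨n, v, rfl⟩ := (hβN z (hVU hz)).1 m
    obtain ⟨w, hw⟩ := (charGerm_eq_iff _ _).1 (key n z hz).symm
    refine ⟨q n, w * v, ?_⟩
    rw [hres, Units.val_mul, ← mul_assoc, hw]
  · rw [hres, hres] at h
    have hxz := specializes_of_mem_stratum hzs
    have hyx := specializes_of_mem_stratum hy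
    -- The equality of classes at `z` is moved to the generic point `x` of the stratum and from
    -- there to `y`, where `β₂'` is the identity on classes.
    have hpp : p = p' := by
      have h1 : L.charGerm V₂ z (hVV₂ hz) (β₂' p) = L.charGerm V₂ z (hVV₂ hz) (β₂' p') :=
        (charGerm_eq_iff _ _).2 ⟨v, h⟩
      have h2 := charGerm_eq_of_mem_stratum hL hy hyV₂ hyV₂ (hyx.mem_open V₂.2 hyV₂)
        (hyx.mem_open V₂.2 hyV₂) (charGerm_eq_of_specializes hxz (hVV₂ hz) (hVV₂ hz) h1)
      rwa [hβ₂c, hβ₂c] at h2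
    subst hpp
    have := hL.isSaturatedMonoid_stalk z
    have hv : (v : L.stalk z) = 1 := mul_left_cancel (h.trans (mul_one _).symm)
    refine ⟨1, 1, ?_, ?_, rfl, ?_⟩
    · rw [map_one, map_one]; exact isUnit_one
    · rw [map_one, map_one]; exact isUnit_one
    · rw [hv, one_mul]
  · have hxz := specializes_of_mem_stratum hzs
    have h1 := isUnit_germ_of_specializes hxz hz hp
    rw [← isUnit_germ_iff_of_mem_stratum hy hyV, ← charGerm_eq_one_iff, charGerm, hres, ← charGerm,
      hβ₂c] at h1
    exact h1

omit hL in
lemma IsChartAt.res {U V : X.Opens} {P : Type u} [CommMonoid P] {β : P →* L.M.obj (op U)}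
    (hVU : V ≤ U) {hyV : y ∈ V} {hyU : y ∈ U} (h : L.IsChartAt U β y hyU) :
    L.IsChartAt V ((L.res hVU).comp β) y hyV := by
  have hres : ∀ p, L.germ V y hyV ((L.res hVU).comp β p) = L.germ U y hyU (β p) :=
    fun p => L.germ_res hVU y hyV _
  simpa only [IsChartAt, hres] using h

end LogStructure

/-- An isomorphism with `ℕ` turns powers into multiples, and the default value `0` is divisible by
every `n`. -/
lemma dvd_monoidOrder {P : Type u} [CommMonoid P] {n : ℕ} {a c : P} (h : c ^ n = a) :
    n ∣ monoidOrder P a := by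
  unfold monoidOrder
  split_ifs with hP
  · rw [← h, map_pow, toAdd_pow, smul_eq_mul]
    exact Nat.dvd_mul_right _ _
  · exact dvd_zero n

/-! ### Charts of divisorial log structures given by one element -/

section PowersChart

variable {X : Scheme.{u}}

lemma divisorialLog_toΓ_injective (W : X.Opens) (U : X.Opens) :
    Function.Injective ((divisorialLog X W).toΓ U) := Subtype.val_injective

lemma LogStructure.alphaStalk_injective (L : LogStructure X)
    (hinj : ∀ U, Function.Injective (L.toΓ U)) (y : X) : Function.Injective (L.alphaStalk y) := by
  intro a b h
  obtain ⟨U, -, hU, m, rfl⟩ := L.exists_germ a (V := ⊤) trivial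
  obtain ⟨V, -, hV, n, rfl⟩ := L.exists_germ b (V := ⊤) trivial
  rw [L.alphaStalk_germ, L.alphaStalk_germ] at h
  obtain ⟨W, hW, i, j, e⟩ := TopCat.Presheaf.germ_eq X.presheaf y hU hV _ _ h
  have h1 : L.res i.le m = L.res j.le n := by
    apply hinj
    rw [L.toΓ_res, L.toΓ_res]
    exact e
  rw [← L.germ_res i.le y hW, ← L.germ_res j.le y hW, h1]

lemma LogStructure.exists_alphaStalk_eq (L : LogStructure X) {y : X} (v : (X.presheaf.stalk y)ˣ) :
    ∃ m : (L.stalk y)ˣ, L.alphaStalk y m = v := by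
  obtain ⟨U, -, hU, s, hs⟩ := TopCat.Presheaf.exists_le_germ_eq X.presheaf (v : X.presheaf.stalk y)
    (V := ⊤) trivial
  have hy : y ∈ X.basicOpen s := (Scheme.mem_basicOpen X s y hU).2 (hs ▸ v.isUnit)
  have h1 : IsUnit (X.presheaf.map (homOfLE (X.basicOpen_le s)).op s) :=
    RingedSpace.isUnit_res_basicOpen X.toRingedSpace s
  refine ⟨Units.map (L.germ (X.basicOpen s) y hy) (L.unitSection h1.unit), ?_⟩
  rw [Units.coe_map, L.alphaStalk_germ, L.toΓ_unitSection, ← hs]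
  exact TopCat.Presheaf.germ_res_apply _ _ _ _ _

/-- The powers of a section, as a chart. -/
def powersChart (L : LogStructure X) {U : X.Opens} (m : L.M.obj (op U)) :
    ULift.{u} (Multiplicative ℕ) →* L.M.obj (op U) :=
  (powersHom _ m).comp (MulEquiv.ulift : ULift.{u} (Multiplicative ℕ) ≃* _).toMonoidHom

lemma powersChart_apply (L : LogStructure X) {U : X.Opens} (m : L.M.obj (op U))
    (p : ULift.{u} (Multiplicative ℕ)) : powersChart L m p = m ^ p.down.toAdd := rfl

/-- A non-unit `g` is divisible by `t`, and `t` can be cancelled from the divisibility relation;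
induction on `N` strips off the factors one at a time. -/
lemma exists_eq_pow_mul_of_dvd_pow {B : Type*} [CommRing B] [IsLocalRing B] {t : B}
    (ht : t ∈ nonZeroDivisors B) (hmax : IsLocalRing.maximalIdeal B ≤ Ideal.span {t}) {g : B} {N : ℕ}
    (h : g ∣ t ^ N) : ∃ (j : ℕ) (v : Bˣ), t ^ j * v = g := by
  induction N generalizing g with
  | zero =>
    rw [pow_zero] at h
    exact ⟨0, (isUnit_of_dvd_one h).unit, by simp⟩
  | succ N ih =>
    by_cases hg : IsUnit g
    · exact ⟨0, hg.unit, by simp⟩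
    · obtain ⟨g', rfl⟩ := Ideal.mem_span_singleton.1 (hmax hg)
      obtain ⟨c, hc⟩ := h
      obtain ⟨j, v, rfl⟩ := @ih g' ⟨c, (mul_cancel_left_mem_nonZeroDivisors ht).1 (by
        rw [← pow_succ', hc, mul_assoc])⟩
      exact ⟨j + 1, v, by rw [pow_succ', mul_assoc]⟩

/-- If `W` is the locus where a section is invertible, then any germ of the divisorial log structure
divides a power of this section. -/
lemma divisorialLog_exists_dvd_pow {W U : X.Opens} {y : X} (hy : y ∈ U)
    (m : (divisorialLog X W).M.obj (op U)) (hW : X.basicOpen ((divisorialLog X W).toΓ U m) ≤ W)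
    (g : (divisorialLog X W).stalk y) : ∃ N : ℕ, (divisorialLog X W).alphaStalk y g ∣
      (X.presheaf.germ U y hy ((divisorialLog X W).toΓ U m)) ^ N := by
  obtain ⟨V, hVU, hV, g, rfl⟩ := (divisorialLog X W).exists_germ g hy
  obtain ⟨V', hV', hyV', hle⟩ := (Opens.isBasis_iff_nbhd.1 X.isBasis_affineOpens) hV
  have hV' : IsAffineOpen V' := hV'
  set a : Γ(X, V') := X.presheaf.map (homOfLE (hle.trans hVU)).op ((divisorialLog X W).toΓ U m) with ha
  set b : Γ(X, V') := X.presheaf.map (homOfLE hle).op ((divisorialLog X W).toΓ V g) with hb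
  have hga : X.presheaf.germ V' y hyV' a = X.presheaf.germ U y hy ((divisorialLog X W).toΓ U m) :=
    TopCat.Presheaf.germ_res_apply _ _ _ _ _
  have hgb : X.presheaf.germ V' y hyV' b = X.presheaf.germ V y hV ((divisorialLog X W).toΓ V g) :=
    TopCat.Presheaf.germ_res_apply _ _ _ _ _
  have := hV'.isLocalization_basicOpen a
  -- The locus where `a` is invertible lies in `W`, where sections of the log structure are
  -- invertible. A section that becomes invertible after inverting `a` divides a power of `a`.
  have hunit : IsUnit (algebraMap Γ(X, V') Γ(X, X.basicOpen a) b) := by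
    refine RingedSpace.isUnit_of_isUnit_germ X.toRingedSpace _ _ fun z hz => ?_
    have hzV : z ∈ V' := X.basicOpen_le a hz
    have h1 : X.presheaf.germ (X.basicOpen a) z hz (algebraMap Γ(X, V') Γ(X, X.basicOpen a) b) =
        X.presheaf.germ V z (hle hzV) ((divisorialLog X W).toΓ V g) :=
      (TopCat.Presheaf.germ_res_apply X.presheaf (homOfLE (X.basicOpen_le a)) z hz b).trans
        (TopCat.Presheaf.germ_res_apply X.presheaf (homOfLE hle) z hzV _)
    refine h1.symm ▸ (mem_divisorialSubmonoid_iff X W _).1 g.2 z (hle hzV) (hW ?_)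
    rw [Scheme.mem_basicOpen X _ z (hVU (hle hzV))]
    rw [Scheme.mem_basicOpen X _ z hzV] at hz
    have h2 : X.presheaf.germ V' z hzV a = X.presheaf.germ U z (hVU (hle hzV)) ((divisorialLog X W).toΓ U m) :=
      TopCat.Presheaf.germ_res_apply _ _ _ _ _
    rwa [h2] at hz
  obtain ⟨N, hN⟩ := (IsLocalization.Away.algebraMap_isUnit_iff a).1 hunit
  refine ⟨N, ?_⟩
  rw [LogStructure.alphaStalk_germ, ← hga, ← hgb, ← map_pow]
  exact map_dvd _ hN

/-- The powers of a section whose germs at the points outside `W` generate the maximal ideals form a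
chart. -/
theorem powersChart_isChartAt {W U : X.Opens} {y : X} (hy : y ∈ U)
    (m : (divisorialLog X W).M.obj (op U)) (hW : X.basicOpen ((divisorialLog X W).toΓ U m) ≤ W)
    (h : y ∉ W → X.presheaf.germ U y hy ((divisorialLog X W).toΓ U m) ∈ nonZeroDivisors _ ∧
      IsLocalRing.maximalIdeal (X.presheaf.stalk y) =
        Ideal.span {X.presheaf.germ U y hy ((divisorialLog X W).toΓ U m)}) :
    (divisorialLog X W).IsChartAt U (powersChart _ m) y hy := by
  have hinj := (divisorialLog X W).alphaStalk_injective (divisorialLog_toΓ_injective W) y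
  have hp : ∀ p, (divisorialLog X W).alphaStalk y ((divisorialLog X W).germ U y hy (powersChart _ m p)) =
      (X.presheaf.germ U y hy ((divisorialLog X W).toΓ U m)) ^ p.down.toAdd := fun p => by
    rw [powersChart_apply, map_pow, map_pow, LogStructure.alphaStalk_germ]
  by_cases hyW : y ∈ W
  -- Over `W` the log structure is trivial. Everything is then a unit, and `q`, `p` themselves serve
  -- as the correcting factors in the injectivity clause.
  · have hu : ∀ g : (divisorialLog X W).stalk y, IsUnit g := by
      intro g
      obtain ⟨V, -, hV, g, rfl⟩ := (divisorialLog X W).exists_germ g hy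
      rw [LogStructure.isUnit_germ_iff]
      exact (mem_divisorialSubmonoid_iff X W _).1 g.2 y hV hyW
    refine ⟨fun g => ⟨1, (hu g).unit, by rw [map_one, map_one, one_mul]; rfl⟩, fun p q v e =>
      ⟨q, p, hu _, hu _, mul_comm _ _, by rw [mul_comm]; exact e⟩⟩
  · obtain ⟨h1, h2⟩ := h hyW
    refine ⟨fun g => ?_, fun p q v e => ?_⟩
    · obtain ⟨N, hN⟩ := divisorialLog_exists_dvd_pow hy m hW g
      obtain ⟨j, v, hv⟩ := exists_eq_pow_mul_of_dvd_pow h1 h2.le hN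
      obtain ⟨v', hv'⟩ := (divisorialLog X W).exists_alphaStalk_eq v
      refine ⟨⟨Multiplicative.ofAdd j⟩, v', hinj ?_⟩
      rw [map_mul, hp, hv', ← hv]
      rfl
    · have h3 : ¬ IsUnit (X.presheaf.germ U y hy ((divisorialLog X W).toΓ U m)) :=
        (h2 ▸ Ideal.mem_span_singleton_self _ : _ ∈ IsLocalRing.maximalIdeal _)
      have hv := v.isUnit.map ((divisorialLog X W).alphaStalk y)
      have e' := congrArg ((divisorialLog X W).alphaStalk y) e
      rw [map_mul, hp, hp] at e'
      generalize X.presheaf.germ U y hy ((divisorialLog X W).toΓ U m) = a at h1 h3 e'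
      have h4 : p.down.toAdd = q.down.toAdd ∧ (divisorialLog X W).alphaStalk y v = 1 := by
        rcases le_or_gt p.down.toAdd q.down.toAdd with hle | hlt
        · obtain ⟨c, hc⟩ := Nat.exists_eq_add_of_le hle
          rw [hc, pow_add] at e'
          have e'' := (mul_cancel_left_mem_nonZeroDivisors (pow_mem h1 _)).1 e'
          rcases Nat.eq_zero_or_pos c with rfl | hc0
          · exact ⟨hc.symm, by rw [e'', pow_zero]⟩
          · exact absurd ((isUnit_pow_iff hc0.ne').1 (e'' ▸ hv)) h3
        · obtain ⟨c, hc⟩ := Nat.exists_eq_add_of_lt hlt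
          rw [hc, add_assoc, pow_add, mul_assoc] at e'
          have e'' := (mul_cancel_left_mem_nonZeroDivisors (pow_mem h1 _)).1 (e'.trans (mul_one _).symm)
          exact absurd ((isUnit_pow_iff c.succ_ne_zero).1 (IsUnit.of_mul_eq_one _ e'')) h3
      have h5 : v = 1 := Units.ext (hinj (h4.2.trans (map_one _).symm))
      refine ⟨1, 1, by simp, by simp, ?_, by rw [map_one, map_one, mul_one, h5]; rfl⟩
      rw [mul_one, mul_one]
      exact ULift.ext _ _ (Multiplicative.toAdd.injective h4.1)

lemma mem_nonZeroDivisors_and_span_germ_ΓSpecIso_inv {A : CommRingCat.{u}} (t : A) (ht : t ∈ nonZeroDivisors A)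
    (hmax : (Ideal.span {t}).IsMaximal) (y : Spec A) (hy : t ∈ y.asIdeal) :
    (Spec A).presheaf.germ ⊤ y trivial ((Scheme.ΓSpecIso A).inv t) ∈ nonZeroDivisors _ ∧
      IsLocalRing.maximalIdeal ((Spec A).presheaf.stalk y) =
        Ideal.span {(Spec A).presheaf.germ ⊤ y trivial ((Scheme.ΓSpecIso A).inv t)} := by
  let _ : Algebra A ((Spec A).presheaf.stalk y) := StructureSheaf.stalkAlgebra A y
  have hprime : y.asIdeal.IsPrime := y.2
  have : IsLocalization.AtPrime ((Spec A).presheaf.stalk y) y.asIdeal :=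
    StructureSheaf.IsLocalization.to_stalk A y
  have h1 : (Spec A).presheaf.germ ⊤ y trivial ((Scheme.ΓSpecIso A).inv t) =
      algebraMap A ((Spec A).presheaf.stalk y) t := rfl
  have h2 : y.asIdeal = Ideal.span {t} :=
    (hmax.eq_of_le y.2.ne_top (by rwa [Ideal.span_singleton_le_iff_mem])).symm
  rw [h1]
  refine ⟨IsLocalization.map_nonZeroDivisors_le y.asIdeal.primeCompl _
    (Submonoid.mem_map_of_mem _ ht), ?_⟩
  rw [← IsLocalization.AtPrime.map_eq_maximalIdeal y.asIdeal, h2, Ideal.map_span,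
    Set.image_singleton]

/-- Powers of a nonzerodivisor generating a maximal ideal form a chart of the divisorial log
structure. -/
theorem powersChart_isChartAt_Spec {A : CommRingCat.{u}} (t : A) (ht : t ∈ nonZeroDivisors A)
    (hmax : (Ideal.span {t}).IsMaximal) {W : (Spec A).Opens} (hW : ∀ y : Spec A, y ∈ W ↔ t ∉ y.asIdeal)
    (m : (divisorialLog (Spec A) W).M.obj (op ⊤))
    (hm : (divisorialLog (Spec A) W).toΓ ⊤ m = (Scheme.ΓSpecIso A).inv t) (y : Spec A) :
    (divisorialLog (Spec A) W).IsChartAt ⊤ (powersChart _ m) y trivial := by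
  refine powersChart_isChartAt (U := ⊤) (y := y) trivial m ?_ fun hy => ?_
  · rw [hm, basicOpen_eq_of_affine]
    exact fun z hz => (hW z).2 hz
  · rw [hm]
    exact mem_nonZeroDivisors_and_span_germ_ΓSpecIso_inv t ht hmax y (not_not.1 fun h => hy ((hW y).2 h))

end PowersChart

/-! ### The log schemes of the trait and of its ramified cover -/

section RamifiedCover

variable {R : Type u} [CommRing R] [IsDomain R] [IsDiscreteValuationRing R]

lemma mem_genericOpen_iff {ϖ : R} (hϖ : Irreducible ϖ) (y : Spec (CommRingCat.of R)) :
    y ∈ genericOpen R ↔ ϖ ∉ y.asIdeal := by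
  rw [← not_iff_not, not_not]
  change ¬ y ≠ _ ↔ _
  rw [not_not]
  constructor
  · rintro rfl
    change ϖ ∈ IsLocalRing.maximalIdeal R
    rw [hϖ.maximalIdeal_eq]
    exact Ideal.mem_span_singleton_self ϖ
  · intro h
    refine PrimeSpectrum.ext ?_
    refine ((IsLocalRing.maximalIdeal.isMaximal R).eq_of_le y.2.ne_top ?_).symm
    rw [hϖ.maximalIdeal_eq]
    exact (Ideal.span_singleton_le_iff_mem _).2 h

lemma uniformizerSection_isChartAt {ϖ : R} (hϖ : Irreducible ϖ) (y : Spec (CommRingCat.of R)) :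
    (traitDagger R).log.IsChartAt ⊤ (powersChart _ (uniformizerSection ϖ hϖ)) y trivial :=
  powersChart_isChartAt_Spec (A := CommRingCat.of R) ϖ (mem_nonZeroDivisors_of_ne_zero hϖ.ne_zero)
    (by rw [← hϖ.maximalIdeal_eq]; infer_instance) (mem_genericOpen_iff hϖ) _ rfl y

variable (ϖ : R) (d : ℕ)

/-- The ring `R[T]/(T ^ d - ϖ)`. -/
abbrev ramifiedRing : Type u := AdjoinRoot (Polynomial.X ^ d - Polynomial.C ϖ)

abbrev ramifiedRoot : ramifiedRing ϖ d := AdjoinRoot.root _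

omit [IsDomain R] [IsDiscreteValuationRing R] in
lemma ramifiedRoot_pow : ramifiedRoot ϖ d ^ d = algebraMap R (ramifiedRing ϖ d) ϖ := by
  have h := AdjoinRoot.eval₂_root (Polynomial.X ^ d - Polynomial.C ϖ)
  rw [Polynomial.eval₂_sub, Polynomial.eval₂_pow, Polynomial.eval₂_X, Polynomial.eval₂_C, sub_eq_zero] at h
  exact h

variable {ϖ d} (hϖ : Irreducible ϖ) (hd : 0 < d)
include hϖ hd

/-- The ring is free over the domain `R`, so the `d`-th power of the root, being the nonzero scalar
`ϖ`, acts injectively. -/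
lemma ramifiedRoot_mem_nonZeroDivisors : ramifiedRoot ϖ d ∈ nonZeroDivisors (ramifiedRing ϖ d) := by
  have hmon : (Polynomial.X ^ d - Polynomial.C ϖ).Monic := Polynomial.monic_X_pow_sub_C ϖ hd.ne'
  have : Module.Free R (ramifiedRing ϖ d) := hmon.free_adjoinRoot
  have h : ramifiedRoot ϖ d ^ d ∈ nonZeroDivisors (ramifiedRing ϖ d) := by
    rw [ramifiedRoot_pow, mem_nonZeroDivisors_iff_right]
    intro z hz
    rw [mul_comm, ← Algebra.smul_def] at hz
    exact (smul_eq_zero.1 hz).resolve_left hϖ.ne_zero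
  rw [mem_nonZeroDivisors_iff_right] at h ⊢
  intro z hz
  refine h z ?_
  obtain ⟨c, hc⟩ := dvd_pow_self (ramifiedRoot ϖ d) hd.ne'
  rw [hc, ← mul_assoc, hz, zero_mul]

/-- The ideal is the kernel of the surjection to the residue field of `R` that kills the root:
modulo the root only the constant coefficient survives, and `ϖ` is itself a multiple of the root. -/
lemma span_ramifiedRoot_isMaximal : (Ideal.span {ramifiedRoot ϖ d}).IsMaximal := by
  have h0 : (Polynomial.X ^ d - Polynomial.C ϖ).eval₂ (IsLocalRing.residue R) 0 = 0 := by
    rw [Polynomial.eval₂_sub, Polynomial.eval₂_pow, Polynomial.eval₂_X, Polynomial.eval₂_C,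
      zero_pow hd.ne', (IsLocalRing.residue_eq_zero_iff ϖ).2 hϖ.not_isUnit, sub_zero]
  let φ : ramifiedRing ϖ d →+* IsLocalRing.ResidueField R := AdjoinRoot.lift (IsLocalRing.residue R) 0 h0
  have hsurj : Function.Surjective φ := fun z => by
    obtain ⟨r, rfl⟩ := IsLocalRing.residue_surjective z
    exact ⟨AdjoinRoot.of _ r, AdjoinRoot.lift_of h0⟩
  have hmax : (RingHom.ker φ).IsMaximal := RingHom.ker_isMaximal_of_surjective φ hsurj
  convert hmax using 1
  refine le_antisymm ((Ideal.span_singleton_le_iff_mem _).2 (AdjoinRoot.lift_root h0)) fun a ha => ?_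
  obtain ⟨g, rfl⟩ := AdjoinRoot.mk_surjective a
  obtain ⟨h, hg⟩ : ∃ h, g = Polynomial.C (g.coeff 0) + Polynomial.X * h :=
    ⟨_, by rw [add_comm, Polynomial.X_mul_divX_add]⟩
  have h1 : AdjoinRoot.mk (Polynomial.X ^ d - Polynomial.C ϖ) g =
      algebraMap R (ramifiedRing ϖ d) (g.coeff 0) + ramifiedRoot ϖ d * AdjoinRoot.mk _ h := by
    conv_lhs => rw [hg]
    rw [map_add, map_mul]
    rfl
  have h2 : φ (AdjoinRoot.mk _ g) = IsLocalRing.residue R (g.coeff 0) := by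
    rw [h1, map_add, map_mul, show φ (ramifiedRoot ϖ d) = 0 from AdjoinRoot.lift_root h0, zero_mul,
      add_zero]
    exact AdjoinRoot.lift_of h0
  have h3 : g.coeff 0 ∈ IsLocalRing.maximalIdeal R :=
    (IsLocalRing.residue_eq_zero_iff _).1 (h2.symm.trans ha)
  rw [hϖ.maximalIdeal_eq, Ideal.mem_span_singleton] at h3
  obtain ⟨c, hc⟩ := h3
  rw [h1, hc, map_mul, ← ramifiedRoot_pow]
  exact Ideal.add_mem _ (Ideal.mul_mem_right _ _ (Ideal.pow_mem_of_mem _ (Ideal.mem_span_singleton_self _) d hd))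
    (Ideal.mul_mem_right _ _ (Ideal.mem_span_singleton_self _))

lemma mem_preimage_genericOpen_iff (y : Spec (CommRingCat.of (ramifiedRing ϖ d))) :
    y ∈ ramifiedCover ϖ d ⁻¹ᵁ genericOpen R ↔ ramifiedRoot ϖ d ∉ y.asIdeal := by
  refine (mem_genericOpen_iff hϖ _).trans (not_congr ?_)
  change algebraMap R (ramifiedRing ϖ d) ϖ ∈ y.asIdeal ↔ _
  rw [← ramifiedRoot_pow, y.2.pow_mem_iff_mem _ hd]

/-- The root of the uniformizer, as a global section of the sheaf of monoids of `S(d)†`. -/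
def rootSection : (dagger (ramifiedCover ϖ d)).log.M.obj (op ⊤) :=
  (⟨(Scheme.ΓSpecIso (CommRingCat.of (ramifiedRing ϖ d))).inv (ramifiedRoot ϖ d), by
    rw [mem_divisorialSubmonoid_iff]
    intro y hy hW
    rw [← Scheme.mem_basicOpen _ _ y hy, basicOpen_eq_of_affine]
    exact (mem_preimage_genericOpen_iff hϖ hd y).1 hW⟩ :
    divisorialSubmonoid (Spec (CommRingCat.of (ramifiedRing ϖ d))) (ramifiedCover ϖ d ⁻¹ᵁ genericOpen R) ⊤)

lemma rootSection_isChartAt (y : Spec (CommRingCat.of (ramifiedRing ϖ d))) :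
    (dagger (ramifiedCover ϖ d)).log.IsChartAt ⊤ (powersChart _ (rootSection hϖ hd)) y trivial :=
  powersChart_isChartAt_Spec (A := CommRingCat.of (ramifiedRing ϖ d)) (ramifiedRoot ϖ d)
    (ramifiedRoot_mem_nonZeroDivisors hϖ hd) (span_ramifiedRoot_isMaximal hϖ hd)
    (mem_preimage_genericOpen_iff hϖ hd) _ rfl y

lemma rootSection_pow : rootSection hϖ hd ^ d =
    (daggerHom (ramifiedCover ϖ d)).comap ⊤ (uniformizerSection ϖ hϖ) := by
  refine Subtype.ext ?_
  change (Scheme.ΓSpecIso _).inv (ramifiedRoot ϖ d) ^ d =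
    (ramifiedCover ϖ d).appTop ((Scheme.ΓSpecIso (CommRingCat.of R)).inv ϖ)
  rw [← map_pow, ramifiedRoot_pow]
  exact ConcreteCategory.congr_hom (Scheme.ΓSpecIso_inv_naturality
    (CommRingCat.ofHom (AdjoinRoot.of (Polynomial.X ^ d - Polynomial.C ϖ)))) ϖ

end RamifiedCover

/-! ### Finite étale algebras given by separable monic polynomials -/

section AdjoinRoot

open Polynomial

variable {C : Type*} [CommRing C] {f : C[X]}

lemma AdjoinRoot.isReduced_of_separable_field {F : Type*} [Field F] {f : F[X]} (hf : f.Separable) :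
    IsReduced (AdjoinRoot f) :=
  (Ideal.isRadical_iff_quotient_reduced _).1
    (isRadical_iff_span_singleton.1 hf.squarefree.isRadical)

/-- Adjoining a root of a monic separable polynomial to a reduced ring yields a reduced ring. -/
theorem AdjoinRoot.isReduced_of_separable [IsReduced C] (hf : f.Monic) (hs : f.Separable) :
    IsReduced (AdjoinRoot f) := by
  refine ⟨fun a ha => ?_⟩
  obtain ⟨g, rfl⟩ := AdjoinRoot.mk_surjective a
  nontriviality C
  have h1 : AdjoinRoot.mk f g = AdjoinRoot.mk f (g %ₘ f) := by
    conv_lhs => rw [← modByMonic_add_div g f]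
    rw [map_add, map_mul, AdjoinRoot.mk_self, zero_mul, add_zero]
  suffices h : g %ₘ f = 0 by rw [h1, h, map_zero]
  ext i
  rw [coeff_zero]
  -- Over each residue field the quotient is reduced, so the remainder of degree less than `f`
  -- vanishes there. Its coefficients thus lie in every prime ideal.
  refine IsNilpotent.eq_zero (nilpotent_iff_mem_prime.2 fun J hJ => ?_)
  let φ := algebraMap C J.ResidueField
  have := AdjoinRoot.isReduced_of_separable_field (hs.map (f := φ))
  have h2 := (ha.map (AdjoinRoot.map φ f (f.map φ) dvd_rfl)).eq_zero
  have h3 : AdjoinRoot.map φ f (f.map φ) dvd_rfl (AdjoinRoot.mk f (g %ₘ f)) =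
      AdjoinRoot.mk (f.map φ) ((g %ₘ f).map φ) := by
    rw [AdjoinRoot.map, AdjoinRoot.lift_mk, ← eval₂_map, ← AdjoinRoot.aeval_eq, aeval_def,
      AdjoinRoot.algebraMap_eq]
  rw [h1, h3, AdjoinRoot.mk_eq_zero] at h2
  have h4 : (g %ₘ f).map φ = 0 := by
    refine eq_zero_of_dvd_of_degree_lt h2 ?_
    rw [hf.degree_map]
    exact degree_map_le.trans_lt (degree_modByMonic_lt g hf)
  have h5 := congrArg (fun r => r.coeff i) h4
  rw [coeff_map, coeff_zero] at h5
  exact Ideal.algebraMap_residueField_eq_zero.1 h5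

/-- Adjoining a root of a monic separable polynomial yields an étale algebra. -/
theorem AdjoinRoot.etale_of_separable (hf : f.Monic) (hs : f.Separable) :
    Algebra.Etale C (AdjoinRoot f) := by
  obtain ⟨a, b, hab⟩ := hs
  -- No localization is needed: the Bezout relation of a separable polynomial is the étaleness
  -- condition with `g = 1`.
  let P : StandardEtalePair C :=
    { f := f
      monic_f := hf
      g := 1
      cond := ⟨b, a, 1, by rw [← hab, pow_one]; ring⟩ }
  have hP : P.HasMap (AdjoinRoot.root f) := ⟨by
    rw [AdjoinRoot.aeval_eq]
    exact AdjoinRoot.mk_self, by rw [map_one]; exact isUnit_one⟩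
  let ψ : AdjoinRoot f →ₐ[C] P.Ring := AdjoinRoot.liftAlgHom f (Algebra.ofId C P.Ring) P.X
    StandardEtalePair.hasMap_X.1
  have hψ : ψ (AdjoinRoot.root f) = P.X := AdjoinRoot.liftAlgHom_root ..
  have h1 : (P.lift _ hP).comp ψ = AlgHom.id C _ := by
    ext
    rw [AlgHom.comp_apply, hψ, StandardEtalePair.lift_X]
    rfl
  have h2 : ψ.comp (P.lift _ hP) = AlgHom.id C _ := by
    refine StandardEtalePair.hom_ext ?_
    rw [AlgHom.comp_apply, StandardEtalePair.lift_X, hψ]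
    rfl
  exact Algebra.Etale.of_equiv (AlgEquiv.ofAlgHom _ _ h1 h2)

lemma AdjoinRoot.finrank_of_monic [Nontrivial C] (hf : f.Monic) :
    Module.finrank C (AdjoinRoot f) = f.natDegree :=
  (AdjoinRoot.powerBasis' hf).finrank

end AdjoinRoot

/-! ### Schemes of roots of an element -/

section RootCover

variable {C : CommRingCat.{u}} (c : C) (n : ℕ)

/-- The scheme of `n`-th roots of an element. -/
abbrev rootCover : Scheme.{u} :=
  Spec (CommRingCat.of (AdjoinRoot (Polynomial.X ^ n - Polynomial.C c)))

/-- The structure morphism. -/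
def rootCoverHom : rootCover c n ⟶ Spec C :=
  Spec.map (CommRingCat.ofHom (AdjoinRoot.of (Polynomial.X ^ n - Polynomial.C c)))

/-- The tautological root. -/
def rootCoverRoot : Γ(rootCover c n, ⊤) :=
  (Scheme.ΓSpecIso (CommRingCat.of (AdjoinRoot (Polynomial.X ^ n - Polynomial.C c)))).inv
    (AdjoinRoot.root _)

lemma appTop_rootCoverHom (r : C) : (rootCoverHom c n).appTop ((Scheme.ΓSpecIso C).inv r) =
    (Scheme.ΓSpecIso (CommRingCat.of (AdjoinRoot (Polynomial.X ^ n - Polynomial.C c)))).inv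
      (AdjoinRoot.of _ r) :=
  (ConcreteCategory.congr_hom (Scheme.ΓSpecIso_inv_naturality
    (CommRingCat.ofHom (AdjoinRoot.of (Polynomial.X ^ n - Polynomial.C c)))) r).symm

lemma rootCoverRoot_pow :
    rootCoverRoot c n ^ n = (rootCoverHom c n).appTop ((Scheme.ΓSpecIso C).inv c) := by
  rw [appTop_rootCoverHom, rootCoverRoot, ← map_pow]
  congr 1
  have h := AdjoinRoot.eval₂_root (Polynomial.X ^ n - Polynomial.C c)
  rwa [Polynomial.eval₂_sub, Polynomial.eval₂_pow, Polynomial.eval₂_X, Polynomial.eval₂_C,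
    sub_eq_zero] at h

variable {c n}

lemma rootCover_hom_ext {T : Scheme.{u}} {a b : T ⟶ rootCover c n}
    (h : a ≫ rootCoverHom c n = b ≫ rootCoverHom c n)
    (h' : a.appTop (rootCoverRoot c n) = b.appTop (rootCoverRoot c n)) : a = b := by
  refine ext_of_isAffine ?_
  rw [← cancel_epi (Scheme.ΓSpecIso (CommRingCat.of (AdjoinRoot (Polynomial.X ^ n - Polynomial.C c)))).inv]
  ext1
  refine AdjoinRoot.ringHom_ext (RingHom.ext fun r => ?_) h'
  have h1 := congrArg (fun g : T ⟶ Spec C => g.appTop ((Scheme.ΓSpecIso C).inv r)) h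
  have h2 : ∀ e : T ⟶ rootCover c n, (e ≫ rootCoverHom c n).appTop ((Scheme.ΓSpecIso C).inv r) =
      e.appTop ((Scheme.ΓSpecIso (CommRingCat.of
        (AdjoinRoot (Polynomial.X ^ n - Polynomial.C c)))).inv (AdjoinRoot.of _ r)) := fun e => by
    rw [Scheme.Hom.comp_appTop, CommRingCat.comp_apply, appTop_rootCoverHom]
  exact (h2 a).symm.trans (h1.trans (h2 b))

lemma exists_rootCover_hom {T : Scheme.{u}} (g : T ⟶ Spec C) (z : Γ(T, ⊤))
    (hz : z ^ n = g.appTop ((Scheme.ΓSpecIso C).inv c)) :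
    ∃ a : T ⟶ rootCover c n, a ≫ rootCoverHom c n = g ∧ a.appTop (rootCoverRoot c n) = z := by
  let φ : C →+* Γ(T, ⊤) := g.appTop.hom.comp (Scheme.ΓSpecIso C).inv.hom
  have h0 : (Polynomial.X ^ n - Polynomial.C c).eval₂ φ z = 0 := by
    rw [Polynomial.eval₂_sub, Polynomial.eval₂_pow, Polynomial.eval₂_X, Polynomial.eval₂_C, hz]
    exact sub_self _
  let a : T ⟶ rootCover c n := T.toSpecΓ ≫ Spec.map (CommRingCat.ofHom (AdjoinRoot.lift φ z h0))
  have ha : ∀ r, a.appTop ((Scheme.ΓSpecIso (CommRingCat.of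
      (AdjoinRoot (Polynomial.X ^ n - Polynomial.C c)))).inv r) = AdjoinRoot.lift φ z h0 r := by
    intro r
    rw [Scheme.Hom.comp_appTop, CommRingCat.comp_apply]
    refine (congrArg _ (ConcreteCategory.congr_hom (Scheme.ΓSpecIso_inv_naturality
      (CommRingCat.ofHom (AdjoinRoot.lift φ z h0))) r).symm).trans ?_
    rw [Scheme.toSpecΓ_appTop]
    exact ConcreteCategory.congr_hom (Scheme.ΓSpecIso Γ(T, ⊤)).inv_hom_id _
  refine ⟨a, ext_of_isAffine ?_, (ha _).trans (AdjoinRoot.lift_root h0)⟩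
  rw [← cancel_epi (Scheme.ΓSpecIso C).inv]
  ext r
  change (a ≫ rootCoverHom c n).appTop ((Scheme.ΓSpecIso C).inv r) = _
  rw [Scheme.Hom.comp_appTop, CommRingCat.comp_apply, appTop_rootCoverHom, ha]
  exact AdjoinRoot.lift_of h0

lemma isFinite_rootCoverHom (hn : n ≠ 0) : IsFinite (rootCoverHom c n) := by
  have := (Polynomial.monic_X_pow_sub_C c hn).finite_adjoinRoot
  exact (IsFinite.SpecMap_iff _).2 (RingHom.finite_algebraMap.2 this)

lemma etale_rootCoverHom (hn : n ≠ 0) (hc : IsUnit c) (hu : IsUnit (n : C)) :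
    Etale (rootCoverHom c n) := by
  obtain ⟨c, rfl⟩ := hc
  have := AdjoinRoot.etale_of_separable (Polynomial.monic_X_pow_sub_C (c : C) hn)
    (Polynomial.separable_X_pow_sub_C_unit c hu)
  exact (HasRingHomProperty.Spec_iff (P := @Etale)).2 (RingHom.etale_algebraMap.2 this)

lemma finrank_rootCoverHom (hn : n ≠ 0) (x : Spec C) : (rootCoverHom c n).finrank x = n := by
  have hmon := Polynomial.monic_X_pow_sub_C c hn
  have := hmon.finite_adjoinRoot
  have := hmon.free_adjoinRoot
  have : Nontrivial C := x.nontrivial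
  refine (Scheme.Hom.finrank_SpecMap_algebraMap C
    (AdjoinRoot (Polynomial.X ^ n - Polynomial.C c)) x).trans ?_
  rw [Module.rankAtStalk_eq_finrank_of_free, AdjoinRoot.finrank_of_monic hmon,
    Polynomial.natDegree_X_pow_sub_C]
  rfl

lemma isReduced_rootCover (hn : n ≠ 0) (hc : IsUnit c) (hu : IsUnit (n : C))
    [_root_.IsReduced C] : IsReduced (rootCover c n) := by
  obtain ⟨c, rfl⟩ := hc
  have := AdjoinRoot.isReduced_of_separable (Polynomial.monic_X_pow_sub_C (c : C) hn)
    (Polynomial.separable_X_pow_sub_C_unit c hu)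
  infer_instance

end RootCover

/-! ### Factoring morphisms through immersions -/

section Lift

/-- A surjective immersion onto a reduced scheme is an isomorphism. -/
lemma isIso_of_isImmersion_of_surjective {X Y : Scheme.{u}} (f : X ⟶ Y) [IsImmersion f]
    [Surjective f] [IsReduced Y] : IsIso f := by
  have : IsClosedImmersion f := .of_isPreimmersion _ (by
    rw [f.surjective.range_eq]
    exact isClosed_univ)
  exact isIso_of_isClosedImmersion_of_surjective f

/-- A morphism from a reduced scheme that factors through an immersion set-theoretically factors
through it. -/
lemma exists_lift_of_isImmersion {W Z X : Scheme.{u}} (i : Z ⟶ X) [IsImmersion i] [IsReduced W]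
    (g : W ⟶ X) (h : Set.range g ⊆ Set.range i) : ∃ l : W ⟶ Z, l ≫ i = g := by
  have : Surjective (Limits.pullback.fst g i) := ⟨by
    rw [← Set.range_eq_univ, Scheme.Pullback.range_fst]
    exact Set.eq_univ_of_forall fun w => h ⟨w, rfl⟩⟩
  have := isIso_of_isImmersion_of_surjective (Limits.pullback.fst g i)
  refine ⟨inv (Limits.pullback.fst g i) ≫ Limits.pullback.snd g i, ?_⟩
  rw [Category.assoc, ← Limits.pullback.condition, IsIso.inv_hom_id_assoc]

instance {X : Scheme.{u}} (S : Set X) : IsImmersion (reducedSubschemeι S) := by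
  have : IsClosedImmersion (closureSchemeι S) :=
    inferInstanceAs (IsClosedImmersion (closureIdeal S).subschemeι)
  exact IsImmersion.comp (closureSchemeι S ⁻¹ᵁ coborderOpen S).ι (closureSchemeι S)

end Lift

/-! ### Morphisms from hollow log schemes to `S†`, to `S(d)†` and to the fibre product -/

section HollowPoints

variable {T : Scheme.{u}} {Q : Type u} [CommMonoid Q] [Subsingleton Qˣ]

/-- The coordinates of the pullback of a global section. -/
abbrev LogScheme.Hom.coord {S : LogScheme.{u}} (φ : hollow T Q ⟶ S) (m : S.log.M.obj (op ⊤)) (t : T) :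
    T.presheaf.stalk t × Q :=
  hollowCoord (φ.base ⁻¹ᵁ ⊤) t trivial (φ.comap ⊤ m)

lemma LogScheme.Hom.germ_appTop_toΓ {S : LogScheme.{u}} (φ : hollow T Q ⟶ S)
    (m : S.log.M.obj (op ⊤)) (t : T) :
    T.presheaf.germ ⊤ t trivial (φ.base.appTop (S.log.toΓ ⊤ m)) = hollowVal (φ.coord m t) :=
  (congrArg _ (φ.toΓ_comap ⊤ m).symm).trans (germ_toΓ_hollowLog _ _)

lemma powersChart_coord {S : LogScheme.{u}} (φ : hollow T Q ⟶ S) (m : S.log.M.obj (op ⊤)) (t : T)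
    (p : ULift.{u} (Multiplicative ℕ)) :
    φ.coord (powersChart S.log m p) t = φ.coord m t ^ p.down.toAdd := by
  rw [powersChart_apply, LogScheme.Hom.coord, map_pow, map_pow]

/-- Morphisms to a log scheme with a global chart given by powers of a section. -/
lemma LogScheme.hom_ext_of_powersChart {S : LogScheme.{u}} {m : S.log.M.obj (op ⊤)}
    (hm : ∀ y, S.log.IsChartAt ⊤ (powersChart S.log m) y trivial) {φ ψ : hollow T Q ⟶ S}
    (hb : φ.base = ψ.base) (h : ∀ t, φ.coord m t = ψ.coord m t) : φ = ψ :=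
  LogScheme.hom_ext_of_chart hb fun t => ⟨⊤, trivial, trivial, _, _, powersChart S.log m, hm _,
    fun p => (powersChart_coord φ m t p).trans
      ((congrArg (· ^ p.down.toAdd) (h t)).trans (powersChart_coord ψ m t p).symm)⟩

variable {R : Type u} [CommRing R] [IsDomain R] [IsDiscreteValuationRing R] {ϖ : R} {d : ℕ}
  (hϖ : Irreducible ϖ) (hd : 0 < d)

/-- The logarithmic coordinates of the root section also determine its pullback as a function,
through `α`. Hence they fix the underlying morphism over the trait, as well as the log part. -/
lemma ramified_hom_ext {φ ψ : hollow T Q ⟶ dagger (ramifiedCover ϖ d)}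
    (hb : φ.base ≫ ramifiedCover ϖ d = ψ.base ≫ ramifiedCover ϖ d)
    (h : ∀ t, φ.coord (rootSection hϖ hd) t = ψ.coord (rootSection hϖ hd) t) : φ = ψ := by
  refine LogScheme.hom_ext_of_powersChart (rootSection_isChartAt hϖ hd) ?_ h
  refine rootCover_hom_ext (C := CommRingCat.of R) (c := ϖ) hb ?_
  refine Scheme.section_ext fun t ht => ?_
  refine (φ.germ_appTop_toΓ (rootSection hϖ hd) t).trans (Eq.trans ?_
    (ψ.germ_appTop_toΓ (rootSection hϖ hd) t).symm)
  rw [h]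

omit [Subsingleton Qˣ] in
lemma germ_hollowVal (v : Γ(T, ⊤)) (q : Q) (t : T) :
    T.presheaf.germ ⊤ t trivial (hollowVal (v, q)) = hollowVal (T.presheaf.germ ⊤ t trivial v, q) := by
  unfold hollowVal
  split_ifs
  · rfl
  · exact map_zero _

lemma hollowVal_pow {A : Type*} [CommRing A] (z : A × Q) (n : ℕ) :
    hollowVal (z ^ n) = hollowVal z ^ n := by
  rcases Nat.eq_zero_or_pos n with rfl | hn
  · rw [pow_zero, pow_zero]
    exact if_pos rfl
  · have h : (z ^ n).2 = 1 ↔ z.2 = 1 := by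
      refine ⟨fun h => ?_, fun h => by rw [Prod.pow_snd, h, one_pow]⟩
      rw [← Nat.sub_add_cancel hn, Prod.pow_snd, pow_succ] at h
      exact ((mul_eq_one_iff_of_sharp _).1 h).2
    unfold hollowVal
    by_cases hz : z.2 = 1
    · rw [if_pos hz, if_pos (h.2 hz)]
      rfl
    · rw [if_neg hz, if_neg (mt h.1 hz), zero_pow hn.ne']

/-- The cover is the scheme of `d`-th roots of `ϖ`, and powers of the root form a global chart. A
morphism is therefore given by the coordinates `(v, q)` of the root, subject only to the condition
on their value under `α`. -/
lemma exists_ramified_hom [IsCancelMul Q] (g : T ⟶ Spec (CommRingCat.of R)) (v : Γ(T, ⊤)ˣ) (q : Q)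
    (h : hollowVal ((v : Γ(T, ⊤)), q) ^ d = g.appTop ((Scheme.ΓSpecIso (CommRingCat.of R)).inv ϖ)) :
    ∃ φ : hollow T Q ⟶ dagger (ramifiedCover ϖ d), φ.base ≫ ramifiedCover ϖ d = g ∧
      ∀ t, φ.coord (rootSection hϖ hd) t = (T.presheaf.germ ⊤ t trivial v, q) := by
  obtain ⟨b, hb, hb'⟩ := exists_rootCover_hom (C := CommRingCat.of R) (c := ϖ) g _ h
  let η : ULift.{u} (Multiplicative ℕ) →* Γ(T, ⊤)ˣ × Q := (powersHom (Γ(T, ⊤)ˣ × Q) (v, q)).comp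
    (MulEquiv.ulift : ULift.{u} (Multiplicative ℕ) ≃* _).toMonoidHom
  have hη : ∀ p, η p = (v, q) ^ p.down.toAdd := fun p => rfl
  have hη' : ∀ (p : ULift.{u} (Multiplicative ℕ)) (t : T), T.presheaf.germ ⊤ t trivial (b.appTop
      ((dagger (ramifiedCover ϖ d)).log.toΓ ⊤ (powersChart _ (rootSection hϖ hd) p))) =
      hollowVal (T.presheaf.germ ⊤ t trivial (η p).1, (η p).2) := by
    intro p t
    have h1 : b.appTop ((dagger (ramifiedCover ϖ d)).log.toΓ ⊤ (rootSection hϖ hd)) =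
      hollowVal ((v : Γ(T, ⊤)), q) := hb'
    rw [powersChart_apply, map_pow, map_pow, map_pow, h1, germ_hollowVal, ← hollowVal_pow, hη]
    refine congrArg hollowVal (Prod.ext ?_ rfl)
    exact (map_pow (T.presheaf.germ ⊤ t trivial).hom _ _).symm
  refine (LogScheme.exists_hollow_hom_of_chart (S := dagger (ramifiedCover ϖ d)) b ⊤
    (fun _ => trivial) (powersChart _ (rootSection hϖ hd)) (fun t => rootSection_isChartAt hϖ hd _)
    η hη').imp fun φ ⟨hφ, hφ'⟩ => ⟨by rw [hφ]; exact hb, fun t => ?_⟩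
  have h1 := hφ' ⟨Multiplicative.ofAdd 1⟩ t trivial
  have h2 : powersChart _ (rootSection hϖ hd) ⟨Multiplicative.ofAdd 1⟩ = rootSection hϖ hd := pow_one _
  rw [h2, hη] at h1
  refine h1.trans ?_
  change (T.presheaf.germ ⊤ t trivial ((v, q) ^ 1 : Γ(T, ⊤)ˣ × Q).1, ((v, q) ^ 1 : Γ(T, ⊤)ˣ × Q).2) = _
  rw [pow_one]

variable {X : Scheme.{u}} {f : X ⟶ Spec (CommRingCat.of R)} {Y : LogScheme.{u}} {fst : Y ⟶ dagger f}
  {snd : Y ⟶ dagger (ramifiedCover ϖ d)}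

lemma coord_comp_ramified (φ : hollow T Q ⟶ dagger (ramifiedCover ϖ d)) (t : T) :
    (φ ≫ daggerHom (ramifiedCover ϖ d)).coord (uniformizerSection ϖ hϖ) t =
      φ.coord (rootSection hϖ hd) t ^ d := by
  refine (congrArg (fun m => φ.coord m t) (rootSection_pow hϖ hd).symm).trans ?_
  rw [LogScheme.Hom.coord, map_pow, map_pow]

/-- Morphisms from hollow log schemes to the fibre product `X† ×_S† S(d)†`: uniqueness. -/
lemma fsPullback_hom_ext
    (hY : LogScheme.IsFsPullback fst snd (daggerHom f) (daggerHom (ramifiedCover ϖ d)))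
    (hQ : IsFsMonoid Q) {φ ψ : hollow T Q ⟶ Y} (h : φ ≫ fst = ψ ≫ fst)
    (h' : ∀ t, (φ ≫ snd).coord (rootSection hϖ hd) t = (ψ ≫ snd).coord (rootSection hϖ hd) t) :
    φ = ψ := by
  have h1 : φ ≫ snd = ψ ≫ snd := by
    refine ramified_hom_ext hϖ hd ?_ h'
    have e : ∀ φ : hollow T Q ⟶ Y, (φ ≫ snd).base ≫ ramifiedCover ϖ d =
        (φ ≫ fst ≫ daggerHom f).base := fun φ => by
      rw [hY.w, ← Category.assoc]
      rfl
    rw [e, e, ← Category.assoc, ← Category.assoc, h]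
  exact (hY.existsUnique_lift (hollow T Q) (hollowLog_isFs hQ) (φ ≫ fst) (φ ≫ snd) (by
    rw [Category.assoc, Category.assoc, hY.w])).unique ⟨rfl, rfl⟩ ⟨h.symm, h1.symm⟩

/-- Morphisms from hollow log schemes to the fibre product `X† ×_S† S(d)†`: existence. -/
lemma exists_fsPullback_hom
    (hY : LogScheme.IsFsPullback fst snd (daggerHom f) (daggerHom (ramifiedCover ϖ d)))
    (hQ : IsFsMonoid Q) (a : hollow T Q ⟶ dagger f) (v : Γ(T, ⊤)ˣ) (q : Q)
    (h : ∀ t, (a ≫ daggerHom f).coord (uniformizerSection ϖ hϖ) t =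
      (T.presheaf.germ ⊤ t trivial v, q) ^ d) :
    ∃ φ : hollow T Q ⟶ Y, φ ≫ fst = a ∧
      ∀ t, (φ ≫ snd).coord (rootSection hϖ hd) t = (T.presheaf.germ ⊤ t trivial v, q) := by
  have := hQ.isSaturatedMonoid
  obtain ⟨b, hb, hb'⟩ := exists_ramified_hom (Q := Q) hϖ hd (a ≫ daggerHom f).base v q (by
    refine Scheme.section_ext fun t ht => ?_
    refine Eq.trans ?_ ((a ≫ daggerHom f).germ_appTop_toΓ (uniformizerSection ϖ hϖ) t).symm
    rw [h, map_pow, germ_hollowVal, hollowVal_pow])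
  obtain ⟨φ, ⟨h1, h2⟩, -⟩ := hY.existsUnique_lift (hollow T Q) (hollowLog_isFs hQ) a b (by
    refine LogScheme.hom_ext_of_powersChart (uniformizerSection_isChartAt hϖ) hb.symm fun t => ?_
    rw [h, coord_comp_ramified hϖ hd, hb'])
  exact ⟨φ, h1, fun t => by rw [h2, hb']⟩

end HollowPoints

/-! ### Roots of units in saturated log structures -/

section RootUnit

variable {X : Scheme.{u}} {L : LogStructure X}

/-- Saturation applies in both directions, because `v` is invertible: each of `a` and `b` divides
the other. -/
lemma exists_unit_of_pow_eq_pow_mul {M : Type*} [CommMonoid M] [IsSaturatedMonoid M] {n : ℕ}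
    (hn : 0 < n) {a b : M} {v : Mˣ} (h : a ^ n = b ^ n * v) : ∃ w : Mˣ, b * w = a := by
  obtain ⟨c, hc⟩ := dvd_of_pow_dvd_pow' hn (a := a) (b := b) ⟨v, h⟩
  obtain ⟨e, he⟩ := dvd_of_pow_dvd_pow' hn (a := b) (b := a) ⟨(v⁻¹ : Mˣ), by
    rw [h, mul_assoc, Units.mul_inv, mul_one]⟩
  have hce : c * e = 1 := mul_left_cancel (a := b) (by rw [← mul_assoc, ← hc, mul_one, ← he])
  exact ⟨⟨c, e, hce, by rw [mul_comm, hce]⟩, hc.symm⟩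

lemma LogStructure.unitSection_pow {U : X.Opens} (v : Γ(X, U)ˣ) (n : ℕ) :
    L.unitSection (v ^ n) = L.unitSection v ^ n := by
  refine Units.ext (L.toΓ_injective_of_isUnit ?_ ?_)
  · rw [toΓ_unitSection]
    exact Units.isUnit _
  · rw [Units.val_pow_eq_pow_val, map_pow, toΓ_unitSection, toΓ_unitSection,
      Units.val_pow_eq_pow_val]

/-- If two sections of a saturated log structure have `n`-th powers differing by a unit, then they
differ by a unit. -/
theorem LogStructure.exists_eq_mul_unitSection_of_pow (hL : ∀ y, IsSaturatedMonoid (L.stalk y)) {n : ℕ}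
    (hn : 0 < n) {U : X.Opens} {a b : L.M.obj (op U)} {v : Γ(X, U)ˣ}
    (h : a ^ n = b ^ n * L.unitSection v) :
    ∃ w : Γ(X, U)ˣ, b * L.unitSection w = a ∧ w ^ n = v := by
  have hex : ∀ y (hy : y ∈ U), ∃ w : (L.stalk y)ˣ, L.germ U y hy b * w = L.germ U y hy a := by
    intro y hy
    have := congrArg (L.germ U y hy) h
    rw [map_mul, map_pow, map_pow] at this
    exact exists_unit_of_pow_eq_pow_mul hn (v := Units.map (L.germ U y hy) (L.unitSection v)) this
  choose w hw using hex
  -- The quotient of `a` and `b` is unique in each stalk by cancellation, so the local unit sections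
  -- representing it glue.
  obtain ⟨s, hs⟩ := Scheme.exists_section_of_germs (V := U)
    (fun y hy => L.alphaStalk y (w y hy)) (fun y hy => by
      obtain ⟨W, hW, hWU, hWU', w', e, -⟩ := L.exists_res_eq_mul_unitSection hy hy a b (w y hy) (hw y hy)
      refine ⟨W, hW, hWU, w', fun z hz => ?_⟩
      have h1 := congrArg (L.germ W z hz) e
      rw [map_mul, L.germ_res, L.germ_res, ← hw z (hWU hz)] at h1
      rw [mul_left_cancel h1, L.alphaStalk_germ, L.toΓ_unitSection])
  have hsu : IsUnit s := by
    refine RingedSpace.isUnit_of_isUnit_germ X.toRingedSpace U s fun y hy => ?_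
    have h1 : IsUnit (X.presheaf.germ U y hy s) := by
      rw [hs]
      exact (w y hy).isUnit.map (L.alphaStalk y)
    exact h1
  have hgerm : ∀ y (hy : y ∈ U), L.germ U y hy (L.unitSection hsu.unit) = w y hy := by
    intro y hy
    refine (L.alphaStalk_injective_of_isUnit (w y hy).isUnit ?_).symm
    rw [L.alphaStalk_germ, L.toΓ_unitSection, ← hs]
    rfl
  have hb : b * L.unitSection hsu.unit = a := L.section_ext fun y hy => by
    rw [map_mul, hgerm, hw]
  refine ⟨hsu.unit, hb, Units.ext ?_⟩
  have h2 : L.unitSection (hsu.unit ^ n) = L.unitSection v := by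
    refine Units.ext (L.section_ext fun y hy => ?_)
    have h3 : b ^ n * L.unitSection (hsu.unit ^ n) = b ^ n * L.unitSection v := by
      rw [← h, unitSection_pow, Units.val_pow_eq_pow_val, ← mul_pow, hb]
    have h4 := congrArg (L.germ U y hy) h3
    rw [map_mul, map_mul] at h4
    exact mul_left_cancel h4
  rw [← L.toΓ_unitSection, h2, L.toΓ_unitSection]

end RootUnit

/-! ### Hollow points on a stratum -/

section StratumChart

variable {R : Type u} [CommRing R] [IsDomain R] [IsDiscreteValuationRing R] {ϖ : R}

/-- The pullback of the uniformizer as a section of the sheaf of monoids. -/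
def uniformizerOn {X : Scheme.{u}} (f : X ⟶ Spec (CommRingCat.of R)) (hϖ : Irreducible ϖ) :
    (dagger f).log.M.obj (op ⊤) := (daggerHom f).comap ⊤ (uniformizerSection ϖ hϖ)

/-- A chart near a point of a stratum, in which the uniformizer is an `n`-th power times a unit. -/
structure StratumChart {X : Scheme.{u}} (f : X ⟶ Spec (CommRingCat.of R)) (x : X)
    (hϖ : Irreducible ϖ) (n k : ℕ) where
  V : X.Opens
  P : Type u
  [commMonoid : CommMonoid P]
  [fg : Monoid.FG P]
  [saturated : IsSaturatedMonoid P]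
  [sharp : Subsingleton Pˣ]
  β : P →* (dagger f).log.M.obj (op V)
  isChartAt : ∀ z (hz : z ∈ V), z ∈ (dagger f).log.stratum x → (dagger f).log.IsChartAt V β z hz
  eq_one : ∀ z (hz : z ∈ V), z ∈ (dagger f).log.stratum x →
    ∀ p, IsUnit ((dagger f).log.germ V z hz (β p)) → p = 1
  p₁ : P
  v : Γ(X, V)ˣ
  res_eq : (dagger f).log.res le_top (uniformizerOn f hϖ) = β p₁ ^ n *
    ((dagger f).log.unitSection v : (dagger f).log.M.obj (op V))
  n_pos : 0 < n
  k_pos : 0 < k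
  pow_ne : ∀ l : ℕ, l.Prime → l ∣ k → ∀ c : P, c ^ l ≠ p₁
  h : P →* Multiplicative ℤ
  l : ℤ
  hl : (h p₁).toAdd + 1 = l * k

namespace StratumChart

attribute [instance] commMonoid fg saturated sharp

variable {X : Scheme.{u}} {f : X ⟶ Spec (CommRingCat.of R)} {x : X} {hϖ : Irreducible ϖ} {n k : ℕ}
  (c : StratumChart f x hϖ n k)

/-- The monoid with a `k`-th root of `p₁` adjoined. -/
abbrev Q : Type u := rootMonoid c.p₁ k

instance : IsMulTorsionFree c.P := isMulTorsionFree_of_sharp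

lemma isFsMonoid_Q : IsFsMonoid c.Q := rootMonoid.isFsMonoid c.p₁ k c.k_pos

lemma of_eq_one_iff {p : c.P} : rootMonoid.of c.p₁ k p = 1 ↔ p = 1 :=
  ⟨fun h => pow_left_injective c.k_pos.ne' ((congrArg Subtype.val h).trans (one_pow k).symm),
    fun h => by rw [h, map_one]⟩

variable {T : Scheme.{u}} [IsReduced T] (g : T ⟶ X) (hV : ∀ t, g t ∈ c.V)
  (hs : ∀ t, g t ∈ (dagger f).log.stratum x)

-- At points of the stratum `β p` is a non-unit for `p ≠ 1`, so its pullback vanishes at every point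
-- of `T`, and hence vanishes because `T` is reduced. This is what makes the hollow log structure on
-- `T` compatible with `α`.
include hs in
lemma app_toΓ_eq_zero {p : c.P} (hp : p ≠ 1) : g.app c.V ((dagger f).log.toΓ c.V (c.β p)) = 0 := by
  refine eq_zero_of_basicOpen_eq_bot _ ?_
  rw [eq_bot_iff]
  intro t ht
  have ht' : t ∈ g ⁻¹ᵁ c.V := T.basicOpen_le _ ht
  rw [Scheme.mem_basicOpen T _ t ht'] at ht
  have h1 : IsUnit (g.stalkMap t (X.presheaf.germ c.V (g t) ht' ((dagger f).log.toΓ c.V (c.β p)))) :=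
    (Scheme.Hom.germ_stalkMap_apply g c.V t ht' _).symm ▸ ht
  exact hp (c.eq_one (g t) ht' (hs t) p
    ((dagger f).log.isUnit_germ_iff.2 (isUnit_of_map_unit (g.stalkMap t).hom _ h1)))

variable {d : ℕ} {Y : LogScheme.{u}} {fst : Y ⟶ dagger f} {snd : Y ⟶ dagger (ramifiedCover ϖ d)}

include hV hs in
/-- A reduced scheme over the stratum with an `n`-th root of the unit `v` gives a hollow point of
the fibre product. -/
theorem exists_hollow_hom (hd : 0 < d) (hnk : d = n * k)
    (hY : LogScheme.IsFsPullback fst snd (daggerHom f) (daggerHom (ramifiedCover ϖ d)))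
    (w : Γ(T, ⊤)ˣ)
    (hw : (w : Γ(T, ⊤)) ^ n = g.appLE c.V ⊤ (fun t _ => hV t) c.v) :
    ∃ τ : hollow T c.Q ⟶ Y, (τ ≫ fst).base = g ∧
      (∀ (p : c.P) (t : T) (ht : (τ ≫ fst).base t ∈ c.V),
        hollowCoord ((τ ≫ fst).base ⁻¹ᵁ c.V) t ht ((τ ≫ fst).comap c.V (c.β p)) =
          (T.presheaf.germ ⊤ t trivial ((w ^ (c.h p).toAdd : Γ(T, ⊤)ˣ) : Γ(T, ⊤)), rootMonoid.of c.p₁ k p)) ∧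
      ∀ t, (τ ≫ snd).coord (rootSection hϖ hd) t =
        (T.presheaf.germ ⊤ t trivial ((w ^ c.l : Γ(T, ⊤)ˣ) : Γ(T, ⊤)), rootMonoid.root c.p₁ k) := by
  -- Without the twist by `c.h`, the root of the uniformizer would need a first coordinate whose
  -- `k`-th power is `w`. With it, the power `w ^ c.l` suffices.
  let η : c.P →* Γ(T, ⊤)ˣ × c.Q := ((zpowersHom _ w).comp c.h).prod (rootMonoid.of c.p₁ k)
  have hη : ∀ p, η p = (w ^ (c.h p).toAdd, rootMonoid.of c.p₁ k p) := fun p => rfl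
  obtain ⟨a, ha, ha'⟩ : ∃ a : hollow T c.Q ⟶ dagger f, _ :=
    LogScheme.exists_hollow_hom_of_chart (S := dagger f) g c.V hV c.β
    (fun t => c.isChartAt _ _ (hs t)) η (fun p t => by
      by_cases hp : p = 1
      · rw [hp, map_one, map_one, map_one, map_one, map_one]
        exact (map_one (T.presheaf.germ ⊤ t trivial).hom).symm.trans (if_pos rfl).symm
      · rw [c.app_toΓ_eq_zero g hs hp, map_zero]
        exact (if_neg (mt c.of_eq_one_iff.1 hp)).symm)
  refine (exists_fsPullback_hom hϖ hd hY c.isFsMonoid_Q a (w ^ c.l) (rootMonoid.root c.p₁ k) ?_).imp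
    fun τ ⟨h1, h2⟩ => ⟨by rw [h1, ha], ?_, h2⟩
  · intro t
    have ht : t ∈ a.base ⁻¹ᵁ c.V := by
      have := hV t
      rwa [← ha] at this
    have e1 : (a ≫ daggerHom f).coord (uniformizerSection ϖ hϖ) t =
        hollowCoord (a.base ⁻¹ᵁ c.V) t ht (a.comap c.V ((dagger f).log.res le_top (uniformizerOn f hϖ))) :=
      (a.hollowCoord_comap_res (S := dagger f) le_top (uniformizerOn f hϖ) t ht).symm
    rw [e1, c.res_eq, map_mul, map_mul, map_pow, map_pow]
    refine (congrArg₂ (· * ·) (congrArg (· ^ n) (ha' c.p₁ t ht))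
      (a.hollowCoord_comap_unitSection (S := dagger f) c.v t ht)).trans ?_
    subst ha
    have e2 : T.presheaf.germ (a.base ⁻¹ᵁ c.V) t ht (a.base.app c.V c.v) =
        T.presheaf.germ ⊤ t trivial ((w ^ n : Γ(T, ⊤)ˣ) : Γ(T, ⊤)) := by
      rw [Units.val_pow_eq_pow_val, hw]
      exact (TopCat.Presheaf.germ_res_apply T.presheaf
        (homOfLE (fun t _ => hV t : ⊤ ≤ a.base ⁻¹ᵁ c.V)) t (show t ∈ (⊤ : T.Opens) from trivial) _).symm
    refine Prod.ext ?_ ?_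
    -- The unit `v` contributes `w ^ n`, so the exponents to be compared are `n * h p₁ + n` and `l *
    -- d`; they agree by `c.hl` and `d = n * k`.
    · change T.presheaf.germ ⊤ t trivial ((w ^ (c.h c.p₁).toAdd : Γ(T, ⊤)ˣ) : Γ(T, ⊤)) ^ n *
        T.presheaf.germ (a.base ⁻¹ᵁ c.V) t ht (a.base.app c.V c.v) =
        T.presheaf.germ ⊤ t trivial ((w ^ c.l : Γ(T, ⊤)ˣ) : Γ(T, ⊤)) ^ d
      rw [e2, ← map_pow, ← map_pow, ← map_mul, ← Units.val_pow_eq_pow_val, ← Units.val_mul,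
        ← Units.val_pow_eq_pow_val, ← zpow_natCast, ← zpow_natCast, ← zpow_natCast, ← zpow_mul,
        ← zpow_mul, ← zpow_add, hnk]
      congr 3
      push_cast
      linear_combination (n : ℤ) * c.hl
    · change rootMonoid.of c.p₁ k c.p₁ ^ n * 1 = rootMonoid.root c.p₁ k ^ d
      rw [mul_one, ← rootMonoid.root_pow, ← pow_mul, hnk, mul_comm]
  · rw [h1]
    exact ha'

end StratumChart

end StratumChart

/-! ### Points of the fibre product with values in a field -/

section FieldPoint

variable {T₀ : Scheme.{u}} [Subsingleton T₀] (t₀ : T₀)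

include t₀ in
lemma eq_top_of_mem_of_subsingleton {U : T₀.Opens} (h : t₀ ∈ U) : U = ⊤ :=
  eq_top_iff.2 fun t _ => Subsingleton.elim t₀ t ▸ h

lemma germ_top_bijective_of_subsingleton :
    Function.Bijective (T₀.presheaf.germ ⊤ t₀ trivial) := by
  constructor
  · intro a b h
    refine Scheme.section_ext fun t ht => ?_
    obtain rfl := Subsingleton.elim t t₀
    exact h
  · intro a
    obtain ⟨U, -, hU, s, rfl⟩ := TopCat.Presheaf.exists_le_germ_eq T₀.presheaf a (V := ⊤) (x := t₀) trivial
    obtain rfl := eq_top_of_mem_of_subsingleton t₀ hU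
    exact ⟨s, rfl⟩

/-- On a one-point scheme a non-unit has empty basic open set, so it vanishes when the scheme is
reduced. Non-units of the log structure thus pull back to `0`, as a hollow log structure requires.
-/
lemma stalk_eq_zero_of_not_isUnit [IsReduced T₀] {a : T₀.presheaf.stalk t₀} (ha : ¬ IsUnit a) :
    a = 0 := by
  obtain ⟨s, rfl⟩ := (germ_top_bijective_of_subsingleton t₀).2 a
  rw [eq_zero_of_basicOpen_eq_bot s, map_zero]
  rw [eq_bot_iff]
  intro t ht
  obtain rfl := Subsingleton.elim t t₀
  exact ha ((Scheme.mem_basicOpen _ _ t (show t ∈ (⊤ : T₀.Opens) from trivial)).1 ht)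

/-- A field-valued point of an fs log scheme underlies a morphism from a hollow log scheme. -/
theorem exists_hollow_hom_of_field_point [IsReduced T₀] {Y : LogScheme.{u}} (hY : Y.log.IsFs)
    (b : T₀ ⟶ Y.scheme) :
    ∃ (ρ : Y.log.stalk (b t₀) →* (T₀.presheaf.stalk t₀)ˣ × Y.log.charStalk (b t₀))
      (c : hollow T₀ (Y.log.charStalk (b t₀)) ⟶ Y), c.base = b ∧
      (∀ (U : Y.scheme.Opens) (m : Y.log.M.obj (op U)) (ht : c.base t₀ ∈ U) (ht' : b t₀ ∈ U),
        hollowCoord (c.base ⁻¹ᵁ U) t₀ ht (c.comap U m) =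
          (((ρ (Y.log.germ U (b t₀) ht' m)).1 : T₀.presheaf.stalk t₀),
            (ρ (Y.log.germ U (b t₀) ht' m)).2)) ∧
      (∀ v : (Y.log.stalk (b t₀))ˣ, ((ρ v).1 : T₀.presheaf.stalk t₀) =
        b.stalkMap t₀ (Y.log.alphaStalk (b t₀) v)) ∧ ∀ m, (ρ m).2 = Associates.mk m := by
  have := hY.isSaturatedMonoid_stalk (b t₀)
  have := hY.fg_charStalk (b t₀)
  obtain ⟨s, hs⟩ := Associates.exists_section (M := Y.log.stalk (b t₀))
  -- The splitting `s` decomposes each element of the stalk into its class and a unit `v m`. The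
  -- unit part, pulled back to `T₀`, becomes the first component of `ρ`.
  have hex : ∀ m, ∃ v : (Y.log.stalk (b t₀))ˣ, s (Associates.mk m) * v = m := fun m =>
    Associates.mk_eq_mk_iff_associated.1 (hs _)
  choose v hv using hex
  have hv1 : ∀ a : (Y.log.stalk (b t₀))ˣ, v a = a := by
    intro a
    refine Units.ext ?_
    have h := hv a
    rwa [Associates.mk_eq_one.2 a.isUnit, map_one, one_mul] at h
  have hvm : ∀ m m', v (m * m') = v m * v m' := by
    intro m m'
    refine Units.ext (mul_left_cancel (a := s (Associates.mk (m * m'))) ?_)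
    rw [hv, ← Associates.mk_mul_mk, map_mul, Units.val_mul, mul_mul_mul_comm, hv, hv]
  let e : (Y.log.stalk (b t₀))ˣ →* (T₀.presheaf.stalk t₀)ˣ :=
    Units.map ((b.stalkMap t₀).hom.toMonoidHom.comp (Y.log.alphaStalk (b t₀)))
  let ρ : Y.log.stalk (b t₀) →* (T₀.presheaf.stalk t₀)ˣ × Y.log.charStalk (b t₀) :=
    { toFun := fun m => (e (v m), Associates.mk m)
      map_one' := Prod.ext ((congrArg e (hv1 1)).trans (map_one e)) rfl
      map_mul' := fun m m' => Prod.ext ((congrArg e (hvm m m')).trans (map_mul e _ _)) rfl }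
  obtain ⟨c, hc⟩ := LogScheme.exists_hollow_hom_of_subsingleton (S := Y)
    (Q := Y.log.charStalk (b t₀)) b t₀ ρ (fun m => by
      by_cases hm : IsUnit m
      · obtain ⟨a, rfl⟩ := hm
        have h1 : hollowVal (((ρ a).1 : T₀.presheaf.stalk t₀), (ρ a).2) = ((ρ a).1 : T₀.presheaf.stalk t₀) :=
          if_pos (Associates.mk_eq_one.2 a.isUnit)
        rw [h1]
        exact (congrArg (fun a => ((e a : (T₀.presheaf.stalk t₀)ˣ) : T₀.presheaf.stalk t₀)) (hv1 a)).symm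
      · have h1 : hollowVal (((ρ m).1 : T₀.presheaf.stalk t₀), (ρ m).2) = 0 :=
          if_neg (mt Associates.mk_eq_one.1 hm)
        rw [h1]
        refine stalk_eq_zero_of_not_isUnit t₀ fun h => hm ?_
        exact Y.log.isUnit_iff.2 (isUnit_of_map_unit (b.stalkMap t₀).hom _ h))
  refine ⟨ρ, c, hc.1, hc.2, fun a => ?_, fun m => rfl⟩
  exact congrArg (fun a => ((e a : (T₀.presheaf.stalk t₀)ˣ) : T₀.presheaf.stalk t₀)) (hv1 a)

lemma isFsMonoid_charStalk {X : Scheme.{u}} {L : LogStructure X} (hL : L.IsFs) (y : X) :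
    IsFsMonoid (L.charStalk y) := by
  have := hL.isSaturatedMonoid_stalk y
  have : IsSaturatedMonoid (L.charStalk y) := inferInstance
  exact ⟨hL.fg_charStalk y, fun a b c h => mul_left_cancel h, fun a b n hn h => dvd_of_pow_dvd_pow' hn h⟩

lemma hollowCoord_hollowChart_mul_unitSection {T : Scheme.{u}} {Q : Type u} [CommMonoid Q]
    [Subsingleton Qˣ] (t : T) (ht : t ∈ (⊤ : T.Opens)) (v : Γ(T, ⊤)ˣ) (q : Q) :
    hollowCoord ⊤ t ht (hollowChart q * ((hollowLog T Q).unitSection v : (hollowLog T Q).M.obj (op ⊤))) =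
      (T.presheaf.germ ⊤ t ht v, q) := by
  rw [map_mul, hollowCoord_unitSection]
  refine Prod.ext ?_ (mul_one q)
  exact (congrArg (· * _) (map_one (T.presheaf.germ ⊤ t ht).hom)).trans (one_mul _)

/-- The effect of a morphism of hollow log schemes in terms of coordinates. -/
lemma hollowCoord_comap_of_chart {T T' : Scheme.{u}} {Q Q' : Type u} [CommMonoid Q] [Subsingleton Qˣ]
    [CommMonoid Q'] [Subsingleton Q'ˣ] (ψ : hollow T' Q' ⟶ hollow T Q) {t : T'} {q : Q}
    {z : T'.presheaf.stalk t × Q'} (hψ : ψ.coord (hollowChart q) t = z)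
    {U : T.Opens} (ht : ψ.base t ∈ U) {s : (hollowLog T Q).M.obj (op U)} (v : Γ(T, ⊤)ˣ)
    (hs : hollowCoord U (ψ.base t) ht s = (T.presheaf.germ ⊤ (ψ.base t) trivial v, q)) :
    hollowCoord (ψ.base ⁻¹ᵁ U) t ht (ψ.comap U s) =
      (T'.presheaf.germ ⊤ t trivial (ψ.base.appTop v) * z.1, z.2) := by
  have h1 : (hollowLog T Q).germ U _ ht s = (hollowLog T Q).germ ⊤ (ψ.base t) trivial
      (hollowChart q * ((hollowLog T Q).unitSection v : (hollowLog T Q).M.obj (op ⊤))) := by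
    have h2 := hollowCoord_hollowChart_mul_unitSection (ψ.base t) trivial v q
    have h3 := hs.trans h2.symm
    exact hollowLog_germ_eq_iff.2 ⟨congrArg Prod.fst h3, congrArg Prod.snd h3⟩
  obtain ⟨W, hW, hWU, hWT, e⟩ := (hollowLog T Q).exists_res_eq ht
    (show ψ.base t ∈ (⊤ : T.Opens) from trivial) h1
  have hW' : t ∈ ψ.base ⁻¹ᵁ W := hW
  refine (ψ.hollowCoord_comap_res (S := hollow T Q) hWU s t hW').symm.trans ?_
  refine (congrArg (fun s => hollowCoord (ψ.base ⁻¹ᵁ W) t hW' (ψ.comap W s)) e).trans ?_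
  refine (ψ.hollowCoord_comap_res (S := hollow T Q) hWT _ t hW').trans ?_
  rw [map_mul, map_mul]
  refine (congrArg₂ (· * ·) hψ (ψ.hollowCoord_comap_unitSection (S := hollow T Q) v t trivial)).trans ?_
  exact Prod.ext (mul_comm _ _) (mul_one _)

end FieldPoint

/-! ### Uniqueness of points of the fibre product over a stratum -/

namespace StratumChart

variable {R : Type u} [CommRing R] [IsDomain R] [IsDiscreteValuationRing R] {ϖ : R}
  {X : Scheme.{u}} {f : X ⟶ Spec (CommRingCat.of R)} {x : X} {hϖ : Irreducible ϖ} {n k d : ℕ}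
  (c : StratumChart f x hϖ n k)
  {Y : LogScheme.{u}} {fst : Y ⟶ dagger f} {snd : Y ⟶ dagger (ramifiedCover ϖ d)}

/-- The root of the uniformizer on the fibre product. -/
def rootOn (snd : Y ⟶ dagger (ramifiedCover ϖ d)) (hϖ : Irreducible ϖ) (hd : 0 < d) :
    Y.log.M.obj (op ⊤) := snd.comap ⊤ (rootSection hϖ hd)

lemma rootOn_pow (hd : 0 < d) (hw : fst ≫ daggerHom f = snd ≫ daggerHom (ramifiedCover ϖ d)) :
    rootOn snd hϖ hd ^ d = fst.comap ⊤ (uniformizerOn f hϖ) := by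
  have h1 : (snd ≫ daggerHom (ramifiedCover ϖ d)).comap ⊤ (uniformizerSection ϖ hϖ) =
      rootOn snd hϖ hd ^ d := by
    refine (congrArg (fun m => snd.comap ⊤ m) (rootSection_pow hϖ hd).symm).trans ?_
    exact map_pow (snd.comap ⊤) _ _
  have h2 : ∀ {φ ψ : Y ⟶ traitDagger R} (h : φ = ψ) (m : (traitDagger R).log.M.obj (op ⊤)),
      (φ.comap ⊤ m : Y.log.M.obj (op ⊤)) = ψ.comap ⊤ m := by
    rintro φ _ rfl m
    rfl
  exact h1.symm.trans (h2 hw _).symm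

variable {T₀ : Scheme.{u}} [Subsingleton T₀] [IsReduced T₀]

/-- The monoid homomorphism on `Q` attached to a point of the fibre product. -/
lemma exists_monoidHom (hYs : Y.log.IsFs) (hd : 0 < d) {z : Y.scheme} (hz : fst.base z ∈ c.V)
    (hzs : fst.base z ∈ (dagger f).log.stratum x) (w : (Y.log.stalk z)ˣ)
    (hw : Y.log.germ (fst.base ⁻¹ᵁ c.V) z hz (fst.comap c.V (c.β c.p₁)) * w =
      Y.log.germ ⊤ z trivial (rootOn snd hϖ hd) ^ k) :
    ∃ Λ : c.Q →* Y.log.stalk z, (∀ q, IsUnit (Λ q) → q = 1) ∧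
      (∀ p, Λ (rootMonoid.of c.p₁ k p) * (w ^ (c.h p).toAdd : (Y.log.stalk z)ˣ) =
        Y.log.germ (fst.base ⁻¹ᵁ c.V) z hz (fst.comap c.V (c.β p))) ∧
      Λ (rootMonoid.root c.p₁ k) * (w ^ c.l : (Y.log.stalk z)ˣ) =
        Y.log.germ ⊤ z trivial (rootOn snd hϖ hd) := by
  have := hYs.isSaturatedMonoid_stalk z
  let g : c.P →* Y.log.stalk z :=
    ((Y.log.germ (fst.base ⁻¹ᵁ c.V) z hz).comp (fst.comap c.V)).comp c.β
  -- The twist by powers of `w` is undone here. With the root divided by `w ^ c.l`, the hypothesis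
  -- of the universal property becomes `1 - l * k = -h p₁` on exponents.
  let φ : c.P →* Y.log.stalk z :=
    g * ((Units.coeHom _).comp ((zpowersHom (Y.log.stalk z)ˣ w⁻¹).comp c.h))
  have hφ : ∀ p, φ p = g p * (w ^ (-(c.h p).toAdd) : (Y.log.stalk z)ˣ) := fun p => by
    rw [zpow_neg, ← inv_zpow]
    rfl
  obtain ⟨Λ, h1, h2, h3⟩ := rootMonoid.exists_lift c.k_pos c.pow_ne φ
    (Y.log.germ ⊤ z trivial (rootOn snd hϖ hd) * (w ^ (-c.l) : (Y.log.stalk z)ˣ)) (by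
      rw [mul_pow, ← hw, hφ, mul_assoc]
      congr 1
      rw [← Units.val_pow_eq_pow_val, ← Units.val_mul, ← zpow_natCast, ← zpow_mul, ← zpow_one_add]
      congr 2
      linear_combination c.hl)
  refine ⟨Λ, fun q hq => ?_, fun p => ?_, ?_⟩
  -- The `k`-th power of `Λ q` is the value of `φ` at `q`, viewed in `P`. So if `Λ q` is a unit, the
  -- chart takes a unit value at `q`, which on the stratum forces `q = 1`.
  · have h4 : IsUnit (g q.1) := by
      have h5 := hq.pow k
      rw [h3, hφ] at h5
      exact isUnit_of_mul_isUnit_left h5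
    have h6 : IsUnit (fst.base.stalkMap z (X.presheaf.germ c.V (fst.base z) hz
        ((dagger f).log.toΓ c.V (c.β q.1)))) := by
      refine (Scheme.Hom.germ_stalkMap_apply fst.base c.V z hz _).symm ▸ ?_
      refine (fst.toΓ_comap c.V (c.β q.1)) ▸ ?_
      exact Y.log.isUnit_germ_iff.1 h4
    exact Subtype.ext (c.eq_one _ hz hzs _ ((dagger f).log.isUnit_germ_iff.2
      (isUnit_of_map_unit (fst.base.stalkMap z).hom _ h6)))
  · rw [h1, hφ, mul_assoc, ← Units.val_mul, ← zpow_add, neg_add_cancel, zpow_zero, Units.val_one,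
      mul_one]
    rfl
  · rw [h2, mul_assoc, ← Units.val_mul, ← zpow_add, neg_add_cancel, zpow_zero, Units.val_one,
      mul_one]

/-- A field-valued point of the fibre product over the stratum is determined by its image in the
scheme of roots. -/
theorem comp_base_eq (hd : 0 < d)
    (hY : LogScheme.IsFsPullback fst snd (daggerHom f) (daggerHom (ramifiedCover ϖ d)))
    {T : Scheme.{u}} (τ : hollow T c.Q ⟶ Y) (w : Γ(T, ⊤)ˣ)
    (hτ : ∀ (p : c.P) (t : T) (ht : (τ ≫ fst).base t ∈ c.V),
        hollowCoord ((τ ≫ fst).base ⁻¹ᵁ c.V) t ht ((τ ≫ fst).comap c.V (c.β p)) =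
          (T.presheaf.germ ⊤ t trivial ((w ^ (c.h p).toAdd : Γ(T, ⊤)ˣ) : Γ(T, ⊤)), rootMonoid.of c.p₁ k p))
    (hτ' : ∀ t, (τ ≫ snd).coord (rootSection hϖ hd) t =
        (T.presheaf.germ ⊤ t trivial ((w ^ c.l : Γ(T, ⊤)ˣ) : Γ(T, ⊤)), rootMonoid.root c.p₁ k))
    (t₀ : T₀) (b : T₀ ⟶ Y.scheme) (e : T₀ ⟶ T) (hbV : fst.base (b t₀) ∈ c.V)
    (hbs : fst.base (b t₀) ∈ (dagger f).log.stratum x) (he : e ≫ (τ ≫ fst).base = b ≫ fst.base)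
    (wY : Γ(Y.scheme, fst.base ⁻¹ᵁ c.V)ˣ)
    (hwY : fst.comap c.V (c.β c.p₁) *
        (Y.log.unitSection wY : Y.log.M.obj (op (fst.base ⁻¹ᵁ c.V))) =
      Y.log.res le_top (rootOn snd hϖ hd ^ k))
    (hew : T₀.presheaf.germ ⊤ t₀ trivial (e.appTop w) =
      b.stalkMap t₀ (Y.scheme.presheaf.germ (fst.base ⁻¹ᵁ c.V) (b t₀) hbV wY)) :
    e ≫ τ.base = b := by
  obtain ⟨ρ, a, hab, ha, hρ, hρ'⟩ := exists_hollow_hom_of_field_point t₀ hY.isFs b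
  let W : (Y.log.stalk (b t₀))ˣ := Units.map (Y.log.germ _ _ hbV) (Y.log.unitSection wY)
  have hW : Y.log.germ (fst.base ⁻¹ᵁ c.V) (b t₀) hbV (fst.comap c.V (c.β c.p₁)) * W =
      Y.log.germ ⊤ (b t₀) trivial (rootOn snd hϖ hd) ^ k := by
    have h1 := congrArg (Y.log.germ (fst.base ⁻¹ᵁ c.V) (b t₀) hbV) hwY
    rw [map_mul] at h1
    exact h1.trans ((Y.log.germ_res le_top _ (show b t₀ ∈ fst.base ⁻¹ᵁ c.V from hbV) _).trans
      (map_pow _ _ _))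
  obtain ⟨Λ, hΛ, hΛ₁, hΛ₂⟩ := c.exists_monoidHom hY.isFs hd hbV hbs W hW
  let G : Γ(T₀, ⊤) ≃* T₀.presheaf.stalk t₀ := MulEquiv.ofBijective
    (T₀.presheaf.germ ⊤ t₀ trivial).hom.toMonoidHom (germ_top_bijective_of_subsingleton t₀)
  -- This is the log part of the morphism `ψ` over `e`, through which the lift `a` of `b` is to
  -- factor.
  let η : c.Q →* Γ(T₀, ⊤)ˣ × Y.log.charStalk (b t₀) :=
    (MonoidHom.prodMap (Units.mapEquiv G.symm).toMonoidHom (MonoidHom.id _)).comp (ρ.comp Λ)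
  have hη : ∀ q, T₀.presheaf.germ ⊤ t₀ trivial (η q).1 = (ρ (Λ q)).1 := fun q =>
    G.apply_symm_apply _
  have hη' : ∀ q, (η q).2 = Associates.mk (Λ q) := fun q => hρ' _
  have hw : ∀ j : ℤ, ((ρ (W ^ j : (Y.log.stalk (b t₀))ˣ)).1 : T₀.presheaf.stalk t₀) =
      T₀.presheaf.germ ⊤ t₀ trivial (e.appTop ((w ^ j : Γ(T, ⊤)ˣ) : Γ(T, ⊤))) := by
    intro j
    let e₁ : (Y.log.stalk (b t₀))ˣ →* (T₀.presheaf.stalk t₀)ˣ :=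
      (MonoidHom.fst _ _).comp (ρ.comp (Units.coeHom _))
    let e₂ : Γ(T, ⊤)ˣ →* (T₀.presheaf.stalk t₀)ˣ :=
      Units.map ((T₀.presheaf.germ ⊤ t₀ trivial).hom.toMonoidHom.comp e.appTop.hom.toMonoidHom)
    have h1 : e₁ W = e₂ w := by
      refine Units.ext ((hρ W).trans (Eq.trans ?_ hew.symm))
      exact congrArg _ ((Y.log.alphaStalk_germ _ _ _).trans (by rw [Y.log.toΓ_unitSection]))
    change ((e₁ (W ^ j) : (T₀.presheaf.stalk t₀)ˣ) : T₀.presheaf.stalk t₀) = (e₂ (w ^ j) : (T₀.presheaf.stalk t₀)ˣ)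
    rw [map_zpow, map_zpow, h1]
  have hkey : ∀ (q : c.Q) (j : ℤ) (m : Y.log.stalk (b t₀)),
      Λ q * (W ^ j : (Y.log.stalk (b t₀))ˣ) = m →
      (T₀.presheaf.germ ⊤ t₀ trivial (e.appTop ((w ^ j : Γ(T, ⊤)ˣ) : Γ(T, ⊤))) *
        T₀.presheaf.germ ⊤ t₀ trivial (η q).1, (η q).2) =
      (((ρ m).1 : T₀.presheaf.stalk t₀), (ρ m).2) := by
    rintro q j _ rfl
    refine Prod.ext ?_ ?_
    · rw [map_mul, Prod.fst_mul, Units.val_mul, hw, hη, mul_comm]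
    · change (η q).2 = _
      rw [map_mul, Prod.snd_mul, hη', hρ', hρ', Associates.mk_eq_one.2 (Units.isUnit _), mul_one]
  obtain ⟨ψ, hψ, hψ'⟩ : ∃ ψ : hollow T₀ (Y.log.charStalk (b t₀)) ⟶ hollow T c.Q, ψ.base = e ∧
      ∀ q, ∀ t, t = t₀ → ψ.coord (hollowChart q) t = (T₀.presheaf.germ ⊤ t trivial (η q).1, (η q).2) := by
    have := (isFsMonoid_charStalk hY.isFs (b t₀)).isSaturatedMonoid
    refine (LogScheme.exists_hollow_hom_of_chart (S := hollow T c.Q) e ⊤ (fun _ => trivial) hollowChart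
      (fun t => hollowChart_isChart _ trivial) η ?_).imp fun ψ ⟨h1, h2⟩ =>
        ⟨h1, fun q t _ => h2 q t trivial⟩
    intro q t
    obtain rfl := Subsingleton.elim t t₀
    refine (Scheme.Hom.germ_stalkMap_apply e ⊤ t trivial _).symm.trans ?_
    refine (congrArg (e.stalkMap t) (germ_toΓ_hollowLog (T := T) (Q := c.Q) (hollowChart q) _)).trans ?_
    by_cases hq : q = 1
    · have h1 : hollowVal (hollowCoord ⊤ (e t) trivial (hollowChart (1 : c.Q))) =
          (1 : T.presheaf.stalk (e t)) := by
        rw [map_one, map_one]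
        exact if_pos rfl
      rw [hq, map_one η]
      refine (congrArg (e.stalkMap t) h1).trans ((map_one (e.stalkMap t).hom).trans ?_)
      exact (map_one (T₀.presheaf.germ ⊤ t trivial).hom).symm.trans (if_pos rfl).symm
    · have h1 : (η q).2 ≠ 1 := by
        rw [hη']
        exact fun h => hq (hΛ q (Associates.mk_eq_one.1 h))
      exact ((congrArg _ (if_neg hq)).trans (map_zero (e.stalkMap t).hom)).trans (if_neg h1).symm
  subst hψ
  -- Both are morphisms from an fs log scheme to the fibre product, so comparison on the two factors
  -- is enough: on the chart `c.β` for the first, on the root of the uniformizer for the second. The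
  -- claim is the equality of underlying morphisms.
  have hmain : ψ ≫ τ = a := by
    refine fsPullback_hom_ext hϖ hd hY (isFsMonoid_charStalk hY.isFs (b t₀)) ?_ fun t => ?_
    · refine LogScheme.hom_ext_of_chart (he.trans (congrArg (· ≫ fst.base) hab.symm)) fun t => ?_
      obtain rfl := Subsingleton.elim t t₀
      have h1 : (τ ≫ fst).base (ψ.base t) = fst.base (b t) := congrArg (fun g : T₀ ⟶ X => g t) he
      have hV : (τ ≫ fst).base (ψ.base t) ∈ c.V := by
        rw [h1]
        exact hbV
      have hV' : (a ≫ fst).base t ∈ c.V := by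
        have h2 : (a ≫ fst).base t = fst.base (b t) := 
          congrArg (fun b : T₀ ⟶ Y.scheme => fst.base (b t)) hab
        rw [h2]
        exact hbV
      refine ⟨c.V, hV, hV', c.P, _, c.β, ?_, fun p => ?_⟩
      · exact c.isChartAt _ _ (h1 ▸ hbs)
      · refine (hollowCoord_comap_of_chart ψ (hψ' (rootMonoid.of c.p₁ k p) t rfl) hV _ (hτ p _ hV)).trans
          ((hkey _ _ _ (hΛ₁ p)).trans ?_)
        exact (ha (fst.base ⁻¹ᵁ c.V) _ hV' hbV).symm
    · obtain rfl := Subsingleton.elim t t₀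
      refine (hollowCoord_comap_of_chart ψ (hψ' (rootMonoid.root c.p₁ k) t rfl)
        (show ψ.base t ∈ (⊤ : T.Opens) from trivial) _ (hτ' _)).trans
          ((hkey _ _ _ hΛ₂).trans ?_)
      exact (ha ⊤ _ trivial trivial).symm
  exact (congrArg LogScheme.Hom.base hmain).trans hab

end StratumChart

/-! ### The fibre product over a stratum is locally a scheme of roots of a unit -/

lemma LogScheme.Hom.comap_unitSection {X Y : LogScheme.{u}} (φ : X ⟶ Y) {U : Y.scheme.Opens}
    (v : Γ(Y.scheme, U)ˣ) : φ.comap U (Y.log.unitSection v) =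
      X.log.unitSection (Units.map (φ.base.app U).hom.toMonoidHom v) := by
  have h1 : X.log.toΓ _ (φ.comap U (Y.log.unitSection v)) = φ.base.app U v :=
    (φ.toΓ_comap U _).trans (by rw [Y.log.toΓ_unitSection])
  refine X.log.toΓ_injective_of_isUnit ?_ ?_
  · rw [h1]
    exact v.isUnit.map (φ.base.app U).hom
  · rw [h1, LogStructure.toΓ_unitSection]
    rfl

lemma appTop_appLE_apply {S T X : Scheme.{u}} (a : S ⟶ T) (b : T ⟶ X) {U : X.Opens} (e : ⊤ ≤ b ⁻¹ᵁ U)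
    (e' : ⊤ ≤ (a ≫ b) ⁻¹ᵁ U) (s : Γ(X, U)) :
    a.appTop (b.appLE U ⊤ e s) = (a ≫ b).appLE U ⊤ e' s := by
  rw [← Scheme.Hom.appLE_comp_appLE a b U ⊤ ⊤ e le_rfl, CommRingCat.comp_apply]
  rw [Scheme.Hom.appTop, Scheme.Hom.app_eq_appLE]
  rfl

lemma comp_appLE_apply {S T X : Scheme.{u}} (a : S ⟶ T) (b : T ⟶ X) {U : X.Opens}
    (e : ⊤ ≤ a ⁻¹ᵁ b ⁻¹ᵁ U) (s : Γ(X, U)) {c : S ⟶ X} (hc : a ≫ b = c) (e' : ⊤ ≤ c ⁻¹ᵁ U) :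
    a.appLE (b ⁻¹ᵁ U) ⊤ e (b.app U s) = c.appLE U ⊤ e' s := by
  subst hc
  rw [Scheme.Hom.comp_appLE]
  rfl

lemma germ_appLE_apply {S X : Scheme.{u}} (a : S ⟶ X) {U : X.Opens} (e : ⊤ ≤ a ⁻¹ᵁ U) (s : Γ(X, U)) (t : S)
    (ht : a t ∈ U) : S.presheaf.germ ⊤ t trivial (a.appLE U ⊤ e s) =
      a.stalkMap t (X.presheaf.germ U (a t) ht s) :=
  (TopCat.Presheaf.germ_res_apply S.presheaf (homOfLE e) t (show t ∈ (⊤ : S.Opens) from trivial) _).trans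
    (Scheme.Hom.germ_stalkMap_apply a U t ht s).symm

namespace StratumChart

variable {R : Type u} [CommRing R] [IsDomain R] [IsDiscreteValuationRing R] {ϖ : R}
  {X : Scheme.{u}} {f : X ⟶ Spec (CommRingCat.of R)} {x : X} {hϖ : Irreducible ϖ} {n k d : ℕ}
  (c : StratumChart f x hϖ n k)
  {Y : LogScheme.{u}} {fst : Y ⟶ dagger f} {snd : Y ⟶ dagger (ramifiedCover ϖ d)}
  (hd : 0 < d) (hnk : d = n * k)
  (hY : LogScheme.IsFsPullback fst snd (daggerHom f) (daggerHom (ramifiedCover ϖ d)))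

include hnk hY in
/-- On the fibre product, the unit `v` acquires an `n`-th root. -/
lemma exists_root_unit : ∃ w : Γ(Y.scheme, fst.base ⁻¹ᵁ c.V)ˣ,
    fst.comap c.V (c.β c.p₁) * (Y.log.unitSection w : Y.log.M.obj (op (fst.base ⁻¹ᵁ c.V))) =
      Y.log.res le_top (rootOn snd hϖ hd ^ k) ∧
    (w : Γ(Y.scheme, fst.base ⁻¹ᵁ c.V)) ^ n = fst.base.app c.V c.v := by
  have h1 : (Y.log.res le_top (rootOn snd hϖ hd ^ k) : Y.log.M.obj (op (fst.base ⁻¹ᵁ c.V))) ^ n =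
      fst.comap c.V (c.β c.p₁) ^ n * (Y.log.unitSection (Units.map (fst.base.app c.V).hom.toMonoidHom c.v) :
        Y.log.M.obj (op (fst.base ⁻¹ᵁ c.V))) := by
    rw [← map_pow, ← pow_mul, mul_comm k, ← hnk, rootOn_pow hd hY.w]
    refine (fst.comap_res (homOfLE le_top) (uniformizerOn f hϖ)).symm.trans ?_
    refine (congrArg (fst.comap c.V) c.res_eq).trans ?_
    rw [map_mul, map_pow]
    exact congrArg _ (fst.comap_unitSection c.v)
  obtain ⟨w, hw, hw'⟩ := LogStructure.exists_eq_mul_unitSection_of_pow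
    hY.isFs.isSaturatedMonoid_stalk c.n_pos h1
  exact ⟨w, hw, by rw [← Units.val_pow_eq_pow_val, hw']; rfl⟩

/-- The pullback of the tautological root. -/
lemma appLE_root_unit {T : Scheme.{u}} (τ : hollow T c.Q ⟶ Y) (w : Γ(T, ⊤)ˣ)
    (hτ : ∀ (p : c.P) (t : T) (ht : (τ ≫ fst).base t ∈ c.V),
        hollowCoord ((τ ≫ fst).base ⁻¹ᵁ c.V) t ht ((τ ≫ fst).comap c.V (c.β p)) =
          (T.presheaf.germ ⊤ t trivial ((w ^ (c.h p).toAdd : Γ(T, ⊤)ˣ) : Γ(T, ⊤)), rootMonoid.of c.p₁ k p))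
    (hτ' : ∀ t, (τ ≫ snd).coord (rootSection hϖ hd) t =
        (T.presheaf.germ ⊤ t trivial ((w ^ c.l : Γ(T, ⊤)ˣ) : Γ(T, ⊤)), rootMonoid.root c.p₁ k))
    (wY : Γ(Y.scheme, fst.base ⁻¹ᵁ c.V)ˣ)
    (hwY : fst.comap c.V (c.β c.p₁) *
        (Y.log.unitSection wY : Y.log.M.obj (op (fst.base ⁻¹ᵁ c.V))) =
      Y.log.res le_top (rootOn snd hϖ hd ^ k))
    (hV : ⊤ ≤ τ.base ⁻¹ᵁ fst.base ⁻¹ᵁ c.V) :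
    τ.base.appLE (fst.base ⁻¹ᵁ c.V) ⊤ hV wY = w := by
  refine Scheme.section_ext fun t ht => ?_
  have ht' : t ∈ τ.base ⁻¹ᵁ fst.base ⁻¹ᵁ c.V := hV ht
  refine (TopCat.Presheaf.germ_res_apply T.presheaf (homOfLE hV) t ht _).trans ?_
  have h1 := congrArg (fun m => hollowCoord (τ.base ⁻¹ᵁ fst.base ⁻¹ᵁ c.V) t ht'
    (τ.comap (fst.base ⁻¹ᵁ c.V) m)) hwY
  have h2 : hollowCoord (τ.base ⁻¹ᵁ fst.base ⁻¹ᵁ c.V) t ht'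
      (τ.comap (fst.base ⁻¹ᵁ c.V) (Y.log.res le_top (rootOn snd hϖ hd ^ k))) =
      (T.presheaf.germ ⊤ t trivial ((w ^ c.l : Γ(T, ⊤)ˣ) : Γ(T, ⊤)), rootMonoid.root c.p₁ k) ^ k := by
    refine (τ.hollowCoord_comap_res le_top _ t ht').trans ?_
    rw [map_pow, map_pow]
    exact congrArg (· ^ k) (hτ' t)
  have h3 := (congrArg₂ (· * ·) (hτ c.p₁ t ht') (τ.hollowCoord_comap_unitSection wY t ht')).symm.trans
    (((map_mul _ _ _).symm.trans (congrArg _ (map_mul _ _ _).symm)).trans (h1.trans h2))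
  -- First coordinates of the pullback of `hwY`. By `c.hl` the right-hand side is also `w ^ h p₁ *
  -- w`, and cancelling `w ^ h p₁` identifies the pullback of `wY` with `w`.
  have h4 : T.presheaf.germ ⊤ t trivial ((w ^ (c.h c.p₁).toAdd : Γ(T, ⊤)ˣ) : Γ(T, ⊤)) *
      T.presheaf.germ _ t ht' (τ.base.app _ wY) =
      T.presheaf.germ ⊤ t trivial ((w ^ c.l : Γ(T, ⊤)ˣ) : Γ(T, ⊤)) ^ k := congrArg Prod.fst h3
  have h5 : w ^ (c.h c.p₁).toAdd * w = (w ^ c.l) ^ k := by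
    rw [← zpow_natCast, ← zpow_mul, ← c.hl, zpow_add_one]
  have h6 := congrArg (fun a : Γ(T, ⊤)ˣ => T.presheaf.germ ⊤ t trivial (a : Γ(T, ⊤))) h5
  simp only [Units.val_mul, Units.val_pow_eq_pow_val, map_mul, map_pow] at h6
  exact ((Units.isUnit _).map (T.presheaf.germ ⊤ t trivial).hom).mul_left_cancel (h4.trans h6.symm)

variable {W Z : Scheme.{u}} [IsReduced W] [IsReduced Z] (iW : W ⟶ Y.scheme) (iZ : Z ⟶ X)
  [IsImmersion iW] [IsImmersion iZ] (q : W ⟶ Z) (hq : q ≫ iZ = iW ≫ fst.base)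
  (hW : Set.range iW = fst.base ⁻¹' (dagger f).log.stratum x)
  (hZ : Set.range iZ = (dagger f).log.stratum x)

include hd hnk hY hq hW hZ in
/-- Locally on the stratum, its inverse image in the fibre product is a scheme of roots of a unit. -/
theorem exists_rootCover_iso {C : CommRingCat.{u}} (j : Spec C ⟶ Z) [IsOpenImmersion j]
    (hj : ∀ t, iZ (j t) ∈ c.V) (hn : IsUnit (n : C)) :
    ∃ (r : C) (τ : rootCover r n ⟶ Limits.pullback q j), IsUnit r ∧ IsIso τ ∧
      τ ≫ Limits.pullback.snd q j = rootCoverHom r n := by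
  have hjV : ⊤ ≤ (j ≫ iZ) ⁻¹ᵁ c.V := fun t _ => hj t
  let r : C := (Scheme.ΓSpecIso C).hom ((j ≫ iZ).appLE c.V ⊤ hjV c.v)
  have hr : (Scheme.ΓSpecIso C).inv r = (j ≫ iZ).appLE c.V ⊤ hjV c.v :=
    ConcreteCategory.congr_hom (Scheme.ΓSpecIso C).hom_inv_id _
  have hru : IsUnit r := (c.v.isUnit.map ((j ≫ iZ).appLE c.V ⊤ hjV).hom).map (Scheme.ΓSpecIso C).hom.hom
  have : IsReduced (Spec C) := isReduced_of_isOpenImmersion j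
  have : _root_.IsReduced C := (affine_isReduced_iff C).1 this
  have : IsReduced (rootCover r n) := isReduced_rootCover c.n_pos.ne' hru hn
  have hW' : IsReduced (Limits.pullback q j) := isReduced_of_isOpenImmersion (Limits.pullback.fst q j)
  let g : rootCover r n ⟶ X := rootCoverHom r n ≫ j ≫ iZ
  have hgV : ∀ t, g t ∈ c.V := fun t => hj (rootCoverHom r n t)
  have hgs : ∀ t, g t ∈ (dagger f).log.stratum x := fun t => hZ ▸ ⟨j (rootCoverHom r n t), rfl⟩
  have hpow : rootCoverRoot r n ^ n = g.appLE c.V ⊤ (fun t _ => hgV t) c.v := by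
    rw [rootCoverRoot_pow, hr]
    exact appTop_appLE_apply _ _ _ _ _
  have hwu : IsUnit (rootCoverRoot r n) := by
    refine (isUnit_pow_iff c.n_pos.ne').1 ?_
    rw [hpow]
    exact c.v.isUnit.map (g.appLE c.V ⊤ _).hom
  obtain ⟨wY, hwY, hwY'⟩ := c.exists_root_unit hd hnk hY
  obtain ⟨τ, hτg, hτ, hτ'⟩ := c.exists_hollow_hom g hgV hgs hd hnk hY hwu.unit hpow
  -- the section
  obtain ⟨l, hl⟩ := exists_lift_of_isImmersion iW τ.base (by
    rw [hW]
    rintro _ ⟨t, rfl⟩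
    have h1 := hgs t
    rwa [← hτg] at h1)
  have hlq : l ≫ q = rootCoverHom r n ≫ j := by
    rw [← cancel_mono iZ, Category.assoc, hq, ← Category.assoc, hl, Category.assoc]
    exact hτg
  let τ' : rootCover r n ⟶ Limits.pullback q j := Limits.pullback.lift l (rootCoverHom r n) hlq
  have hτ'1 : τ' ≫ Limits.pullback.fst q j = l := Limits.pullback.lift_fst _ _ _
  have hτ'2 : τ' ≫ Limits.pullback.snd q j = rootCoverHom r n := Limits.pullback.lift_snd _ _ _
  let y : Limits.pullback q j ⟶ Y.scheme := Limits.pullback.fst q j ≫ iW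
  have hyX : y ≫ fst.base = Limits.pullback.snd q j ≫ j ≫ iZ := by
    rw [Category.assoc, ← hq, ← Category.assoc, Limits.pullback.condition, Category.assoc]
  have hyV : ∀ t, fst.base (y t) ∈ c.V := fun t => by
    have h1 : fst.base (y t) = iZ (j (Limits.pullback.snd q j t)) :=
      congrArg (fun a : Limits.pullback q j ⟶ X => a t) hyX
    rw [h1]
    exact hj _
  have hys : ∀ t, fst.base (y t) ∈ (dagger f).log.stratum x := fun t => by
    have h1 : y t ∈ Set.range iW := ⟨Limits.pullback.fst q j t, rfl⟩
    rwa [hW] at h1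
  have hyV' : ⊤ ≤ y ⁻¹ᵁ fst.base ⁻¹ᵁ c.V := fun t _ => hyV t
  -- the retraction
  obtain ⟨ω, hω, hω'⟩ := exists_rootCover_hom (n := n) (c := r) (Limits.pullback.snd q j)
    (y.appLE _ ⊤ hyV' wY) (by
      rw [hr, ← map_pow, hwY']
      exact (comp_appLE_apply y fst.base hyV' _ hyX (fun t _ => hj _)).trans
        (appTop_appLE_apply (Limits.pullback.snd q j) (j ≫ iZ) hjV (fun t _ => hj _) _).symm)
  have hτ'y : τ' ≫ y = τ.base := by rw [← Category.assoc, hτ'1, hl]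
  have hτω : τ' ≫ ω = 𝟙 _ := by
    refine rootCover_hom_ext (by rw [Category.assoc, hω, hτ'2, Category.id_comp]) ?_
    rw [Scheme.Hom.comp_appTop, CommRingCat.comp_apply, hω',
      appTop_appLE_apply τ' y hyV' (fun t _ => hyV (τ' t))]
    have h1 : ⊤ ≤ τ.base ⁻¹ᵁ fst.base ⁻¹ᵁ c.V := fun t _ => by
      have h2 := hgV t
      rwa [← hτg] at h2
    have h3 : ∀ {a b : rootCover r n ⟶ Y.scheme} (h : a = b) (ha : ⊤ ≤ a ⁻¹ᵁ fst.base ⁻¹ᵁ c.V)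
        (hb : ⊤ ≤ b ⁻¹ᵁ fst.base ⁻¹ᵁ c.V), a.appLE _ ⊤ ha wY = b.appLE _ ⊤ hb wY := by
      rintro a _ rfl ha hb
      rfl
    refine (h3 hτ'y _ h1).trans ((c.appLE_root_unit hd τ hwu.unit hτ hτ' wY hwY h1).trans ?_)
    simp
  -- A section of a morphism is an immersion.
  have : IsImmersion (τ' ≫ ω) := by rw [hτω]; infer_instance
  have : IsImmersion τ' := IsImmersion.of_comp τ' ω
  -- The point `v` is tested through its residue field: by `comp_base_eq` the corresponding morphism
  -- is unchanged by `ω` followed by `τ'`, so `v` is in the image.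
  have : Surjective τ' := ⟨fun v => by
    let p := (Limits.pullback q j).fromSpecResidueField v
    have t₀ : Spec ((Limits.pullback q j).residueField v) := IsLocalRing.closedPoint _
    have h1 := c.comp_base_eq hd hY τ hwu.unit hτ hτ' t₀ (p ≫ y) (p ≫ ω) (hyV _) (hys _) (by
      rw [hτg, Category.assoc, Category.assoc, hyX, ← hω, Category.assoc]) wY hwY (by
      have h2 : (p ≫ ω).appTop (rootCoverRoot r n) =
          (p ≫ y).appLE (fst.base ⁻¹ᵁ c.V) ⊤ (fun t _ => hyV (p t)) wY := by
        rw [Scheme.Hom.comp_appTop, CommRingCat.comp_apply, hω',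
          appTop_appLE_apply p y hyV' (fun t _ => hyV (p t))]
      refine (congrArg _ h2).trans ?_
      exact germ_appLE_apply _ _ _ _ _)
    have h2 : p ≫ ω ≫ τ' = p := by
      rw [← cancel_mono y, Category.assoc, Category.assoc, hτ'y, ← Category.assoc]
      exact h1
    refine ⟨ω (p t₀), ?_⟩
    have h3 := congrArg (fun a : Spec ((Limits.pullback q j).residueField v) ⟶ _ => a t₀) h2
    exact h3.trans (Scheme.fromSpecResidueField_apply v t₀)⟩
  exact ⟨r, τ', hru, isIso_of_isImmersion_of_surjective τ', hτ'2⟩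

end StratumChart

/-! ### Existence of stratum charts -/

section StratumChart

variable {R : Type u} [CommRing R] [IsDomain R] [IsDiscreteValuationRing R] {ϖ : R}

/-- Divisibility of the class of `ϖ` by divisors of `d` is the same at `y` as at `x`, so the `n`-th
root `p₁` exists at `y`, and maximality of `n` prevents `p₁` from being an `l`-th power for primes
`l ∣ k`. The identity of classes then spreads out, up to a unit, to a neighbourhood. -/
theorem exists_stratumChart {X : Scheme.{u}} [IsLocallyNoetherian X]
    {f : X ⟶ Spec (CommRingCat.of R)} {x : X} (hϖ : Irreducible ϖ) (hL : (dagger f).log.IsFs)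
    {d n k : ℕ} (hd : 0 < d) (hk : d = n * k)
    (hn : ∃ a : (dagger f).log.charStalk x,
      a ^ n = (dagger f).log.charGerm ⊤ x trivial (uniformizerOn f hϖ))
    (hmax : ∀ m, m ∣ d → (∃ a : (dagger f).log.charStalk x,
      a ^ m = (dagger f).log.charGerm ⊤ x trivial (uniformizerOn f hϖ)) → m ≤ n)
    {y : X} (hy : y ∈ (dagger f).log.stratum x) :
    ∃ c : StratumChart f x hϖ n k, y ∈ c.V := by
  have hn0 : 0 < n := Nat.pos_of_ne_zero (by rintro rfl; simp at hk; omega)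
  have hk0 : 0 < k := Nat.pos_of_ne_zero (by rintro rfl; simp at hk; omega)
  have hiff : ∀ m, (∃ a : (dagger f).log.charStalk y,
      a ^ m = (dagger f).log.charGerm ⊤ y trivial (uniformizerOn f hϖ)) ↔ _ := fun m =>
    LogStructure.exists_pow_eq_charGerm_iff_of_mem_stratum hL hy
      (show y ∈ (⊤ : X.Opens) from trivial) (show x ∈ (⊤ : X.Opens) from trivial)
  obtain ⟨p₁, hp₁⟩ := (hiff n).2 hn
  have := hL.isSaturatedMonoid_stalk y
  have := hL.fg_charStalk y
  have := isMulTorsionFree_of_sharp (M := (dagger f).log.charStalk y)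
  have hpow : ∀ l : ℕ, l.Prime → l ∣ k → ∀ c : (dagger f).log.charStalk y, c ^ l ≠ p₁ :=
    pow_ne_of_maximal hd hk (fun m hm h => hmax m hm ((hiff m).1 h)) hp₁
  obtain ⟨h, l, hl⟩ := exists_linearForm hpow
  obtain ⟨V, hyV, β, hβ, hchart⟩ := LogStructure.exists_charStalk_chart hL
    (divisorialLog_toΓ_injective _) hy
  have h1 : (dagger f).log.charGerm V y hyV (β p₁ ^ n) =
      (dagger f).log.charGerm ⊤ y trivial (uniformizerOn f hϖ) := by
    rw [LogStructure.charGerm_pow, hβ, hp₁]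
  obtain ⟨v, hv⟩ := (LogStructure.charGerm_eq_iff _ _).1 h1
  obtain ⟨W, hyW, hWT, hWV, w, hw, -⟩ := (dagger f).log.exists_res_eq_mul_unitSection
    (show y ∈ (⊤ : X.Opens) from trivial) hyV (uniformizerOn f hϖ) (β p₁ ^ n) v hv
  refine ⟨{
    V := W
    P := (dagger f).log.charStalk y
    β := ((dagger f).log.res hWV).comp β
    isChartAt := fun z hz hzs => ((hchart z (hWV hz) hzs).1).res hWV
    eq_one := fun z hz hzs p hp => (hchart z (hWV hz) hzs).2 p (by
      rwa [MonoidHom.comp_apply, (dagger f).log.germ_res hWV z hz] at hp)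
    p₁ := p₁
    v := w
    res_eq := by
      rw [MonoidHom.comp_apply, ← map_pow]
      exact hw
    n_pos := hn0
    k_pos := hk0
    pow_ne := hpow
    h := h
    l := l
    hl := hl }, hyW⟩

end StratumChart

/-! ### Morphisms locally given by roots of units -/

lemma isZariskiLocalAtTarget_isFinite : IsZariskiLocalAtTarget @IsFinite.{u} := by
  have := (HasAffineProperty.affineAnd_iff @IsFinite.{u} RingHom.finite_respectsIso
    RingHom.finite_localizationPreserves.away RingHom.finite_ofLocalizationSpan).2
    (by simp [isFinite_iff])
  exact HasAffineProperty.instIsZariskiLocalAtTarget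

lemma isZariskiLocalAtTarget_etale : IsZariskiLocalAtTarget @Etale.{u} :=
  have := HasRingHomProperty.HasAffineProperty @Etale.{u}
  HasAffineProperty.instIsZariskiLocalAtTarget

/-- A morphism that is locally on the target a scheme of `n`-th roots of a unit, with `n`
invertible, is finite étale of degree `n`. -/
theorem finite_etale_finrank_of_rootCover {W Z : Scheme.{u}} (q : W ⟶ Z) {n : ℕ} (hn : n ≠ 0)
    (H : ∀ z : Z, ∃ (C : CommRingCat.{u}) (j : Spec C ⟶ Z) (_ : IsOpenImmersion j), z ∈ Set.range j ∧
      IsUnit (n : C) ∧ ∃ (r : C) (τ : rootCover r n ⟶ Limits.pullback q j), IsUnit r ∧ IsIso τ ∧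
        τ ≫ Limits.pullback.snd q j = rootCoverHom r n) :
    IsFinite q ∧ Etale q ∧ ∀ z, q.finrank z = n := by
  have key : ∀ (P : MorphismProperty Scheme.{u}), IsZariskiLocalAtTarget P →
      (∀ (C : CommRingCat.{u}) (r : C), IsUnit (n : C) → IsUnit r → P (rootCoverHom r n)) → P q := by
    intro P _ hP
    refine IsZariskiLocalAtTarget.of_forall_exists_morphismRestrict fun z => ?_
    obtain ⟨C, j, _, hz, hnC, r, τ, hr, _, hτ⟩ := H z
    refine ⟨j.opensRange, hz, ?_⟩
    -- Restriction to the image of `j` is base change along `j`, which `τ` identifies with the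
    -- scheme of roots.
    rw [P.arrow_mk_iso_iff (morphismRestrictOpensRange q j), ← P.cancel_left_of_respectsIso τ, hτ]
    exact hP C r hnC hr
  have h1 : IsFinite q := key @IsFinite isZariskiLocalAtTarget_isFinite fun C r _ _ => isFinite_rootCoverHom hn
  have h2 : Etale q := key @Etale isZariskiLocalAtTarget_etale fun C r hnC hr => etale_rootCoverHom hn hr hnC
  refine ⟨h1, h2, fun z => ?_⟩
  obtain ⟨C, j, _, ⟨t, rfl⟩, hnC, r, τ, hr, _, hτ⟩ := H z
  rw [← Scheme.Hom.finrank_pullback_snd, ← Scheme.Hom.finrank_comp_left_of_isIso τ, hτ]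
  exact finrank_rootCoverHom hn t

/-- Being prime to the residue characteristic, `n` is nonzero in the residue field and so a unit in
the local ring `R`; units map to units. -/
lemma isUnit_natCast_of_hom_Spec {R : Type u} [CommRing R] [IsLocalRing R] {p n : ℕ}
    [CharP (IsLocalRing.ResidueField R) p] (hp : p.Prime) (hn : Nat.Coprime n p) {C : CommRingCat.{u}}
    (g : Spec C ⟶ Spec (CommRingCat.of R)) : IsUnit (n : C) := by
  have h1 : IsUnit (n : R) := by
    rw [← IsLocalRing.notMem_maximalIdeal, ← IsLocalRing.residue_eq_zero_iff, map_natCast,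
      CharP.cast_eq_zero_iff _ p]
    intro h
    exact hp.one_lt.ne' (Nat.eq_one_of_dvd_coprimes hn h dvd_rfl)
  have h2 := h1.map (Spec.preimage g).hom
  rwa [map_natCast] at h2

end

theorem mainTheorem8
    -- a complete discrete valuation ring with algebraically closed residue field
    -- of characteristic `p > 0`, and its fraction field
    {R : Type u} [CommRing R] [IsDomain R] [IsDiscreteValuationRing R]
    [IsAdicComplete (IsLocalRing.maximalIdeal R) R]
    [IsAlgClosed (IsLocalRing.ResidueField R)]
    (p : ℕ) [Fact p.Prime] [CharP (IsLocalRing.ResidueField R) p]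
    (K : Type u) [Field K] [Algebra R K] [IsFractionRing R K]
    -- a proper, flat `R`-scheme with smooth generic fibre such that `𝒳†` is log regular
    (𝒳 : Scheme.{u}) (f : 𝒳 ⟶ Spec (CommRingCat.of R)) [IsProper f] [Flat f]
    [Smooth (Limits.pullback.snd f (Spec.map (CommRingCat.ofHom (algebraMap R K))))]
    (hreg : (dagger f).log.IsLogRegular)
    -- a point of the fan, an integer prime to `p`, a uniformizer
    (x : 𝒳) (hx : x ∈ (dagger f).log.fan)
    (d : ℕ) (hd : 0 < d) (hdp : Nat.Coprime d p)
    (ϖ : R) (hϖ : Irreducible ϖ)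
    -- `Y = 𝒳(d)†` is the fibre product of `𝒳†` and `S(d)†` over `S†` in fs log schemes
    (Y : LogScheme.{u}) (fst : Y ⟶ dagger f) (snd : Y ⟶ dagger (ramifiedCover ϖ d))
    (hY : LogScheme.IsFsPullback fst snd (daggerHom f) (daggerHom (ramifiedCover ϖ d))) :
    IsLocallyClosed ((dagger f).log.stratum x) ∧
    ∃ q : reducedSubscheme (X := Y.scheme) (fst.base ⁻¹' (dagger f).log.stratum x) ⟶
        reducedSubscheme (X := 𝒳) ((dagger f).log.stratum x),
      q ≫ reducedSubschemeι (X := 𝒳) ((dagger f).log.stratum x) =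
        reducedSubschemeι (X := Y.scheme) (fst.base ⁻¹' (dagger f).log.stratum x) ≫ fst.base ∧
      IsFinite q ∧ Etale q ∧
      ∃ n : ℕ, (∀ z, q.finrank z = n) ∧ n ∣ d ∧
        ∀ y ∈ (dagger f).log.fan, (dagger f).log.height y = 1 → y ⤳ x →
          n ∣ saturationIndex (daggerHom f) ϖ hϖ y := by
  have : IsLocallyNoetherian 𝒳 := LocallyOfFiniteType.isLocallyNoetherian f
  have hL := hreg.1
  have hlc := LogStructure.isLocallyClosed_stratum hL x
  have hrZ := range_reducedSubschemeι (X := 𝒳) ((dagger f).log.stratum x) hlc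
  have hrW := range_reducedSubschemeι (X := Y.scheme) (fst.base ⁻¹' (dagger f).log.stratum x)
    (hlc.preimage fst.base.continuous)
  obtain ⟨q, hq⟩ := exists_lift_of_isImmersion
    (reducedSubschemeι (X := 𝒳) ((dagger f).log.stratum x))
    (reducedSubschemeι (X := Y.scheme) (fst.base ⁻¹' (dagger f).log.stratum x) ≫ fst.base) (by
      rw [hrZ]
      rintro _ ⟨t, rfl⟩
      exact hrW.subset ⟨t, rfl⟩)
  -- the degree is the largest divisor of `d` by which the class of the uniformizer is divisible
  obtain ⟨n, ⟨hnd, hn⟩, hmax⟩ : ∃ n, (n ∣ d ∧ ∃ a : (dagger f).log.charStalk x,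
      a ^ n = (dagger f).log.charGerm ⊤ x trivial (uniformizerOn f hϖ)) ∧
      ∀ m, m ∣ d → (∃ a : (dagger f).log.charStalk x,
        a ^ m = (dagger f).log.charGerm ⊤ x trivial (uniformizerOn f hϖ)) → m ≤ n := by
    classical
    let S := d.divisors.filter fun m => ∃ a : (dagger f).log.charStalk x,
      a ^ m = (dagger f).log.charGerm ⊤ x trivial (uniformizerOn f hϖ)
    have hS : S.Nonempty := ⟨1, Finset.mem_filter.2
      ⟨Nat.one_mem_divisors.2 hd.ne', _, pow_one _⟩⟩
    have h1 := Finset.mem_filter.1 (S.max'_mem hS)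
    exact ⟨S.max' hS, ⟨Nat.dvd_of_mem_divisors h1.1, h1.2⟩, fun m hm h => S.le_max' m
      (Finset.mem_filter.2 ⟨Nat.mem_divisors.2 ⟨hm, hd.ne'⟩, h⟩)⟩
  obtain ⟨k, hk⟩ := hnd
  have hn0 : n ≠ 0 := by
    rintro rfl
    rw [Nat.zero_mul] at hk
    exact hd.ne' hk
  have hnp : Nat.Coprime n p := Nat.Coprime.of_dvd_left ⟨k, hk⟩ hdp
  obtain ⟨h1, h2, h3⟩ := finite_etale_finrank_of_rootCover q hn0 fun z => by
    obtain ⟨c, hc⟩ := exists_stratumChart hϖ hL hd hk hn hmax (hrZ.subset ⟨z, rfl⟩)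
    obtain ⟨_, ⟨V, hV, rfl⟩, hzV, hVc⟩ := (reducedSubscheme (X := 𝒳)
      ((dagger f).log.stratum x)).isBasis_affineOpens.exists_subset_of_mem_open
      (show z ∈ (reducedSubschemeι (X := 𝒳) ((dagger f).log.stratum x) ⁻¹ᵁ c.V) from hc)
      (reducedSubschemeι (X := 𝒳) ((dagger f).log.stratum x) ⁻¹ᵁ c.V).2
    have hrange : Set.range hV.fromSpec = V := hV.range_fromSpec
    have hj : IsOpenImmersion hV.fromSpec := hV.isOpenImmersion_fromSpec
    have hu := isUnit_natCast_of_hom_Spec (Fact.out : p.Prime) hnp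
      (hV.fromSpec ≫ reducedSubschemeι (X := 𝒳) ((dagger f).log.stratum x) ≫ f)
    exact ⟨_, hV.fromSpec, hj, hrange.symm ▸ hzV, hu,
      c.exists_rootCover_iso hd hk hY _ _ q hq hrW hrZ hV.fromSpec
        (fun t => hVc (hrange.subset ⟨t, rfl⟩)) hu⟩
  refine ⟨hlc, q, hq, h1, h2, n, h3, ⟨k, hk⟩, fun y _ _ hyx => ?_⟩
  -- An `n`-th root of the class of `ϖ` at `x` induces one at the generization `y`, where the order
  -- of that class is the saturation index.
  obtain ⟨a, ha⟩ := LogStructure.exists_pow_eq_charGerm_of_specializes hyx _ hn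
  exact dvd_monoidOrder ha
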